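/- **Language.** Formulas of $\mu\mathsf{PA}$ are built from the atoms $s<t$, $s\not<t$, $s=t$, $s\neq t$ ($s,t$ terms over $0,\mathsf s,+,\times$), $t\in X$, $t\in\mu Xx\,\phi$, $t\in\nu Xx\,\phi$ by $\wedge,\vee,\forall x,\exists x$; every set variable is bound by a fixed point and occurs only positively in its body. Negation is defined by De Morgan duality, with $\neg\,t\in\mu Xx\,\phi(X):=t\in\nu Xx\,\neg\phi(\neg X)$ and dually. Sequents are lists of formulas. Annotated formulas may also contain $\mu^\kappa Xx\,\phi$ and $\nu^\kappa Xx\,\phi$ with $\kappa$ from an enumerated countable set $\xi_0,\xi_1,\dots$ of ordinal variables. **Coderivations.** A coderivation is a possibly infinite (at most binary) tree of rule instances, each deriving a conclusion from the conclusions of its children. The rules of $\mu\mathsf{PA}$-coderivations are the following (premises / conclusion): the axioms $\Gamma,\neg\phi,\phi$ ($\mathsf{id}$), $t=t$, the Peano axioms $\mathsf{PA}_1$–$\mathsf{PA}_7$ for successor, $+$, $\times$, $<$, and $t\in\mathbf N$ with $\mathbf N=\mu Xx(x=0\vee\exists y(y\in X\wedge x=\mathsf s y))$; weakening $\Gamma/\Gamma,\Delta$;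 exchange $\Gamma,\psi,\phi,\Delta/\Gamma,\phi,\psi,\Delta$; substitution of terms for free variables $\Gamma/\theta(\Gamma)$; cut $\Gamma,\phi\mid\Gamma,\neg\phi\,/\,\Gamma$; $\Gamma,\phi\mid\Gamma,\psi\,/\,\Gamma,\phi\wedge\psi$; $\Gamma,\phi,\psi/\Gamma,\phi\vee\psi$; $\Gamma,\phi[y/x]/\Gamma,\forall x\phi$ ($y$ fresh); $\Gamma,\phi(t)/\Gamma,\exists x\phi$; $\Gamma(s)/\Gamma(t),s\neq t$; and, for $\sigma\in\{\mu,\nu\}$, the unfolding rules $\Gamma,\phi(t,\sigma Xx\phi)\,/\,\Gamma,t\in\sigma Xx\phi$, where $\phi(t,S)=\phi[S/X,t/x]$. **Progress.** A trace along an infinite branch is a sequence $(\phi_i)_{i\ge k}$ of formula occurrences, $\phi_i$ in the $i$-th sequent of the branch, where for each $i$ the occurrences $\phi_i,\phi_{i+1}$ are the same side formula (or the same exchanged formula), or $\phi_i$ is principal and $\phi_{i+1}$ active in the $i$-th rule. A set term $\sigma Xx\phi$ progresses at $i$ if $\phi_i=t\in\sigma Xx\phi$ is unfolded there. The trace is progressing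 if some $\nu$-term progresses infinitely often and has the minimal number of symbols among all set terms that progress infinitely often, where each occurrence of a number term counts as one symbol. A progressing proof is a coderivation each of whose infinite branches has a progressing trace. **Annotated coderivations.** A constraint $\mathcal O$ is a finite set of ordinal variables with a strict partial order $<_{\mathcal O}$ in which the elements above any given one are linearly ordered. $\mathcal O+\lambda$ adds $\lambda$ as a new root, $\mathcal O+_\kappa\lambda$ adds $\lambda$ as a new child of $\kappa$ (below $\kappa$ and everything above it), and $\mathcal O\setminus L$ restricts $\mathcal O$ to the variables outside $L$. An extended sequent $\mathcal O:\Gamma$ consists of a constraint and an annotated sequent, all of whose ordinal variables lie in $\mathcal O$. Annotated coderivations use: the rules above except $\nu$, with the constraint unchanged; $\mathcal O+\lambda:\Gamma,t\in\nu^\lambda Xx\phi\;/\;\mathcal O:\Gamma,t\in\nu Xx\phi$ and $(\nu^\kappa)$ $\mathcal O+_\kappa\lambda:\Gamma,\phi(t,\nu^\lambda Xx\phi)\;/\;\mathcal O:\Gamma,t\in\nu^\kappa Xx\phi$ with $\lambda\notin\mathcal O$; constraint weakening $\mathcal O\setminus L:\Gamma\,/\,\mathcal O:\Gamma$; its special case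 $\mathsf{RS}(\kappa)$, where $\kappa\in\mathcal O$ does not occur in $\Gamma$ and $L$ is the non-empty set of children of $\kappa$ in $\mathcal O$ (none of which occurs in $\Gamma$); and its special case $\mathsf{pr}$, where $L$ is the non-empty set of variables of $\mathcal O$ such that neither they nor anything below them occurs in $\Gamma$. Along an infinite branch, $\kappa$ is stable if it belongs to all but finitely many of the constraints, and it is a reset variable if $\mathsf{RS}(\kappa)$ occurs infinitely often. A reset proof is an annotated coderivation each of whose infinite branches has a stable reset variable. **Translation.** An ordinal assignment $\ell$ for $\phi$ is a list over the ordinal variables and $\star$ with one entry per occurrence of $\nu$ in $\phi$; $\phi^\ell$ is $\phi$ with these annotations, where $\star$ means no annotation. For a list $\vec\ell$ of ordinal assignments, one for each formula of the conclusion $\Gamma$ of $\mathcal D$, the translation $\mathcal D^{\mathcal O\mid\vec\ell}$ of $\mathcal D$ is an annotated coderivation of $\mathcal O:\Gamma^{\vec\ell}$, defined corecursively. If the last rule of $\mathcal D$ has no premise, take the corresponding annotated axiom. Otherwise first apply (bottom-up) $\mathsf{RS}$ and $\mathsf{pr}$ until neither is applicable, in an order given by any fixed choice of an applicable instance at each extended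 sequent where there is one; this yields $\mathcal O^{\mathsf{rp}}:\Gamma^{\vec\ell}$. Then apply the corresponding annotated rule, in which formulas keep their annotations, cut formulas get only $\star$, and $\phi(t,\mu Xx\phi)$ is annotated as $\phi^\ell(t,\mu Xx\phi^\ell)$, and translate the premises. For $\nu$ with principal formula annotated as $t\in\nu Xx\phi^\ell$, apply $\nu$ and then $\nu^\lambda$, getting $(\mathcal O^{\mathsf{rp}}+\lambda)+_\lambda\kappa$ and the active formula $\phi^\ell(t,\nu^\kappa Xx\phi^\ell)$; if it is annotated as $t\in\nu^\lambda Xx\phi^\ell$, apply $\nu^\lambda$ only, getting $\mathcal O^{\mathsf{rp}}+_\lambda\kappa$ and the same active formula. New variables are always those of least index not in the current constraint. **Lemma.** Let $\mathcal D$ be a progressing proof in which only finitely many distinct sequents occur (up to renaming of bound variables) and whose $\mathsf{id}$ steps $\Gamma,\neg\phi,\phi$ all have $\phi$ of the form $s<t$, $s\not<t$, $s=t$ or $s\neq t$. Then its translation $\mathcal D^{\emptyset\mid\vec\star}$ (empty constraint, all annotations $\star$) is a reset proof: it is an annotated coderivation, and each of its infinite branches has a stable reset variable. -/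

import Mathlib

namespace MuPA

/-! ### Number terms and formulas

Bound variables are well-scoped de Bruijn indices (index `0` is the innermost binder), free number
variables are names in `ℕ`; so terms and formulas are taken up to renaming of bound variables. -/

/-- Number terms with at most `n` bound number variables in scope. -/
inductive Tm (n : ℕ) : Type
  | bvar (i : Fin n) : Tm n
  | fvar (x : ℕ) : Tm n
  | zero : Tm n
  | succ (t : Tm n) : Tm n
  | add (s t : Tm n) : Tm n
  | mul (s t : Tm n) : Tm n

/-- Formulas whose fixed points carry an annotation in `Option V`; the annotation `none` (written `⋆`
on paper) stands for the plain binders `μ`, `ν`, and `some κ` for `μ^κ`, `ν^κ`.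
`n` and `m` count the number variables and the set variables bound by the context. All set variables
are bound, and they are bound by fixed points, in whose body they have to occur positively; hence
`t ∉ X` never occurs in a formula and positivity holds by construction.
`mu a t φ` is the formula `t ∈ μ^a X x. φ`, and `nu a t φ` is `t ∈ ν^a X x. φ`. -/
inductive Fml (V : Type) : ℕ → ℕ → Type
  | lt {n m : ℕ} (s t : Tm n) : Fml V n m
  | nlt {n m : ℕ} (s t : Tm n) : Fml V n m
  | eq {n m : ℕ} (s t : Tm n) : Fml V n m
  | ne {n m : ℕ} (s t : Tm n) : Fml V n m
  | mem {n m : ℕ} (t : Tm n) (X : Fin m) : Fml V n m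
  | and {n m : ℕ} (φ ψ : Fml V n m) : Fml V n m
  | or {n m : ℕ} (φ ψ : Fml V n m) : Fml V n m
  | all {n m : ℕ} (φ : Fml V (n + 1) m) : Fml V n m
  | ex {n m : ℕ} (φ : Fml V (n + 1) m) : Fml V n m
  | mu {n m : ℕ} (a : Option V) (t : Tm n) (φ : Fml V (n + 1) (m + 1)) : Fml V n m
  | nu {n m : ℕ} (a : Option V) (t : Tm n) (φ : Fml V (n + 1) (m + 1)) : Fml V n m

/-- Set terms. -/
inductive STm (V : Type) (n m : ℕ) : Type
  | var (X : Fin m) : STm V n m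
  | mu (a : Option V) (φ : Fml V (n + 1) (m + 1)) : STm V n m
  | nu (a : Option V) (φ : Fml V (n + 1) (m + 1)) : STm V n m

/-- Ordinal variables, in their fixed enumeration. -/
abbrev OrdVar : Type := ℕ

/-- Closed terms, i.e. terms all of whose variables are (named) free variables. -/
abbrev Term : Type := Tm 0
/-- Formulas of `μPA` (all annotations are `none`, since `Empty` has no element). -/
abbrev Formula : Type := Fml Empty 0 0
/-- Annotated formulas. -/
abbrev AFormula : Type := Fml OrdVar 0 0
/-- Sequents are lists of formulas. -/
abbrev Sequent : Type := List Formula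
/-- Annotated sequents. -/
abbrev ASequent : Type := List AFormula

/-- Extension of a map of de Bruijn indices under a binder. -/
def liftFin {n k : ℕ} (f : Fin n → Fin k) : Fin (n + 1) → Fin (k + 1) :=
  Fin.cases 0 (fun i => (f i).succ)

namespace Tm

def rename {n k : ℕ} (f : Fin n → Fin k) : Tm n → Tm k
  | bvar i => bvar (f i)
  | fvar x => fvar x
  | zero => zero
  | succ t => succ (t.rename f)
  | add s t => add (s.rename f) (t.rename f)
  | mul s t => mul (s.rename f) (t.rename f)

/-- Simultaneous substitution of bound variables by `σ` and of free variables by `θ`. -/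
def subst {n k : ℕ} (σ : Fin n → Tm k) (θ : ℕ → Tm k) : Tm n → Tm k
  | bvar i => σ i
  | fvar x => θ x
  | zero => zero
  | succ t => succ (t.subst σ θ)
  | add s t => add (s.subst σ θ) (t.subst σ θ)
  | mul s t => mul (s.subst σ θ) (t.subst σ θ)

/-- Weakening of a term under one more binder. -/
def lift {n : ℕ} (t : Tm n) : Tm (n + 1) := t.rename Fin.succ

/-- The free variables of a term. -/
def fv {n : ℕ} : Tm n → Set ℕ
  | bvar _ => ∅
  | fvar x => {x}
  | zero => ∅
  | succ t => t.fv
  | add s t => s.fv ∪ t.fv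
  | mul s t => s.fv ∪ t.fv

end Tm

namespace Fml

variable {V : Type}

def rename : {n m k l : ℕ} → (Fin n → Fin k) → (Fin m → Fin l) → Fml V n m → Fml V k l
  | _, _, _, _, f, _, lt s t => lt (s.rename f) (t.rename f)
  | _, _, _, _, f, _, nlt s t => nlt (s.rename f) (t.rename f)
  | _, _, _, _, f, _, eq s t => eq (s.rename f) (t.rename f)
  | _, _, _, _, f, _, ne s t => ne (s.rename f) (t.rename f)
  | _, _, _, _, f, g, mem t X => mem (t.rename f) (g X)
  | _, _, _, _, f, g, and φ ψ => and (φ.rename f g) (ψ.rename f g)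
  | _, _, _, _, f, g, or φ ψ => or (φ.rename f g) (ψ.rename f g)
  | _, _, _, _, f, g, all φ => all (φ.rename (liftFin f) g)
  | _, _, _, _, f, g, ex φ => ex (φ.rename (liftFin f) g)
  | _, _, _, _, f, g, mu a t φ => mu a (t.rename f) (φ.rename (liftFin f) (liftFin g))
  | _, _, _, _, f, g, nu a t φ => nu a (t.rename f) (φ.rename (liftFin f) (liftFin g))

/-- Capture-avoiding simultaneous substitution of number terms: bound variables by `σ`, free
variables by `θ`. -/
def subst : {n m k : ℕ} → (Fin n → Tm k) → (ℕ → Tm k) → Fml V n m → Fml V k m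
  | _, _, _, σ, θ, lt s t => lt (s.subst σ θ) (t.subst σ θ)
  | _, _, _, σ, θ, nlt s t => nlt (s.subst σ θ) (t.subst σ θ)
  | _, _, _, σ, θ, eq s t => eq (s.subst σ θ) (t.subst σ θ)
  | _, _, _, σ, θ, ne s t => ne (s.subst σ θ) (t.subst σ θ)
  | _, _, _, σ, θ, mem t X => mem (t.subst σ θ) X
  | _, _, _, σ, θ, and φ ψ => and (φ.subst σ θ) (ψ.subst σ θ)
  | _, _, _, σ, θ, or φ ψ => or (φ.subst σ θ) (ψ.subst σ θ)
  | _, _, _, σ, θ, all φ =>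
      all (φ.subst (Fin.cases (.bvar 0) fun i => (σ i).lift) fun x => (θ x).lift)
  | _, _, _, σ, θ, ex φ =>
      ex (φ.subst (Fin.cases (.bvar 0) fun i => (σ i).lift) fun x => (θ x).lift)
  | _, _, _, σ, θ, mu a t φ =>
      mu a (t.subst σ θ) (φ.subst (Fin.cases (.bvar 0) fun i => (σ i).lift) fun x => (θ x).lift)
  | _, _, _, σ, θ, nu a t φ =>
      nu a (t.subst σ θ) (φ.subst (Fin.cases (.bvar 0) fun i => (σ i).lift) fun x => (θ x).lift)

/-- `φ[t/x]`, where `x` is the only bound number variable in scope. -/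
def inst {m : ℕ} (t : Term) (φ : Fml V 1 m) : Fml V 0 m := φ.subst (fun _ => t) Tm.fvar

/-- `θ(φ)`: substitution of the free number variables. -/
def substFree {m : ℕ} (θ : ℕ → Term) (φ : Fml V 0 m) : Fml V 0 m := φ.subst Fin.elim0 θ

/-- Negation of formulas, by De Morgan duality. Since
`¬ (t ∈ μ X x. φ(X)) = t ∈ ν X x. ¬ φ(¬ X)` and dually, the atoms `t ∈ X`
with `X` bound by a fixed point inside the formula stay as they are. -/
def neg : {n m : ℕ} → Fml V n m → Fml V n m
  | _, _, lt s t => nlt s t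
  | _, _, nlt s t => lt s t
  | _, _, eq s t => ne s t
  | _, _, ne s t => eq s t
  | _, _, mem t X => mem t X
  | _, _, and φ ψ => or φ.neg ψ.neg
  | _, _, or φ ψ => and φ.neg ψ.neg
  | _, _, all φ => ex φ.neg
  | _, _, ex φ => all φ.neg
  | _, _, mu a t φ => nu a t φ.neg
  | _, _, nu a t φ => mu a t φ.neg

def imp {n m : ℕ} (φ ψ : Fml V n m) : Fml V n m := or φ.neg ψ

/-- Atomic arithmetical formulas (equations, inequalities and their negations). -/
def IsLiteral : {n m : ℕ} → Fml V n m → Prop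
  | _, _, lt _ _ => True
  | _, _, nlt _ _ => True
  | _, _, eq _ _ => True
  | _, _, ne _ _ => True
  | _, _, _ => False

/-- The free number variables of a formula. -/
def fv : {n m : ℕ} → Fml V n m → Set ℕ
  | _, _, lt s t => s.fv ∪ t.fv
  | _, _, nlt s t => s.fv ∪ t.fv
  | _, _, eq s t => s.fv ∪ t.fv
  | _, _, ne s t => s.fv ∪ t.fv
  | _, _, mem t _ => t.fv
  | _, _, and φ ψ => φ.fv ∪ ψ.fv
  | _, _, or φ ψ => φ.fv ∪ ψ.fv
  | _, _, all φ => φ.fv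
  | _, _, ex φ => φ.fv
  | _, _, mu _ t φ => t.fv ∪ φ.fv
  | _, _, nu _ t φ => t.fv ∪ φ.fv

/-- The annotations (ordinal variables) that occur in a formula. -/
def ordVars : {n m : ℕ} → Fml V n m → Set V
  | _, _, lt _ _ => ∅
  | _, _, nlt _ _ => ∅
  | _, _, eq _ _ => ∅
  | _, _, ne _ _ => ∅
  | _, _, mem _ _ => ∅
  | _, _, and φ ψ => φ.ordVars ∪ ψ.ordVars
  | _, _, or φ ψ => φ.ordVars ∪ ψ.ordVars
  | _, _, all φ => φ.ordVars
  | _, _, ex φ => φ.ordVars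
  | _, _, mu a _ φ => {κ | a = some κ} ∪ φ.ordVars
  | _, _, nu a _ φ => {κ | a = some κ} ∪ φ.ordVars

/-- The number of symbols of a formula, where every number term counts as a single symbol. Thus the
size of a formula is not changed by substitution of number terms. -/
def size : {n m : ℕ} → Fml V n m → ℕ
  | _, _, lt _ _ => 3
  | _, _, nlt _ _ => 3
  | _, _, eq _ _ => 3
  | _, _, ne _ _ => 3
  | _, _, mem _ _ => 3
  | _, _, and φ ψ => φ.size + ψ.size + 1
  | _, _, or φ ψ => φ.size + ψ.size + 1
  | _, _, all φ => φ.size + 2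
  | _, _, ex φ => φ.size + 2
  | _, _, mu _ _ φ => φ.size + 5
  | _, _, nu _ _ φ => φ.size + 5

end Fml

namespace STm

variable {V : Type}

/-- The number of symbols of a set term (number terms count as one symbol):
`μ X x. φ` consists of `μ`, `X`, `x` and the symbols of `φ`. -/
def size {n m : ℕ} : STm V n m → ℕ
  | var _ => 1
  | mu _ φ => φ.size + 3
  | nu _ φ => φ.size + 3

def rename {n m k l : ℕ} (f : Fin n → Fin k) (g : Fin m → Fin l) : STm V n m → STm V k l
  | var X => var (g X)
  | mu a φ => mu a (φ.rename (liftFin f) (liftFin g))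
  | nu a φ => nu a (φ.rename (liftFin f) (liftFin g))

/-- The formula `t ∈ S`. -/
def toFml {n m : ℕ} (t : Tm n) : STm V n m → Fml V n m
  | var X => .mem t X
  | mu a φ => .mu a t φ
  | nu a φ => .nu a t φ

end STm

namespace Fml

variable {V : Type}

/-- Capture-avoiding substitution of set terms for set variables. -/
def setSubst : {n m k : ℕ} → (Fin m → STm V n k) → Fml V n m → Fml V n k
  | _, _, _, _, lt s t => lt s t
  | _, _, _, _, nlt s t => nlt s t
  | _, _, _, _, eq s t => eq s t
  | _, _, _, _, ne s t => ne s t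
  | _, _, _, τ, mem t X => (τ X).toFml t
  | _, _, _, τ, and φ ψ => and (φ.setSubst τ) (ψ.setSubst τ)
  | _, _, _, τ, or φ ψ => or (φ.setSubst τ) (ψ.setSubst τ)
  | _, _, _, τ, all φ => all (φ.setSubst fun X => (τ X).rename Fin.succ id)
  | _, _, _, τ, ex φ => ex (φ.setSubst fun X => (τ X).rename Fin.succ id)
  | _, _, _, τ, mu a t φ =>
      mu a t (φ.setSubst (Fin.cases (.var 0) fun X => (τ X).rename Fin.succ Fin.succ))
  | _, _, _, τ, nu a t φ =>
      nu a t (φ.setSubst (Fin.cases (.var 0) fun X => (τ X).rename Fin.succ Fin.succ))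

/-- `φ[S/X, t/x]`, also written `φ(t, S)`. -/
def plug (φ : Fml V 1 1) (S : STm V 0 0) (t : Term) : Fml V 0 0 :=
  (φ.inst t).setSubst fun _ => S

/-! ### Ordinal assignments -/

/-- The number of occurrences of `ν`. -/
def nuCount : {n m : ℕ} → Fml V n m → ℕ
  | _, _, lt _ _ => 0
  | _, _, nlt _ _ => 0
  | _, _, eq _ _ => 0
  | _, _, ne _ _ => 0
  | _, _, mem _ _ => 0
  | _, _, and φ ψ => φ.nuCount + ψ.nuCount
  | _, _, or φ ψ => φ.nuCount + ψ.nuCount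
  | _, _, all φ => φ.nuCount
  | _, _, ex φ => φ.nuCount
  | _, _, mu _ _ φ => φ.nuCount
  | _, _, nu _ _ φ => φ.nuCount + 1

/-- The list of the annotations of the occurrences of `ν`, from left to right. -/
def nuList : {n m : ℕ} → Fml V n m → List (Option V)
  | _, _, lt _ _ => []
  | _, _, nlt _ _ => []
  | _, _, eq _ _ => []
  | _, _, ne _ _ => []
  | _, _, mem _ _ => []
  | _, _, and φ ψ => φ.nuList ++ ψ.nuList
  | _, _, or φ ψ => φ.nuList ++ ψ.nuList
  | _, _, all φ => φ.nuList
  | _, _, ex φ => φ.nuList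
  | _, _, mu _ _ φ => φ.nuList
  | _, _, nu a _ φ => a :: φ.nuList

end Fml

/-- Ordinal assignments: lists over the ordinal variables and `⋆` (which is `none`). -/
abbrev OrdAssign : Type := List (Option OrdVar)

namespace Fml

/-- `φ^ℓ`: the `i`-th occurrence of `ν` in `φ` is annotated with the `i`-th entry of `ℓ`. It is used
only when the length of `ℓ` is the number of occurrences of `ν` in `φ`. -/
def annotate : {n m : ℕ} → Fml Empty n m → OrdAssign → Fml OrdVar n m
  | _, _, lt s t, _ => lt s t
  | _, _, nlt s t, _ => nlt s t
  | _, _, eq s t, _ => eq s t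
  | _, _, ne s t, _ => ne s t
  | _, _, mem t X, _ => mem t X
  | _, _, and φ ψ, ℓ => and (φ.annotate (ℓ.take φ.nuCount)) (ψ.annotate (ℓ.drop φ.nuCount))
  | _, _, or φ ψ, ℓ => or (φ.annotate (ℓ.take φ.nuCount)) (ψ.annotate (ℓ.drop φ.nuCount))
  | _, _, all φ, ℓ => all (φ.annotate ℓ)
  | _, _, ex φ, ℓ => ex (φ.annotate ℓ)
  | _, _, mu _ t φ, ℓ => mu none t (φ.annotate ℓ)
  | _, _, nu _ t φ, ℓ => nu (ℓ.headD none) t (φ.annotate ℓ.tail)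

/-- The identity ordinal assignment `⋆ ⋯ ⋆` for `φ`. -/
def star {n m : ℕ} (φ : Fml Empty n m) : OrdAssign := List.replicate φ.nuCount none

end Fml

/-- `Γ^ℓ` for a list `ℓ` of ordinal assignments, one for each formula of `Γ`. -/
def annotateList {n m : ℕ} (Γ : List (Fml Empty n m)) (ℓ : List OrdAssign) :
    List (Fml OrdVar n m) :=
  List.zipWith Fml.annotate Γ ℓ

/-- `μ(ℓ)`: the ordinal assignment that turns `φ(t, μ X x. φ)` into `φ^ℓ(t, μ X x. φ^ℓ)`. -/
def muAssign (φ : Fml Empty 1 1) (t : Term) (ℓ : OrdAssign) : OrdAssign :=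
  ((φ.annotate ℓ).plug (.mu none (φ.annotate ℓ)) t).nuList

/-- `ν^κ(ℓ)`: the ordinal assignment that turns `φ(t, ν X x. φ)` into `φ^ℓ(t, ν^κ X x. φ^ℓ)`. -/
def nuAssign (φ : Fml Empty 1 1) (t : Term) (κ : OrdVar) (ℓ : OrdAssign) : OrdAssign :=
  ((φ.annotate ℓ).plug (.nu (some κ) (φ.annotate ℓ)) t).nuList

/-! ### Rules and coderivations -/

/-- A set of (at most binary) rule instances `R` over sequents `S`. -/
structure RuleSystem (R S : Type) where
  /-- The instance satisfies the side conditions of its rule. -/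
  Valid : R → Prop
  concl : R → S
  prems : R → List S

/-- `label` is the labelling of a coderivation. Its support, the set of all nodes `v` with
`label v ≠ none`, is a non-empty prefix-closed set of binary words; a node `v` labelled by a rule
instance with premises `Γ₀, …` has precisely the successors `v0, …`, labelled by instances with
conclusions `Γ₀, …`. -/
structure IsCoderivation {R S : Type} (sys : RuleSystem R S) (label : List Bool → Option R) :
    Prop where
  root : label [] ≠ none
  prefix_closed : ∀ v b, label v = none → label (v ++ [b]) = none
  valid : ∀ v r, label v = some r → sys.Valid r
  succ : ∀ v r (b : Bool), label v = some r →
    (label (v ++ [b])).map sys.concl = (sys.prems r)[b.toNat]?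

/-- Coderivations over a set of rules. -/
structure Coderivation {R S : Type} (sys : RuleSystem R S) where
  label : List Bool → Option R
  isCoderivation : IsCoderivation sys label

/-- `β` is an infinite branch of the tree with labelling `label`. -/
structure IsInfiniteBranch {R : Type} (label : List Bool → Option R) (β : ℕ → List Bool) :
    Prop where
  zero : β 0 = []
  succ : ∀ i, ∃ b : Bool, β (i + 1) = β i ++ [b]
  mem : ∀ i, label (β i) ≠ none

/-- The axioms `PA₁`, …, `PA₇`, with variables `x`, `y`. -/
def paAxiom {V : Type} (x y : ℕ) : Fin 7 → Fml V 0 0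
  | 0 => .ne .zero (.succ (.fvar x))
  | 1 => .imp (.eq (.succ (.fvar x)) (.succ (.fvar y))) (.eq (.fvar x) (.fvar y))
  | 2 => .eq (.add (.fvar x) .zero) (.fvar x)
  | 3 => .eq (.add (.fvar x) (.succ (.fvar y))) (.succ (.add (.fvar x) (.fvar y)))
  | 4 => .eq (.mul (.fvar x) .zero) .zero
  | 5 => .eq (.mul (.fvar x) (.succ (.fvar y))) (.add (.mul (.fvar x) (.fvar y)) (.fvar x))
  | 6 => .and
      (.imp (.lt (.fvar x) (.fvar y)) (.ex (.eq (.add (.fvar x) (.succ (.bvar 0))) (.fvar y))))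
      (.imp (.ex (.eq (.add (.fvar x) (.succ (.bvar 0))) (.fvar y))) (.lt (.fvar x) (.fvar y)))

/-- `t ∈ 𝐍`, where `𝐍 = μ X x. (x = 0 ∨ ∃ y (y ∈ X ∧ x = succ y))`. -/
def memNat {V : Type} (t : Term) : Fml V 0 0 :=
  .mu none t (.or (.eq (.bvar 0) .zero)
    (.ex (.and (.mem (.bvar 0) 0) (.eq (.bvar 1) (.succ (.bvar 0))))))

/-- The rule instances that the plain and the annotated system have in common. -/
inductive BaseRule (V : Type) : Type
  | id (Γ : List (Fml V 0 0)) (φ : Fml V 0 0)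
  | wk (Γ Δ : List (Fml V 0 0))
  | exch (Γ : List (Fml V 0 0)) (φ ψ : Fml V 0 0) (Δ : List (Fml V 0 0))
  | sub (θ : ℕ → Term) (Γ : List (Fml V 0 0))
  | cut (Γ : List (Fml V 0 0)) (φ : Fml V 0 0)
  | and (Γ : List (Fml V 0 0)) (φ ψ : Fml V 0 0)
  | or (Γ : List (Fml V 0 0)) (φ ψ : Fml V 0 0)
  | all (Γ : List (Fml V 0 0)) (φ : Fml V 1 0) (y : ℕ)
  | ex (Γ : List (Fml V 0 0)) (φ : Fml V 1 0) (t : Term)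
  | eqSub (Γ : List (Fml V 1 0)) (s t : Term)
  | refl (t : Term)
  | pa (i : Fin 7) (x y : ℕ)
  | nat (t : Term)
  | mu (Γ : List (Fml V 0 0)) (t : Term) (φ : Fml V 1 1)

namespace BaseRule

variable {V : Type}

def concl : BaseRule V → List (Fml V 0 0)
  | id Γ φ => Γ ++ [φ.neg, φ]
  | wk Γ Δ => Γ ++ Δ
  | exch Γ φ ψ Δ => Γ ++ φ :: ψ :: Δ
  | sub θ Γ => Γ.map (Fml.substFree θ)
  | cut Γ _ => Γ
  | and Γ φ ψ => Γ ++ [.and φ ψ]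
  | or Γ φ ψ => Γ ++ [.or φ ψ]
  | all Γ φ _ => Γ ++ [.all φ]
  | ex Γ φ _ => Γ ++ [.ex φ]
  | eqSub Γ s t => Γ.map (Fml.inst t) ++ [.ne s t]
  | refl t => [.eq t t]
  | pa i x y => [paAxiom x y i]
  | nat t => [memNat t]
  | mu Γ t φ => Γ ++ [.mu none t φ]

def prems : BaseRule V → List (List (Fml V 0 0))
  | id _ _ => []
  | wk Γ _ => [Γ]
  | exch Γ φ ψ Δ => [Γ ++ ψ :: φ :: Δ]
  | sub _ Γ => [Γ]
  | cut Γ φ => [Γ ++ [φ], Γ ++ [φ.neg]]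
  | and Γ φ ψ => [Γ ++ [φ], Γ ++ [ψ]]
  | or Γ φ ψ => [Γ ++ [φ, ψ]]
  | all Γ φ y => [Γ ++ [φ.inst (.fvar y)]]
  | ex Γ φ t => [Γ ++ [φ.inst t]]
  | eqSub Γ s _ => [Γ.map (Fml.inst s)]
  | refl _ => []
  | pa _ _ _ => []
  | nat _ => []
  | mu Γ t φ => [Γ ++ [φ.plug (.mu none φ) t]]

/-- The only side condition: the eigenvariable of `∀` is fresh. -/
def Valid : BaseRule V → Prop
  | all Γ φ y => (∀ ψ ∈ Γ, y ∉ ψ.fv) ∧ y ∉ φ.fv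
  | _ => True

end BaseRule

/-! ### Coderivations of `μPA`, traces and progress -/

/-- Rule instances of the plain system. -/
inductive Rule : Type
  | base (r : BaseRule Empty)
  | nu (Γ : Sequent) (t : Term) (φ : Fml Empty 1 1)

namespace Rule

def concl : Rule → Sequent
  | base r => r.concl
  | nu Γ t φ => Γ ++ [.nu none t φ]

def prems : Rule → List Sequent
  | base r => r.prems
  | nu Γ t φ => [Γ ++ [φ.plug (.nu none φ) t]]

def Valid : Rule → Prop
  | base r => r.Valid
  | nu _ _ _ => True

/-- Immediate ancestry of formula occurrences: the formula at position `q` of a premise is an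
immediate ancestor of the formula at position `p` of the conclusion. Both are the same side formula
of the context, or they are principal and active, or the rule is exchange and they are the two
occurrences of one of the exchanged formulas. -/
def Anc : Rule → ℕ → ℕ → Prop
  | base (.wk Γ _), p, q => p = q ∧ p < Γ.length
  | base (.exch Γ _ _ Δ), p, q =>
      (p = Γ.length ∧ q = Γ.length + 1) ∨ (p = Γ.length + 1 ∧ q = Γ.length) ∨
      (p = q ∧ (p < Γ.length ∨ (Γ.length + 2 ≤ p ∧ p < Γ.length + 2 + Δ.length)))
  | base (.sub _ Γ), p, q => p = q ∧ p < Γ.length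
  | base (.cut Γ _), p, q => p = q ∧ p < Γ.length
  | base (.and Γ _ _), p, q => p = q ∧ p ≤ Γ.length
  | base (.or Γ _ _), p, q => (p = q ∧ p ≤ Γ.length) ∨ (p = Γ.length ∧ q = Γ.length + 1)
  | base (.all Γ _ _), p, q => p = q ∧ p ≤ Γ.length
  | base (.ex Γ _ _), p, q => p = q ∧ p ≤ Γ.length
  | base (.eqSub Γ _ _), p, q => p = q ∧ p < Γ.length
  | base (.mu Γ _ _), p, q => p = q ∧ p ≤ Γ.length
  | nu Γ _ _, p, q => p = q ∧ p ≤ Γ.length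
  | _, _, _ => False

/-- The rule unfolds the set term `S` in the formula at position `p` of its conclusion. -/
def Unfolds : Rule → ℕ → STm Empty 0 0 → Prop
  | base (.mu Γ _ φ), p, S => p = Γ.length ∧ S = .mu none φ
  | nu Γ _ φ, p, S => p = Γ.length ∧ S = .nu none φ
  | _, _, _ => False

end Rule

/-- The rule system whose coderivations are the coderivations of `μPA`. -/
def plainSystem : RuleSystem Rule Sequent where
  Valid := Rule.Valid
  concl := Rule.concl
  prems := Rule.prems

/-- A trace `(φ_i)_{i ≥ k}` along the branch `β`; `p i` is the position of `φ_i` in the conclusion of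
the rule at `β i` (for `i ≥ k`). -/
def IsTrace (label : List Bool → Option Rule) (β : ℕ → List Bool) (k : ℕ) (p : ℕ → ℕ) : Prop :=
  ∀ i, k ≤ i → ∃ r, label (β i) = some r ∧ r.Anc (p i) (p (i + 1))

/-- The set term `S` progresses infinitely often along a trace. -/
def ProgressesInfinitelyOften (label : List Bool → Option Rule) (β : ℕ → List Bool) (k : ℕ)
    (p : ℕ → ℕ) (S : STm Empty 0 0) : Prop :=
  ∀ N, ∃ i, N ≤ i ∧ k ≤ i ∧ ∃ r, label (β i) = some r ∧ r.Unfolds (p i) S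

/-- Progressing traces: a `ν`-term progresses infinitely often and has minimal size among all set
terms that progress infinitely often. -/
def IsProgressingTrace (label : List Bool → Option Rule) (β : ℕ → List Bool) (k : ℕ)
    (p : ℕ → ℕ) : Prop :=
  IsTrace label β k p ∧
  ∃ φ : Fml Empty 1 1, ProgressesInfinitelyOften label β k p (.nu none φ) ∧
    ∀ S, ProgressesInfinitelyOften label β k p S → STm.size (.nu none φ : STm Empty 0 0) ≤ S.size

namespace Coderivation

/-- Progressing proofs: every infinite branch has a progressing trace. -/
def IsProgressing (D : Coderivation plainSystem) : Prop :=
  ∀ β, IsInfiniteBranch D.label β → ∃ k p, IsProgressingTrace D.label β k p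

/-- The set of sequents of `D`. -/
def sequents (D : Coderivation plainSystem) : Set Sequent :=
  {Γ | ∃ v r, D.label v = some r ∧ r.concl = Γ}

/-- All `id` steps `Γ, ¬φ, φ` have an atomic (arithmetical) formula `φ`. -/
def HasAtomicIdentities (D : Coderivation plainSystem) : Prop :=
  ∀ v Γ φ, D.label v = some (.base (.id Γ φ)) → φ.IsLiteral

/-- The conclusion of a coderivation. -/
def conclusion (D : Coderivation plainSystem) : Sequent :=
  ((D.label []).map Rule.concl).getD []

end Coderivation

/-! ### Constraints and annotated coderivations -/

/-- The data of a constraint: finitely many ordinal variables and a relation on them.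
`O.lt a b` is `a <_O b`. -/
structure Constraint where
  V : Finset OrdVar
  lt : OrdVar → OrdVar → Prop

namespace Constraint

/-- The defining conditions of a constraint: a strict partial order on `V` whose sets
`{b | a < b}` are linearly ordered. -/
structure IsConstraint (O : Constraint) : Prop where
  mem : ∀ a b, O.lt a b → a ∈ O.V ∧ b ∈ O.V
  irrefl : ∀ a, ¬ O.lt a a
  trans : ∀ a b c, O.lt a b → O.lt b c → O.lt a c
  linear : ∀ a b c, O.lt a b → O.lt a c → O.lt b c ∨ b = c ∨ O.lt c b

/-- The empty constraint. -/
def empty : Constraint := ⟨∅, fun _ _ => False⟩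

/-- `O + l`. -/
def addRoot (O : Constraint) (l : OrdVar) : Constraint := ⟨insert l O.V, O.lt⟩

/-- `O +_κ l`. -/
def addChild (O : Constraint) (κ l : OrdVar) : Constraint :=
  ⟨insert l O.V, fun a b => O.lt a b ∨ (a = l ∧ (O.lt κ b ∨ κ = b))⟩

/-- `O \ L`. -/
def remove (O : Constraint) (L : Finset OrdVar) : Constraint :=
  ⟨O.V \ L, fun a b => O.lt a b ∧ a ∈ O.V \ L ∧ b ∈ O.V \ L⟩

open Classical in
/-- The set `C(κ)` of the children of `κ` in `O`. -/
noncomputable def children (O : Constraint) (κ : OrdVar) : Finset OrdVar :=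
  O.V.filter fun l => O.lt l κ ∧ ¬ ∃ ξ ∈ O.V, O.lt l ξ ∧ O.lt ξ κ

/-- The ordinal variable of least index that is not in `O`. -/
noncomputable def fresh (O : Constraint) : OrdVar := sInf {l | l ∉ O.V}

end Constraint

/-- The ordinal variables of an annotated sequent. -/
def seqOrdVars (Γ : ASequent) : Set OrdVar := {κ | ∃ φ ∈ Γ, κ ∈ φ.ordVars}

open Classical in
/-- The set `P(Γ)` of the variables in `O` all of whose descendants (including themselves) do not
occur in `Γ`. -/
noncomputable def prunable (O : Constraint) (Γ : ASequent) : Finset OrdVar :=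
  O.V.filter fun κ => ∀ l ∈ O.V, (O.lt l κ ∨ l = κ) → l ∉ seqOrdVars Γ

/-- `O : Γ` is an extended sequent: `O` is a constraint that contains all ordinal variables
of `Γ`. -/
def IsExtSequent (s : Constraint × ASequent) : Prop :=
  s.1.IsConstraint ∧ ∀ κ ∈ seqOrdVars s.2, κ ∈ s.1.V

/-- The reset rule for `κ` and the pruning rule. -/
inductive Reduction : Type
  | rs (κ : OrdVar)
  | pr

namespace Reduction

/-- The variables that are removed from the constraint. -/
noncomputable def removed (O : Constraint) (Γ : ASequent) : Reduction → Finset OrdVar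
  | rs κ => O.children κ
  | pr => prunable O Γ

/-- The rule can be applied with conclusion `O : Γ`. -/
def Applicable (O : Constraint) (Γ : ASequent) : Reduction → Prop
  | rs κ => κ ∈ O.V ∧ κ ∉ seqOrdVars Γ ∧ (O.children κ).Nonempty ∧
      ∀ l ∈ O.children κ, l ∉ seqOrdVars Γ
  | pr => (prunable O Γ).Nonempty

end Reduction

/-- Rule instances of the annotated system. -/
inductive ARule : Type
  | base (O : Constraint) (r : BaseRule OrdVar)
  | nu (O : Constraint) (Γ : ASequent) (t : Term) (φ : Fml OrdVar 1 1) (l : OrdVar)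
  | nuK (O : Constraint) (Γ : ASequent) (κ : OrdVar) (t : Term) (φ : Fml OrdVar 1 1) (l : OrdVar)
  | cw (O : Constraint) (L : Finset OrdVar) (Γ : ASequent)
  | red (O : Constraint) (Γ : ASequent) (ρ : Reduction)

namespace ARule

def concl : ARule → Constraint × ASequent
  | base O r => (O, r.concl)
  | nu O Γ t φ _ => (O, Γ ++ [.nu none t φ])
  | nuK O Γ κ t φ _ => (O, Γ ++ [.nu (some κ) t φ])
  | cw O _ Γ => (O, Γ)
  | red O Γ _ => (O, Γ)

noncomputable def prems : ARule → List (Constraint × ASequent)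
  | base O r => r.prems.map fun Γ => (O, Γ)
  | nu O Γ t φ l => [(O.addRoot l, Γ ++ [.nu (some l) t φ])]
  | nuK O Γ κ t φ l => [(O.addChild κ l, Γ ++ [φ.plug (.nu (some l) φ) t])]
  | cw O L Γ => [(O.remove L, Γ)]
  | red O Γ ρ => [(O.remove (ρ.removed O Γ), Γ)]

/-- The side conditions of the rules. -/
def Side : ARule → Prop
  | base _ r => r.Valid
  | nu O _ _ _ l => l ∉ O.V
  | nuK O _ _ _ _ l => l ∉ O.V
  | cw O L _ => L ⊆ O.V
  | red O Γ ρ => ρ.Applicable O Γ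

/-- A rule instance derives extended sequents from extended sequents. -/
def Valid (r : ARule) : Prop :=
  r.Side ∧ IsExtSequent r.concl ∧ ∀ s ∈ r.prems, IsExtSequent s

end ARule

/-- The rule system whose coderivations are the annotated coderivations. -/
noncomputable def annotatedSystem : RuleSystem ARule (Constraint × ASequent) where
  Valid := ARule.Valid
  concl := ARule.concl
  prems := ARule.prems

/-- `κ` is a stable variable of the branch `β`. -/
def IsStable (label : List Bool → Option ARule) (β : ℕ → List Bool) (κ : OrdVar) : Prop :=
  ∃ i₀, ∀ i, i₀ ≤ i → ∃ r, label (β i) = some r ∧ κ ∈ r.concl.1.V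

/-- `κ` is a reset variable of the branch `β`: the reset rule for `κ` occurs infinitely often. -/
def IsReset (label : List Bool → Option ARule) (β : ℕ → List Bool) (κ : OrdVar) : Prop :=
  ∀ N, ∃ i, N ≤ i ∧ ∃ O Γ, label (β i) = some (.red O Γ (.rs κ))

/-- Reset proofs: annotated coderivations in which every infinite branch has a stable reset
variable. -/
def IsResetProof (label : List Bool → Option ARule) : Prop :=
  IsCoderivation annotatedSystem label ∧
  ∀ β, IsInfiniteBranch label β → ∃ κ, IsStable label β κ ∧ IsReset label β κ

/-! ### The translation -/

/-- A way of applying the reset and pruning rules until none of them can be applied: at every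
extended sequent to which one of them applies, the strategy selects such a rule. -/
structure ReductionStrategy where
  next : Constraint → ASequent → Option Reduction
  sound : ∀ O Γ ρ, next O Γ = some ρ → ρ.Applicable O Γ
  complete : ∀ O Γ, next O Γ = none → ∀ ρ : Reduction, ¬ ρ.Applicable O Γ

namespace BaseRule

/-- The annotated instance that corresponds to a plain rule instance with conclusion `Σ`, when `Σ` is
annotated by `ℓ`. -/
def annotate : BaseRule Empty → List OrdAssign → BaseRule OrdVar
  | id Γ φ, ℓ => id (annotateList Γ (ℓ.take Γ.length)) (φ.annotate [])
  | wk Γ Δ, ℓ => wk (annotateList Γ (ℓ.take Γ.length)) (annotateList Δ (ℓ.drop Γ.length))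
  | exch Γ φ ψ Δ, ℓ =>
      exch (annotateList Γ (ℓ.take Γ.length)) (φ.annotate (ℓ.getD Γ.length []))
        (ψ.annotate (ℓ.getD (Γ.length + 1) [])) (annotateList Δ (ℓ.drop (Γ.length + 2)))
  | sub θ Γ, ℓ => sub θ (annotateList Γ ℓ)
  | cut Γ φ, ℓ => cut (annotateList Γ ℓ) (φ.annotate φ.star)
  | and Γ φ ψ, ℓ =>
      and (annotateList Γ (ℓ.take Γ.length)) (φ.annotate ((ℓ.getD Γ.length []).take φ.nuCount))
        (ψ.annotate ((ℓ.getD Γ.length []).drop φ.nuCount))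
  | or Γ φ ψ, ℓ =>
      or (annotateList Γ (ℓ.take Γ.length)) (φ.annotate ((ℓ.getD Γ.length []).take φ.nuCount))
        (ψ.annotate ((ℓ.getD Γ.length []).drop φ.nuCount))
  | all Γ φ y, ℓ =>
      all (annotateList Γ (ℓ.take Γ.length)) (φ.annotate (ℓ.getD Γ.length [])) y
  | ex Γ φ t, ℓ =>
      ex (annotateList Γ (ℓ.take Γ.length)) (φ.annotate (ℓ.getD Γ.length [])) t
  | eqSub Γ s t, ℓ => eqSub (annotateList Γ (ℓ.take Γ.length)) s t
  | refl t, _ => refl t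
  | pa i x y, _ => pa i x y
  | nat t, _ => nat t
  | mu Γ t φ, ℓ => mu (annotateList Γ (ℓ.take Γ.length)) t (φ.annotate (ℓ.getD Γ.length []))

/-- The ordinal assignments with which the translation continues in the premises. -/
def premAssign : BaseRule Empty → List OrdAssign → List (List OrdAssign)
  | id _ _, _ => []
  | wk Γ _, ℓ => [ℓ.take Γ.length]
  | exch Γ _ _ _, ℓ =>
      [ℓ.take Γ.length ++
        ℓ.getD (Γ.length + 1) [] :: ℓ.getD Γ.length [] :: ℓ.drop (Γ.length + 2)]
  | sub _ _, ℓ => [ℓ]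
  | cut _ φ, ℓ => [ℓ ++ [φ.star], ℓ ++ [φ.neg.star]]
  | and Γ φ _, ℓ =>
      [ℓ.take Γ.length ++ [(ℓ.getD Γ.length []).take φ.nuCount],
       ℓ.take Γ.length ++ [(ℓ.getD Γ.length []).drop φ.nuCount]]
  | or Γ φ _, ℓ =>
      [ℓ.take Γ.length ++
        [(ℓ.getD Γ.length []).take φ.nuCount, (ℓ.getD Γ.length []).drop φ.nuCount]]
  | all _ _ _, ℓ => [ℓ]
  | ex _ _ _, ℓ => [ℓ]
  | eqSub Γ _ _, ℓ => [ℓ.take Γ.length]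
  | refl _, _ => []
  | pa _ _ _, _ => []
  | nat _, _ => []
  | mu Γ t φ, ℓ => [ℓ.take Γ.length ++ [muAssign φ t (ℓ.getD Γ.length [])]]

end BaseRule

/-- The arguments `D_u`, `O`, `ℓ` of the corecursive calls of the translation: the sub-coderivation
`D_u` is given by its root `u`. If `pending` is `false`, the block of reset and pruning steps below the
rule at `u` and the annotated `ν` step are already done. -/
structure State where
  node : List Bool
  O : Constraint
  ℓ : List OrdAssign
  pending : Bool

/-- One step of the translation: the rule instance at the root of the translated coderivation, and the
calls that yield its immediate sub-coderivations. Rules without premises are translated without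
preceding reset and pruning steps. -/
noncomputable def State.step (D : Coderivation plainSystem) (σ : ReductionStrategy) (s : State) :
    Option (ARule × List State) :=
  match D.label s.node with
  | none => none
  | some r =>
    match (if s.pending && !r.prems.isEmpty then σ.next s.O (annotateList r.concl s.ℓ)
      else none) with
    | some ρ =>
        some (.red s.O (annotateList r.concl s.ℓ) ρ,
          [{ s with O := s.O.remove (ρ.removed s.O (annotateList r.concl s.ℓ)) }])
    | none =>
      match r with
      | .base b =>
          some (.base s.O (b.annotate s.ℓ),
            (b.premAssign s.ℓ).mapIdx fun i ℓ' => ⟨s.node ++ [i == 1], s.O, ℓ', true⟩)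
      | .nu Γ t φ =>
        match s.ℓ.getD Γ.length [] with
        | [] => none
        | none :: ℓ₀ =>
            some (.nu s.O (annotateList Γ (s.ℓ.take Γ.length)) t (φ.annotate ℓ₀) s.O.fresh,
              [⟨s.node, s.O.addRoot s.O.fresh,
                s.ℓ.take Γ.length ++ [some s.O.fresh :: ℓ₀], false⟩])
        | some κ :: ℓ₀ =>
            some (.nuK s.O (annotateList Γ (s.ℓ.take Γ.length)) κ t (φ.annotate ℓ₀) s.O.fresh,
              [⟨s.node ++ [false], s.O.addChild κ s.O.fresh,
                s.ℓ.take Γ.length ++ [nuAssign φ t s.O.fresh ℓ₀], true⟩])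

/-- The call of the translation that is made at the node `v` of the translated coderivation, when the
call at the root is `s`. -/
noncomputable def State.at (D : Coderivation plainSystem) (σ : ReductionStrategy) (s : State)
    (v : List Bool) : Option State :=
  v.foldl (fun c b => c.bind fun s' => (s'.step D σ).bind fun x => x.2[b.toNat]?) (some s)

/-- The translation `D^{O | ℓ}`, as a labelling of binary words by annotated rule instances. -/
noncomputable def Coderivation.translate (D : Coderivation plainSystem) (σ : ReductionStrategy)
    (O : Constraint) (ℓ : List OrdAssign) (v : List Bool) : Option ARule :=
  (State.at D σ ⟨[], O, ℓ, true⟩ v).bind fun s => (s.step D σ).map Prod.fst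

end MuPA

namespace MuPA

namespace Fml

variable {V : Type}

/-! ### Annotations and substitution of number terms -/

/-! That the translation is an annotated coderivation is local: in a well-formed call (`State.WF`)
each rule of the proof has an annotated instance with the required conclusion and premises
(`State.Trans.concl_eq`, `State.Trans.prems_eq`), and the variables removed by a reduction never
occur in the sequent.

For the global condition, an infinite branch of the translation is read as a `Run`. Reductions
shrink the constraint, so the run cannot stay at one node, and it follows an infinite branch of the
given proof. That branch has a progressing trace with a `ν`-term of minimal size `n`. Finitely many
sequents contain finitely many set terms, so from some point on every term unfolded on the trace has
size at least `n` (`exists_forall_unfolds_le`).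

At a later unfolding of the minimal term its copies receive a fresh annotation `κ`, and the traced
formula becomes `Marked κ n`: copies annotated with `κ` are closed of size `n`, and every other
fixed point either contains `κ` or is smaller than `n`. A trace that lost `κ` could only unfold
terms that are too small, so `κ` stays in the traced formula. Unfolding a larger fixed point keeps
`κ`. Unfolding a `ν`-term of size `n` must unfold a copy annotated with `κ`, and this replaces `κ`
by a new child (`State.TraceStep.marked`). The result is a sequence of occurring variables that
moves to a child infinitely often (`Run.exists_marks`).

Consider the chain of the current variable and everything above it. Pruning cannot remove any of its
members, because the current variable occurs below them; so a member disappears only when its parent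
is reset. When no reduction applies, each variable that does not occur has an occurring child, and
parents are unique, so at most half of the constraint fails to occur. With least-index choice of new
variables, only finitely many variables are ever used. Hence there is a least variable `c` among
those that eventually stay in the chain for good. If `c` were reset only finitely often, then at a
later descent its child in the chain would stay forever too, contradicting the choice of `c`
(`Constraint.exists_stable_reset`). -/

theorem nuCount_subst {n m k : ℕ} (σ : Fin n → Tm k) (θ : ℕ → Tm k) (φ : Fml V n m) :
    (φ.subst σ θ).nuCount = φ.nuCount := by
  induction φ generalizing k <;> simp_all [subst, nuCount]

theorem size_subst {n m k : ℕ} (σ : Fin n → Tm k) (θ : ℕ → Tm k) (φ : Fml V n m) :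
    (φ.subst σ θ).size = φ.size := by
  induction φ generalizing k <;> simp_all [subst, size]

theorem ordVars_subst {n m k : ℕ} (σ : Fin n → Tm k) (θ : ℕ → Tm k) (φ : Fml V n m) :
    (φ.subst σ θ).ordVars = φ.ordVars := by
  induction φ generalizing k <;> simp_all [subst, ordVars]

theorem size_rename {n m k l : ℕ} (f : Fin n → Fin k) (g : Fin m → Fin l) (φ : Fml V n m) :
    (φ.rename f g).size = φ.size := by
  induction φ generalizing k l <;> simp_all [rename, size]

theorem ordVars_rename {n m k l : ℕ} (f : Fin n → Fin k) (g : Fin m → Fin l) (φ : Fml V n m) :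
    (φ.rename f g).ordVars = φ.ordVars := by
  induction φ generalizing k l <;> simp_all [rename, ordVars]

theorem annotate_subst {n m k : ℕ} (σ : Fin n → Tm k) (θ : ℕ → Tm k) (φ : Fml Empty n m)
    (ℓ : OrdAssign) : (φ.subst σ θ).annotate ℓ = (φ.annotate ℓ).subst σ θ := by
  induction φ generalizing k ℓ <;> simp_all [subst, annotate, nuCount_subst]

theorem fv_annotate {n m : ℕ} (φ : Fml Empty n m) (ℓ : OrdAssign) :
    (φ.annotate ℓ).fv = φ.fv := by
  induction φ generalizing ℓ <;> simp_all [fv, annotate]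

theorem size_annotate {n m : ℕ} (φ : Fml Empty n m) (ℓ : OrdAssign) :
    (φ.annotate ℓ).size = φ.size := by
  induction φ generalizing ℓ <;> simp_all [size, annotate]

theorem mem_of_mem_ordVars_annotate {n m : ℕ} {φ : Fml Empty n m} {ℓ : OrdAssign} {κ : OrdVar}
    (h : κ ∈ (φ.annotate ℓ).ordVars) : some κ ∈ ℓ := by
  induction φ generalizing ℓ with
  | and φ ψ ih1 ih2 | or φ ψ ih1 ih2 =>
    rcases h with h | h
    · exact List.mem_of_mem_take (ih1 h)
    · exact List.mem_of_mem_drop (ih2 h)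
  | all φ ih | ex φ ih => exact ih h
  | mu a t φ ih =>
    rcases h with h | h
    · simp at h
    · exact ih h
  | nu a t φ ih =>
    rcases h with h | h
    · cases ℓ <;> simp_all
    · exact List.mem_of_mem_tail (ih h)
  | _ => simp [annotate, ordVars] at h

/-- Negation turns `ν` into `μ`, so the two assignments address different binders and only trivial
annotations commute with it. Lengths do not matter, because a missing entry is read as `none`. This
is what makes the two premises of an annotated cut dual to each other. -/
theorem annotate_neg {n m : ℕ} (φ : Fml Empty n m) {ℓ ℓ' : OrdAssign}
    (h : ∀ a ∈ ℓ, a = none) (h' : ∀ a ∈ ℓ', a = none) :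
    φ.neg.annotate ℓ = (φ.annotate ℓ').neg := by
  induction φ generalizing ℓ ℓ' with
  | and φ ψ ih1 ih2 | or φ ψ ih1 ih2 =>
    simp only [neg, annotate]
    rw [ih1 (fun a ha => h a (List.mem_of_mem_take ha)) fun a ha => h' a (List.mem_of_mem_take ha),
      ih2 (fun a ha => h a (List.mem_of_mem_drop ha)) fun a ha => h' a (List.mem_of_mem_drop ha)]
  | all φ ih | ex φ ih => simp only [neg, annotate]; rw [ih h h']
  | mu a t φ ih =>
    simp only [neg, annotate]
    rw [ih (fun a ha => h a (List.mem_of_mem_tail ha)) h']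
    cases ℓ <;> simp_all
  | nu a t φ ih =>
    simp only [neg, annotate]
    rw [ih h (fun a ha => h' a (List.mem_of_mem_tail ha))]
    cases ℓ' <;> simp_all
  | _ => simp [neg, annotate]

/-! ### Erasure of annotations -/

/-- The underlying plain formula of an annotated formula. -/
def erase : {n m : ℕ} → Fml V n m → Fml Empty n m
  | _, _, lt s t => lt s t
  | _, _, nlt s t => nlt s t
  | _, _, eq s t => eq s t
  | _, _, ne s t => ne s t
  | _, _, mem t X => mem t X
  | _, _, and φ ψ => and φ.erase ψ.erase
  | _, _, or φ ψ => or φ.erase ψ.erase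
  | _, _, all φ => all φ.erase
  | _, _, ex φ => ex φ.erase
  | _, _, mu _ t φ => mu none t φ.erase
  | _, _, nu _ t φ => nu none t φ.erase

/-- No `μ` of the formula is annotated. -/
def PlainMu : {n m : ℕ} → Fml V n m → Prop
  | _, _, lt _ _ => True
  | _, _, nlt _ _ => True
  | _, _, eq _ _ => True
  | _, _, ne _ _ => True
  | _, _, mem _ _ => True
  | _, _, and φ ψ => φ.PlainMu ∧ ψ.PlainMu
  | _, _, or φ ψ => φ.PlainMu ∧ ψ.PlainMu
  | _, _, all φ => φ.PlainMu
  | _, _, ex φ => φ.PlainMu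
  | _, _, mu a _ φ => a = none ∧ φ.PlainMu
  | _, _, nu _ _ φ => φ.PlainMu

end Fml

namespace STm

variable {V : Type}

/-- The underlying plain set term of an annotated set term. -/
def erase {n m : ℕ} : STm V n m → STm Empty n m
  | var X => var X
  | mu _ φ => mu none φ.erase
  | nu _ φ => nu none φ.erase

/-- No `μ` of the set term is annotated. -/
def PlainMu {n m : ℕ} : STm V n m → Prop
  | var _ => True
  | mu a φ => a = none ∧ φ.PlainMu
  | nu _ φ => φ.PlainMu

/-- The annotations that occur in a set term. -/
def ordVars {n m : ℕ} : STm V n m → Set V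
  | var _ => ∅
  | mu a φ => {κ | a = some κ} ∪ φ.ordVars
  | nu a φ => {κ | a = some κ} ∪ φ.ordVars

theorem erase_toFml {n m : ℕ} (t : Tm n) (S : STm V n m) : (S.toFml t).erase = S.erase.toFml t := by
  cases S <;> rfl

theorem plainMu_toFml {n m : ℕ} (t : Tm n) (S : STm V n m) : (S.toFml t).PlainMu ↔ S.PlainMu := by
  cases S <;> rfl

theorem ordVars_toFml {n m : ℕ} (t : Tm n) (S : STm V n m) : (S.toFml t).ordVars = S.ordVars := by
  cases S <;> rfl

theorem ordVars_rename {n m k l : ℕ} (f : Fin n → Fin k) (g : Fin m → Fin l) (S : STm V n m) :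
    (S.rename f g).ordVars = S.ordVars := by
  cases S <;> simp [rename, ordVars, Fml.ordVars_rename]

end STm

/-! ### Erasure commutes with substitution, and annotations can be recovered -/

namespace Fml

variable {V : Type}

theorem erase_rename {n m k l : ℕ} (f : Fin n → Fin k) (g : Fin m → Fin l) (φ : Fml V n m) :
    (φ.rename f g).erase = φ.erase.rename f g := by
  induction φ generalizing k l <;> simp_all [rename, erase]

theorem erase_subst {n m k : ℕ} (σ : Fin n → Tm k) (θ : ℕ → Tm k) (φ : Fml V n m) :
    (φ.subst σ θ).erase = φ.erase.subst σ θ := by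
  induction φ generalizing k <;> simp_all [subst, erase]

theorem plainMu_rename {n m k l : ℕ} (f : Fin n → Fin k) (g : Fin m → Fin l) (φ : Fml V n m) :
    (φ.rename f g).PlainMu ↔ φ.PlainMu := by
  induction φ generalizing k l <;> simp_all [rename, PlainMu]

theorem plainMu_subst {n m k : ℕ} (σ : Fin n → Tm k) (θ : ℕ → Tm k) (φ : Fml V n m) :
    (φ.subst σ θ).PlainMu ↔ φ.PlainMu := by
  induction φ generalizing k <;> simp_all [subst, PlainMu]

theorem _root_.MuPA.STm.erase_rename {n m k l : ℕ} (f : Fin n → Fin k) (g : Fin m → Fin l)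
    (S : STm V n m) : (S.rename f g).erase = S.erase.rename f g := by
  cases S <;> simp [STm.rename, STm.erase, Fml.erase_rename]

theorem _root_.MuPA.STm.plainMu_rename {n m k l : ℕ} (f : Fin n → Fin k) (g : Fin m → Fin l)
    (S : STm V n m) : (S.rename f g).PlainMu ↔ S.PlainMu := by
  cases S <;> simp [STm.rename, STm.PlainMu, Fml.plainMu_rename]

theorem erase_setSubst {n m k : ℕ} (τ : Fin m → STm V n k) (φ : Fml V n m) :
    (φ.setSubst τ).erase = φ.erase.setSubst fun X => (τ X).erase := by
  induction φ generalizing k with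
  | mem t X => simp [setSubst, erase, STm.erase_toFml]
  | mu a t φ ih | nu a t φ ih =>
    simp only [setSubst, erase, ih]
    congr 2
    funext X
    cases X using Fin.cases with
    | zero => rfl
    | succ X => exact STm.erase_rename _ _ _
  | _ => simp_all [setSubst, erase, STm.erase_rename]

theorem plainMu_setSubst {n m k : ℕ} {τ : Fin m → STm V n k} {φ : Fml V n m}
    (hτ : ∀ X, (τ X).PlainMu) (h : φ.PlainMu) : (φ.setSubst τ).PlainMu := by
  induction φ generalizing k with
  | mem t X => simpa [setSubst, STm.plainMu_toFml] using hτ X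
  | and φ ψ ih1 ih2 | or φ ψ ih1 ih2 => exact ⟨ih1 hτ h.1, ih2 hτ h.2⟩
  | all φ ih | ex φ ih => exact ih (fun X => (STm.plainMu_rename _ _ _).2 (hτ X)) h
  | mu a t φ ih =>
    refine ⟨h.1, ih (fun X => ?_) h.2⟩
    cases X using Fin.cases
    · trivial
    · exact (STm.plainMu_rename _ _ _).2 (hτ _)
  | nu a t φ ih =>
    refine ih (fun X => ?_) h
    cases X using Fin.cases
    · trivial
    · exact (STm.plainMu_rename _ _ _).2 (hτ _)
  | _ => trivial

theorem length_nuList {n m : ℕ} (A : Fml V n m) : A.nuList.length = A.erase.nuCount := by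
  induction A <;> simp_all [nuList, erase, nuCount]

/-- Once no `μ` carries an annotation, the list of `ν`-annotations is all that erasure forgets. This
is how the assignments read off from an unfolded formula by `nuList` are seen to be the correct
ones. -/
theorem annotate_erase {n m : ℕ} {A : Fml OrdVar n m} (h : A.PlainMu) :
    A.erase.annotate A.nuList = A := by
  induction A <;> simp_all [nuList, erase, annotate, PlainMu, ← length_nuList]

theorem erase_annotate {n m : ℕ} (φ : Fml Empty n m) (ℓ : OrdAssign) :
    (φ.annotate ℓ).erase = φ := by
  -- Annotations of a plain formula lie in `Option Empty`, so each of them equals the `none` that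
  -- erasure inserts.
  induction φ generalizing ℓ <;> simp_all [erase, annotate] <;> exact (Option.eq_none_iff_forall_not_mem.2 fun a => a.elim).symm

theorem plainMu_annotate {n m : ℕ} (φ : Fml Empty n m) (ℓ : OrdAssign) :
    (φ.annotate ℓ).PlainMu := by
  induction φ generalizing ℓ <;> simp_all [PlainMu, annotate]

theorem erase_plug (φ : Fml V 1 1) (S : STm V 0 0) (t : Term) :
    (φ.plug S t).erase = φ.erase.plug S.erase t := by
  simp [plug, inst, erase_setSubst, erase_subst]

theorem plainMu_plug {φ : Fml V 1 1} {S : STm V 0 0} (t : Term) (h : φ.PlainMu)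
    (hS : S.PlainMu) : (φ.plug S t).PlainMu :=
  plainMu_setSubst (fun _ => hS) ((plainMu_subst _ _ _).2 h)

theorem ordVars_setSubst_subset {n m k : ℕ} {τ : Fin m → STm V n k} {φ : Fml V n m} {P : Set V}
    (hτ : ∀ X, (τ X).ordVars ⊆ P) (h : φ.ordVars ⊆ P) : (φ.setSubst τ).ordVars ⊆ P := by
  induction φ generalizing k with
  | mem t X => simpa [setSubst, STm.ordVars_toFml] using hτ X
  | and φ ψ ih1 ih2 | or φ ψ ih1 ih2 =>
    exact Set.union_subset (ih1 hτ (Set.union_subset_iff.1 h).1)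
      (ih2 hτ (Set.union_subset_iff.1 h).2)
  | all φ ih | ex φ ih => exact ih (fun X => (STm.ordVars_rename _ _ (τ X)).symm ▸ hτ X) h
  | mu a t φ ih | nu a t φ ih =>
    refine Set.union_subset (Set.union_subset_iff.1 h).1
      (ih (fun X => ?_) (Set.union_subset_iff.1 h).2)
    cases X using Fin.cases
    · simp [STm.ordVars]
    · simpa [STm.ordVars_rename] using hτ _
  | _ => simp [setSubst, ordVars]

theorem ordVars_plug_subset (φ : Fml V 1 1) (S : STm V 0 0) (t : Term) :
    (φ.plug S t).ordVars ⊆ S.ordVars ∪ φ.ordVars :=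
  ordVars_setSubst_subset (fun _ => Set.subset_union_left)
    (by simp [inst, ordVars_subst])

theorem subset_ordVars_setSubst {n m k : ℕ} (τ : Fin m → STm V n k) (φ : Fml V n m) :
    φ.ordVars ⊆ (φ.setSubst τ).ordVars := by
  induction φ generalizing k with
  | and φ ψ ih1 ih2 | or φ ψ ih1 ih2 => exact Set.union_subset_union (ih1 _) (ih2 _)
  | all φ ih | ex φ ih => exact ih _
  | mu a t φ ih | nu a t φ ih => exact Set.union_subset_union le_rfl (ih _)
  | _ => simp [ordVars]

/-- The right-hand side has plain `μ` and erases to the plain unfolding, so its own list of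
`ν`-annotations reconstructs it. -/
theorem annotate_plug_mu (φ : Fml Empty 1 1) (t : Term) (ℓ : OrdAssign) :
    (φ.plug (.mu none φ) t).annotate (muAssign φ t ℓ) =
      (φ.annotate ℓ).plug (.mu none (φ.annotate ℓ)) t := by
  have h := annotate_erase (plainMu_plug (S := .mu none (φ.annotate ℓ)) t (plainMu_annotate φ ℓ)
    ⟨rfl, plainMu_annotate φ ℓ⟩)
  simpa only [muAssign, erase_plug, STm.erase, erase_annotate] using h

theorem length_muAssign (φ : Fml Empty 1 1) (t : Term) (ℓ : OrdAssign) :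
    (muAssign φ t ℓ).length = (φ.plug (.mu none φ) t).nuCount := by
  simp [muAssign, length_nuList, erase_plug, STm.erase, erase_annotate]

theorem annotate_plug_nu (φ : Fml Empty 1 1) (t : Term) (κ : OrdVar) (ℓ : OrdAssign) :
    (φ.plug (.nu none φ) t).annotate (nuAssign φ t κ ℓ) =
      (φ.annotate ℓ).plug (.nu (some κ) (φ.annotate ℓ)) t := by
  have h := annotate_erase (plainMu_plug (S := .nu (some κ) (φ.annotate ℓ)) t (plainMu_annotate φ ℓ)
    (plainMu_annotate φ ℓ))
  simpa only [nuAssign, erase_plug, STm.erase, erase_annotate] using h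

theorem length_nuAssign (φ : Fml Empty 1 1) (t : Term) (κ : OrdVar) (ℓ : OrdAssign) :
    (nuAssign φ t κ ℓ).length = (φ.plug (.nu none φ) t).nuCount := by
  simp [nuAssign, length_nuList, erase_plug, STm.erase, erase_annotate]

/-! ### Marked formulas -/

/-- The set variables that occur free in a formula. -/
def setVars : {n m : ℕ} → Fml V n m → Set (Fin m)
  | _, _, lt _ _ => ∅
  | _, _, nlt _ _ => ∅
  | _, _, eq _ _ => ∅
  | _, _, ne _ _ => ∅
  | _, _, mem _ X => {X}
  | _, _, and φ ψ => φ.setVars ∪ ψ.setVars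
  | _, _, or φ ψ => φ.setVars ∪ ψ.setVars
  | _, _, all φ => φ.setVars
  | _, _, ex φ => φ.setVars
  | _, _, mu _ _ φ => {X | X.succ ∈ φ.setVars}
  | _, _, nu _ _ φ => {X | X.succ ∈ φ.setVars}

open Classical in
/-- Every `ν`-term annotated with `κ` is closed and of size `n`, and every other fixed point without
an occurrence of `κ` is smaller than `n`. -/
def Marked (κ : V) (k : ℕ) : {n m : ℕ} → Fml V n m → Prop
  | _, _, lt _ _ => True
  | _, _, nlt _ _ => True
  | _, _, eq _ _ => True
  | _, _, ne _ _ => True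
  | _, _, mem _ _ => True
  | _, _, and φ ψ => φ.Marked κ k ∧ ψ.Marked κ k
  | _, _, or φ ψ => φ.Marked κ k ∧ ψ.Marked κ k
  | _, _, all φ => φ.Marked κ k
  | _, _, ex φ => φ.Marked κ k
  | _, _, mu a _ φ => a ≠ some κ ∧ (κ ∈ φ.ordVars ∨ φ.size + 3 < k) ∧ φ.Marked κ k
  | _, _, nu a _ φ =>
      if a = some κ then φ.size + 3 = k ∧ φ.setVars ⊆ {0}
      else (κ ∈ φ.ordVars ∨ φ.size + 3 < k) ∧ φ.Marked κ k

end Fml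

namespace STm

variable {V : Type}

/-- The set variables that occur free in a set term. -/
def setVars {n m : ℕ} : STm V n m → Set (Fin m)
  | var X => {X}
  | mu _ φ => {X | X.succ ∈ φ.setVars}
  | nu _ φ => {X | X.succ ∈ φ.setVars}

end STm

/-! ### Set variables, sizes and marks under substitution -/

namespace Fml

variable {V : Type}

theorem setVars_subst {n m k : ℕ} (σ : Fin n → Tm k) (θ : ℕ → Tm k) (φ : Fml V n m) :
    (φ.subst σ θ).setVars = φ.setVars := by
  induction φ generalizing k <;> simp_all [subst, setVars]

theorem setVars_rename {n m k l : ℕ} (f : Fin n → Fin k) (g : Fin m → Fin l) (φ : Fml V n m) :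
    (φ.rename f g).setVars = g '' φ.setVars := by
  induction φ generalizing k l with
  | and φ ψ ih1 ih2 | or φ ψ ih1 ih2 => simp [rename, setVars, ih1, ih2, Set.image_union]
  | mu a t φ ih | nu a t φ ih =>
    ext Y
    simp only [rename, setVars, ih, Set.mem_image, Set.mem_ofPred_eq]
    constructor
    · rintro ⟨X, hX, h⟩
      cases X using Fin.cases with
      | zero => simp [liftFin, eq_comm, Fin.succ_ne_zero] at h
      | succ X => exact ⟨X, hX, Fin.succ_injective _ (by simpa [liftFin] using h)⟩
    · rintro ⟨X, hX, rfl⟩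
      exact ⟨X.succ, hX, by simp [liftFin]⟩
  | _ => simp_all [rename, setVars]

theorem _root_.MuPA.STm.setVars_rename_subset {n m k l : ℕ} (f : Fin n → Fin k)
    (g : Fin m → Fin l) (S : STm V n m) : (S.rename f g).setVars ⊆ g '' S.setVars := by
  cases S with
  | var X => simp [STm.rename, STm.setVars]
  | mu a φ => exact (setVars_rename f g (.mu a (.zero) φ)).le
  | nu a φ => exact (setVars_rename f g (.nu a (.zero) φ)).le

theorem setVars_setSubst_subset {n m k : ℕ} {τ : Fin m → STm V n k} {φ : Fml V n m}
    {P : Set (Fin k)} (h : ∀ X ∈ φ.setVars, (τ X).setVars ⊆ P) : (φ.setSubst τ).setVars ⊆ P := by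
  induction φ generalizing k with
  | mem t X =>
    have : (τ X).setVars ⊆ P := h X rfl
    revert this
    rw [setSubst]
    cases τ X <;> exact id
  | and φ ψ ih1 ih2 | or φ ψ ih1 ih2 =>
    exact Set.union_subset (ih1 fun X hX => h X (.inl hX)) (ih2 fun X hX => h X (.inr hX))
  | all φ ih | ex φ ih =>
    refine ih fun X hX => (STm.setVars_rename_subset _ _ _).trans ?_
    simpa using h X hX
  | mu a t φ ih | nu a t φ ih =>
    -- Under the binder the bound `P` is shifted by one, and the newly bound variable `0` is
    -- admitted without condition.
    have : (φ.setSubst (Fin.cases (.var 0) fun X => (τ X).rename Fin.succ Fin.succ)).setVars ⊆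
        {X | ∀ Y, X = Fin.succ Y → Y ∈ P} := by
      refine ih fun X hX => ?_
      cases X using Fin.cases with
      | zero =>
        rintro _ rfl Y hY
        exact absurd hY.symm (Fin.succ_ne_zero Y)
      | succ X =>
        refine (STm.setVars_rename_subset _ _ _).trans ?_
        rintro _ ⟨Z, hZ, rfl⟩ Y hY
        exact Fin.succ_injective _ hY ▸ h X hX hZ
    exact fun X hX => this hX X rfl
  | _ => simp [setSubst, setVars]

theorem size_setSubst {n m k : ℕ} {τ : Fin m → STm V n k} {φ : Fml V n m}
    (h : ∀ X ∈ φ.setVars, ∃ Y, τ X = .var Y) : (φ.setSubst τ).size = φ.size := by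
  induction φ generalizing k with
  | mem t X =>
    obtain ⟨Y, hY⟩ := h X rfl
    simp [setSubst, hY, STm.toFml, size]
  | and φ ψ ih1 ih2 | or φ ψ ih1 ih2 =>
    simp [setSubst, size, ih1 fun X hX => h X (.inl hX), ih2 fun X hX => h X (.inr hX)]
  | all φ ih | ex φ ih =>
    simp only [setSubst, size]
    rw [ih fun X hX => (h X hX).imp fun Y hY => by rw [hY]; rfl]
  | mu a t φ ih | nu a t φ ih =>
    simp only [setSubst, size]
    rw [ih]
    intro X hX
    cases X using Fin.cases with
    | zero => exact ⟨0, rfl⟩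
    | succ X =>
      obtain ⟨Y, hY⟩ := h X hX
      exact ⟨Y.succ, by simp [hY, STm.rename]⟩
  | _ => simp [setSubst, size]

/-- If some free set variable of `φ` is replaced by a proper set term, that term brings `κ` with it;
otherwise the substitution merely renames set variables. So a fixed point can grow only by acquiring
the mark. -/
theorem mem_ordVars_setSubst_or_size_eq {n m k : ℕ} {κ : V} {τ : Fin m → STm V n k}
    (hτ : ∀ X, κ ∈ (τ X).ordVars ∨ ∃ Y, τ X = .var Y) (φ : Fml V n m) :
    κ ∈ (φ.setSubst τ).ordVars ∨ (φ.setSubst τ).size = φ.size := by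
  by_cases h : ∀ X ∈ φ.setVars, ∃ Y, τ X = .var Y
  · exact .inr (size_setSubst h)
  · push Not at h
    obtain ⟨X, hX, hY⟩ := h
    have hκ : κ ∈ (τ X).ordVars := (hτ X).resolve_right fun ⟨Y, h⟩ => hY Y h
    left
    clear hY hτ
    induction φ generalizing k with
    | mem t Z => obtain rfl : X = Z := hX; simpa [setSubst, STm.ordVars_toFml] using hκ
    | and φ ψ ih1 ih2 | or φ ψ ih1 ih2 =>
      exact hX.imp (fun h => ih1 X h hκ) (fun h => ih2 X h hκ)
    | all φ ih | ex φ ih => exact ih X hX (by simpa [STm.ordVars_rename] using hκ)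
    | mu a t φ ih | nu a t φ ih =>
      exact .inr (ih X.succ hX (by simpa [STm.ordVars_rename] using hκ))
    | _ => exact hX.elim

theorem marked_subst {n m k : ℕ} {κ : V} {j : ℕ} (σ : Fin n → Tm k) (θ : ℕ → Tm k)
    (φ : Fml V n m) : (φ.subst σ θ).Marked κ j ↔ φ.Marked κ j := by
  induction φ generalizing k <;>
    simp_all [subst, Marked, ordVars_subst, size_subst, setVars_subst]

theorem marked_rename {n m k l : ℕ} {κ : V} {j : ℕ} (f : Fin n → Fin k) (g : Fin m → Fin l)
    {φ : Fml V n m} (h : φ.Marked κ j) : (φ.rename f g).Marked κ j := by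
  induction φ generalizing k l with
  | and φ ψ ih1 ih2 | or φ ψ ih1 ih2 => exact ⟨ih1 _ _ h.1, ih2 _ _ h.2⟩
  | all φ ih | ex φ ih => exact ih _ _ h
  | mu a t φ ih =>
    exact ⟨h.1, by simpa [ordVars_rename, size_rename] using h.2.1, ih _ _ h.2.2⟩
  | nu a t φ ih =>
    by_cases ha : a = some κ
    · simp only [rename, Marked, ha, if_true, size_rename, setVars_rename] at h ⊢
      refine ⟨h.1, ?_⟩
      rintro _ ⟨X, hX, rfl⟩
      obtain rfl := h.2 hX
      simp [liftFin]
    · simp only [rename, Marked, ha, if_false, size_rename, ordVars_rename] at h ⊢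
      exact ⟨h.1, ih _ _ h.2⟩
  | _ => trivial

/-- All fixed points inside `φ` are smaller than `φ`, so the size alternative holds everywhere. It
applies to the body of a term of size `k` whose mark is fresh. -/
theorem marked_of_size_lt {n m : ℕ} {κ : V} {k : ℕ} {φ : Fml V n m} (h : κ ∉ φ.ordVars)
    (hk : φ.size < k) : φ.Marked κ k := by
  induction φ with
  | and φ ψ ih1 ih2 | or φ ψ ih1 ih2 =>
    simp only [ordVars, size, Set.mem_union, not_or] at h hk
    exact ⟨ih1 h.1 (by omega), ih2 h.2 (by omega)⟩
  | all φ ih | ex φ ih => exact ih h (by simp only [size] at hk; omega)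
  | mu a t φ ih =>
    simp only [ordVars, size, Set.mem_union, not_or] at h hk
    exact ⟨h.1, .inr (by omega), ih h.2 (by omega)⟩
  | nu a t φ ih =>
    simp only [ordVars, size, Set.mem_union, not_or] at h hk
    simp only [Marked, if_neg (show ¬ a = some κ from h.1)]
    exact ⟨.inr (by omega), ih h.2 (by omega)⟩
  | _ => trivial

/-- A set term that is a variable or contains the mark and is marked correctly. -/
def _root_.MuPA.STm.VarOrMarked {n m : ℕ} (κ : V) (k : ℕ) (S : STm V n m) : Prop :=
  (κ ∈ S.ordVars ∧ ∀ t, (S.toFml t).Marked κ k) ∨ ∃ Y, S = .var Y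

theorem _root_.MuPA.STm.VarOrMarked.rename {n m k l : ℕ} {κ : V} {j : ℕ} {S : STm V n m}
    (h : S.VarOrMarked κ j) (f : Fin n → Fin k) (g : Fin m → Fin l) :
    (S.rename f g).VarOrMarked κ j := by
  rcases h with ⟨h1, h2⟩ | ⟨Y, rfl⟩
  · refine .inl ⟨by simpa [STm.ordVars_rename] using h1, fun t => ?_⟩
    cases S with
    | var X => trivial
    | mu a φ => exact marked_rename f g (h2 .zero)
    | nu a φ => exact marked_rename f g (h2 .zero)
  · exact .inr ⟨g Y, rfl⟩

/-- Substitution could spoil the sizes in two ways. A term annotated with `κ` is closed, so its size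
does not change; a fixed point without `κ` either keeps its size or acquires `κ`. -/
theorem marked_setSubst {n m k : ℕ} {κ : V} {j : ℕ} {τ : Fin m → STm V n k} {φ : Fml V n m}
    (hτ : ∀ X, (τ X).VarOrMarked κ j) (h : φ.Marked κ j) : (φ.setSubst τ).Marked κ j := by
  have hlift : ∀ {n m k : ℕ} {τ : Fin m → STm V n k}, (∀ X, (τ X).VarOrMarked κ j) →
      ∀ X : Fin (m + 1), (Fin.cases (.var 0) (fun X => (τ X).rename Fin.succ Fin.succ) X :
        STm V (n + 1) (k + 1)).VarOrMarked κ j := by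
    intro n m k τ hτ X
    cases X using Fin.cases with
    | zero => exact .inr ⟨0, rfl⟩
    | succ X => exact (hτ X).rename _ _
  have hsize : ∀ {n m k : ℕ} {τ : Fin m → STm V n k} (φ : Fml V n m),
      (∀ X, (τ X).VarOrMarked κ j) → (κ ∈ φ.ordVars ∨ φ.size + 3 < j) →
      κ ∈ (φ.setSubst τ).ordVars ∨ (φ.setSubst τ).size + 3 < j := by
    rintro n m k τ φ hτ (h | h)
    · exact .inl (subset_ordVars_setSubst _ _ h)
    · exact (mem_ordVars_setSubst_or_size_eq (fun X => (hτ X).imp_left And.left) φ).imp_right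
        fun e => by rw [e]; exact h
  induction φ generalizing k with
  | mem t X =>
    rcases hτ X with h | ⟨Y, hY⟩
    · exact h.2 t
    · simp [setSubst, hY, STm.toFml, Marked]
  | and φ ψ ih1 ih2 | or φ ψ ih1 ih2 => exact ⟨ih1 hτ h.1, ih2 hτ h.2⟩
  | all φ ih | ex φ ih => exact ih (fun X => (hτ X).rename _ _) h
  | mu a t φ ih => exact ⟨h.1, hsize φ (hlift hτ) h.2.1, ih (hlift hτ) h.2.2⟩
  | nu a t φ ih =>
    by_cases ha : a = some κ
    · simp only [setSubst, Marked, if_pos ha] at h ⊢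
      refine ⟨?_, ?_⟩
      · rw [size_setSubst, h.1]
        intro X hX
        obtain rfl := h.2 hX
        exact ⟨0, rfl⟩
      · refine setVars_setSubst_subset fun X hX => ?_
        obtain rfl := h.2 hX
        simp [STm.setVars]
    · simp only [setSubst, Marked, if_neg ha] at h ⊢
      exact ⟨hsize φ (hlift hτ) h.1, ih (hlift hτ) h.2⟩
  | _ => trivial

/-- An occurrence of `κ` comes from a `ν`-term annotated with it, which already has size `k`.
Consequently a fixed point with `κ` inside its body is strictly larger than `k`. -/
theorem Marked.le_size {n m : ℕ} {κ : V} {k : ℕ} {φ : Fml V n m} (h : φ.Marked κ k)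
    (hκ : κ ∈ φ.ordVars) : k ≤ φ.size := by
  induction φ with
  | and φ ψ ih1 ih2 | or φ ψ ih1 ih2 =>
    simp only [size]
    rcases hκ with hκ | hκ
    · have := ih1 h.1 hκ; omega
    · have := ih2 h.2 hκ; omega
  | all φ ih | ex φ ih => have := ih h hκ; simp only [size]; omega
  | mu a t φ ih =>
    have := ih h.2.2 (hκ.resolve_left h.1)
    simp only [size]; omega
  | nu a t φ ih =>
    by_cases ha : a = some κ
    · simp only [Marked, if_pos ha] at h
      simp only [size]; omega
    · simp only [Marked, if_neg ha] at h
      have := ih h.2 (hκ.resolve_left ha)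
      simp only [size]; omega
  | _ => exact hκ.elim

/-- Unfolding a fixed point that contains the mark preserves marked formulas. -/
theorem marked_plug {κ : V} {k : ℕ} {φ : Fml V 1 1} {S : STm V 0 0} (t : Term)
    (h : φ.Marked κ k) (hS : κ ∈ S.ordVars) (hS' : ∀ t, (S.toFml t).Marked κ k) :
    (φ.plug S t).Marked κ k :=
  marked_setSubst (fun _ => .inl ⟨hS, hS'⟩) ((marked_subst _ _ _).2 h)

/-- Unfolding a `ν`-term with a fresh annotation marks the formula. -/
theorem marked_plug_of_fresh {l : V} {φ : Fml V 1 1} (t : Term) (hl : l ∉ φ.ordVars) :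
    (φ.plug (.nu (some l) φ) t).Marked l (φ.size + 3) := by
  refine marked_plug t (marked_of_size_lt hl (by omega)) (.inl rfl) fun t => ?_
  simp only [STm.toFml, Marked, if_true, true_and]
  intro X _
  exact Subsingleton.elim (α := Fin 1) X 0

end Fml

/-! ### Matching ordinal assignments -/

/-- Each formula has an ordinal assignment with one entry per occurrence of `ν`. -/
def Matches (Γ : Sequent) (ℓ : List OrdAssign) : Prop :=
  ℓ.map List.length = Γ.map Fml.nuCount

namespace Matches

theorem length_eq {Γ : Sequent} {ℓ : List OrdAssign} (h : Matches Γ ℓ) : ℓ.length = Γ.length := by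
  simpa using congrArg List.length h

theorem append {Γ Δ : Sequent} {ℓ ℓ' : List OrdAssign} (h : Matches Γ ℓ) (h' : Matches Δ ℓ') :
    Matches (Γ ++ Δ) (ℓ ++ ℓ') := by
  simpa [Matches] using congrArg₂ (· ++ ·) h h'

theorem cons {φ : Formula} {Γ : Sequent} {a : OrdAssign} {ℓ : List OrdAssign}
    (h : a.length = φ.nuCount) (h' : Matches Γ ℓ) : Matches (φ :: Γ) (a :: ℓ) := by
  simp_all [Matches]

theorem nil : Matches [] [] := rfl

theorem single {φ : Formula} {a : OrdAssign} (h : a.length = φ.nuCount) : Matches [φ] [a] :=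
  cons h nil

theorem star (Γ : Sequent) : Matches Γ (Γ.map Fml.star) := by
  simp [Matches, Fml.star]

theorem exists_append {Γ Δ : Sequent} {ℓ : List OrdAssign} (h : Matches (Γ ++ Δ) ℓ) :
    ∃ ℓ₁ ℓ₂, ℓ = ℓ₁ ++ ℓ₂ ∧ Γ.length = ℓ₁.length ∧ Matches Γ ℓ₁ ∧ Matches Δ ℓ₂ := by
  rw [Matches, List.map_append, List.map_eq_append_iff] at h
  obtain ⟨ℓ₁, ℓ₂, rfl, h₁, h₂⟩ := h
  exact ⟨ℓ₁, ℓ₂, rfl, (length_eq h₁).symm, h₁, h₂⟩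

theorem exists_cons {φ : Formula} {Γ : Sequent} {ℓ : List OrdAssign} (h : Matches (φ :: Γ) ℓ) :
    ∃ a ℓ', ℓ = a :: ℓ' ∧ a.length = φ.nuCount ∧ Matches Γ ℓ' := by
  rw [Matches, List.map_cons, List.map_eq_cons_iff] at h
  obtain ⟨a, ℓ', rfl, h₁, h₂⟩ := h
  exact ⟨a, ℓ', rfl, h₁, h₂⟩

theorem eq_nil {ℓ : List OrdAssign} (h : Matches [] ℓ) : ℓ = [] := by
  simpa [Matches] using h

theorem exists_concat {Γ : Sequent} {φ : Formula} {ℓ : List OrdAssign}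
    (h : Matches (Γ ++ [φ]) ℓ) :
    ∃ ℓ₁ a, ℓ = ℓ₁ ++ [a] ∧ Γ.length = ℓ₁.length ∧ Matches Γ ℓ₁ ∧ a.length = φ.nuCount := by
  obtain ⟨ℓ₁, ℓ₂, rfl, h₁, h₂, h₃⟩ := h.exists_append
  obtain ⟨a, ℓ', rfl, h₄, h₅⟩ := h₃.exists_cons
  obtain rfl := h₅.eq_nil
  exact ⟨ℓ₁, a, rfl, h₁, h₂, h₄⟩

theorem map_of_nuCount {m n : ℕ} {Γ : List (Fml Empty n m)} {f : Fml Empty n m → Formula}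
    (hf : ∀ φ, (f φ).nuCount = φ.nuCount) {ℓ : List OrdAssign} :
    Matches (Γ.map f) ℓ ↔ ℓ.map List.length = Γ.map Fml.nuCount := by
  simp [Matches, Function.comp_def, hf]

end Matches

theorem annotateList_append {n m : ℕ} {Γ Δ : List (Fml Empty n m)} {ℓ ℓ' : List OrdAssign}
    (h : Γ.length = ℓ.length) :
    annotateList (Γ ++ Δ) (ℓ ++ ℓ') = annotateList Γ ℓ ++ annotateList Δ ℓ' :=
  List.zipWith_append h

theorem annotateList_cons {n m : ℕ} (φ : Fml Empty n m) (Γ : List (Fml Empty n m)) (a : OrdAssign)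
    (ℓ : List OrdAssign) :
    annotateList (φ :: Γ) (a :: ℓ) = φ.annotate a :: annotateList Γ ℓ := rfl

theorem annotateList_nil {n m : ℕ} : annotateList ([] : List (Fml Empty n m)) [] = [] := rfl

theorem length_annotateList {n m : ℕ} {Γ : List (Fml Empty n m)} {ℓ : List OrdAssign}
    (h : Γ.length = ℓ.length) : (annotateList Γ ℓ).length = ℓ.length := by
  simp [annotateList, h]

theorem annotateList_map {n m n' m' : ℕ} {f : Fml Empty n m → Fml Empty n' m'}
    {g : Fml OrdVar n m → Fml OrdVar n' m'} (h : ∀ φ ℓ, (f φ).annotate ℓ = g (φ.annotate ℓ))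
    (Γ : List (Fml Empty n m)) (ℓ : List OrdAssign) :
    annotateList (Γ.map f) ℓ = (annotateList Γ ℓ).map g := by
  induction Γ generalizing ℓ with
  | nil => simp [annotateList]
  | cons φ Γ ih => cases ℓ <;> simp_all [annotateList]

theorem mem_of_mem_seqOrdVars {Γ : Sequent} {ℓ : List OrdAssign} {κ : OrdVar}
    (h : κ ∈ seqOrdVars (annotateList Γ ℓ)) : ∃ a ∈ ℓ, some κ ∈ a := by
  obtain ⟨A, hA, hκ⟩ := h
  induction Γ generalizing ℓ with
  | nil => simp [annotateList] at hA
  | cons φ Γ ih =>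
    cases ℓ with
    | nil => simp [annotateList] at hA
    | cons a ℓ =>
      rw [annotateList_cons, List.mem_cons] at hA
      rcases hA with rfl | hA
      · exact ⟨a, by simp, Fml.mem_of_mem_ordVars_annotate hκ⟩
      · obtain ⟨b, hb, hb'⟩ := ih hA
        exact ⟨b, by simp [hb], hb'⟩

theorem fv_of_mem_annotateList {Γ : Sequent} {ℓ : List OrdAssign} {A : AFormula}
    (h : A ∈ annotateList Γ ℓ) : ∃ φ ∈ Γ, A.fv = φ.fv := by
  induction Γ generalizing ℓ with
  | nil => simp [annotateList] at h
  | cons φ Γ ih =>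
    cases ℓ with
    | nil => simp [annotateList] at h
    | cons a ℓ =>
      rw [annotateList_cons, List.mem_cons] at h
      rcases h with rfl | h
      · exact ⟨φ, by simp, Fml.fv_annotate _ _⟩
      · obtain ⟨ψ, hψ, h⟩ := ih h
        exact ⟨ψ, by simp [hψ], h⟩

theorem seqOrdVars_append (Γ Δ : ASequent) :
    seqOrdVars (Γ ++ Δ) = seqOrdVars Γ ∪ seqOrdVars Δ := by
  ext κ
  simp [seqOrdVars, or_and_right, exists_or]

theorem seqOrdVars_cons (φ : AFormula) (Γ : ASequent) :
    seqOrdVars (φ :: Γ) = φ.ordVars ∪ seqOrdVars Γ := by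
  ext κ
  simp [seqOrdVars]

theorem seqOrdVars_nil : seqOrdVars [] = ∅ := by
  ext κ
  simp [seqOrdVars]

theorem seqOrdVars_map {n : ℕ} {f : Fml OrdVar n 0 → AFormula}
    (h : ∀ φ, (f φ).ordVars = φ.ordVars) (Γ : List (Fml OrdVar n 0)) :
    seqOrdVars (Γ.map f) = {κ | ∃ φ ∈ Γ, κ ∈ φ.ordVars} := by
  ext κ
  simp [seqOrdVars, h]

theorem Fml.annotate_substFree (θ : ℕ → Term) (φ : Formula) (ℓ : OrdAssign) :
    (φ.substFree θ).annotate ℓ = (φ.annotate ℓ).substFree θ := annotate_subst _ _ _ _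

theorem Fml.annotate_inst {m : ℕ} (t : Term) (φ : Fml Empty 1 m) (ℓ : OrdAssign) :
    (φ.inst t).annotate ℓ = (φ.annotate ℓ).inst t := annotate_subst _ _ _ _

theorem Fml.nuCount_inst {V : Type} {m : ℕ} (t : Term) (φ : Fml V 1 m) :
    (φ.inst t).nuCount = φ.nuCount := nuCount_subst _ _ _

theorem Fml.nuCount_substFree {V : Type} {m : ℕ} (θ : ℕ → Term) (φ : Fml V 0 m) :
    (φ.substFree θ).nuCount = φ.nuCount := nuCount_subst _ _ _

theorem Fml.ordVars_inst {V : Type} {m : ℕ} (t : Term) (φ : Fml V 1 m) :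
    (φ.inst t).ordVars = φ.ordVars := ordVars_subst _ _ _

theorem Fml.ordVars_substFree {V : Type} {m : ℕ} (θ : ℕ → Term) (φ : Fml V 0 m) :
    (φ.substFree θ).ordVars = φ.ordVars := ordVars_subst _ _ _

theorem Fml.ordVars_annotate_star {n m : ℕ} (φ : Fml Empty n m) :
    (φ.annotate φ.star).ordVars = ∅ := by
  ext κ
  simp only [Set.mem_empty_iff_false, iff_false]
  intro h
  simpa [star] using mem_of_mem_ordVars_annotate h

theorem Fml.annotate_neg_star {n m : ℕ} (φ : Fml Empty n m) :
    φ.neg.annotate φ.neg.star = (φ.annotate φ.star).neg :=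
  annotate_neg φ (fun _ h => (List.mem_replicate.1 h).2) (fun _ h => (List.mem_replicate.1 h).2)

/-- Literals contain no fixed points, so annotating them has no effect. -/
theorem Fml.neg_annotate_nil_of_isLiteral {φ : Formula} (h : φ.IsLiteral) (a b : OrdAssign) :
    φ.neg.annotate a = (φ.annotate []).neg ∧ φ.annotate b = φ.annotate [] := by
  cases φ <;> simp_all [IsLiteral, neg, annotate]

/-! ### The annotated instances of the common rules -/

namespace BaseRule

/-- Only `id` needs care: in `Γ, ¬φ, φ` the two formulas have their `ν` at dual places, so
independently annotated copies need not be negations of each other. For literals nothing is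
annotated and the axiom survives. -/
theorem concl_annotate {b : BaseRule Empty} {ℓ : List OrdAssign} (h : Matches b.concl ℓ)
    (hid : ∀ Γ φ, b = id Γ φ → φ.IsLiteral) :
    (b.annotate ℓ).concl = annotateList b.concl ℓ := by
  cases b with
  | id Γ φ =>
    obtain ⟨ℓ₁, ℓ₂, rfl, h₁, -, h₂⟩ := h.exists_append
    obtain ⟨a, ℓ₂, rfl, -, h₂⟩ := h₂.exists_cons
    obtain ⟨c, ℓ₂, rfl, -, h₂⟩ := h₂.exists_cons
    obtain rfl := h₂.eq_nil
    obtain ⟨h₃, h₄⟩ := Fml.neg_annotate_nil_of_isLiteral (hid Γ φ rfl) a c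
    simp [annotate, concl, annotateList_append h₁, annotateList_cons, annotateList_nil, h₁, h₃, h₄]
  | wk Γ Δ =>
    obtain ⟨ℓ₁, ℓ₂, rfl, h₁, -, h₂⟩ := h.exists_append
    simp [annotate, concl, annotateList_append h₁, h₁]
  | exch Γ φ ψ Δ =>
    obtain ⟨ℓ₁, ℓ₂, rfl, h₁, -, h₂⟩ := h.exists_append
    obtain ⟨a, ℓ₂, rfl, -, h₂⟩ := h₂.exists_cons
    obtain ⟨c, ℓ₂, rfl, -, h₂⟩ := h₂.exists_cons
    simp [annotate, concl, annotateList_append h₁, annotateList_cons, h₁]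
  | sub θ Γ => exact (annotateList_map (Fml.annotate_substFree θ) Γ ℓ).symm
  | cut Γ φ => rfl
  | and Γ φ ψ | or Γ φ ψ | all Γ φ y | ex Γ φ t | mu Γ t φ =>
    obtain ⟨ℓ₁, a, rfl, h₁, -, h₂⟩ := h.exists_concat
    simp [annotate, concl, annotateList_append h₁, annotateList_cons, annotateList_nil, h₁,
      Fml.annotate]
  | eqSub Γ s t =>
    obtain ⟨ℓ₁, a, rfl, h₁, -, h₂⟩ := h.exists_concat
    rw [List.length_map] at h₁
    simp [annotate, concl, annotateList_append (Γ := Γ.map (Fml.inst t)) (ℓ := ℓ₁) (by simp [h₁]),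
      annotateList_cons, annotateList_nil, h₁, Fml.annotate,
      annotateList_map (Fml.annotate_inst t)]
  | refl t =>
    obtain ⟨a, ℓ, rfl, -, h⟩ := h.exists_cons
    obtain rfl := h.eq_nil
    rfl
  | pa i x y =>
    obtain ⟨a, ℓ, rfl, -, h⟩ := h.exists_cons
    obtain rfl := h.eq_nil
    fin_cases i <;> rfl
  | nat t =>
    obtain ⟨a, ℓ, rfl, -, h⟩ := h.exists_cons
    obtain rfl := h.eq_nil
    rfl

/-- The second part carries the length condition on assignments to the premises, where the
translation needs it again. -/
theorem prems_annotate {b : BaseRule Empty} {ℓ : List OrdAssign} (h : Matches b.concl ℓ) :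
    (b.annotate ℓ).prems = List.zipWith annotateList b.prems (b.premAssign ℓ) ∧
      List.Forall₂ Matches b.prems (b.premAssign ℓ) := by
  cases b with
  | id Γ φ => exact ⟨rfl, .nil⟩
  | wk Γ Δ =>
    obtain ⟨ℓ₁, ℓ₂, rfl, h₁, h₂, -⟩ := h.exists_append
    simp [annotate, prems, premAssign, h₁, h₂]
  | exch Γ φ ψ Δ =>
    obtain ⟨ℓ₁, ℓ₂, rfl, h₁, h₂, h₃⟩ := h.exists_append
    obtain ⟨a, ℓ₂, rfl, ha, h₃⟩ := h₃.exists_cons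
    obtain ⟨c, ℓ₂, rfl, hc, h₃⟩ := h₃.exists_cons
    simp [annotate, prems, premAssign, annotateList_append h₁, annotateList_cons, h₁,
      h₂.append (.cons hc (.cons ha h₃))]
  | sub θ Γ => exact ⟨rfl, .cons ((Matches.map_of_nuCount (Fml.nuCount_substFree θ)).1 h) .nil⟩
  | cut Γ φ =>
    have h₁ : Γ.length = ℓ.length := h.length_eq.symm
    have hs : ∀ φ : Formula, φ.star.length = φ.nuCount := fun φ => by simp [Fml.star]
    simp [annotate, prems, premAssign, annotateList_append h₁, annotateList_cons, annotateList_nil,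
      Fml.annotate_neg_star]
    exact ⟨h.append (.single (hs _)), h.append (.single (hs _))⟩
  | and Γ φ ψ =>
    obtain ⟨ℓ₁, a, rfl, h₁, h₂, h₃⟩ := h.exists_concat
    simp only [Fml.nuCount] at h₃
    simp [annotate, prems, premAssign, annotateList_append h₁, annotateList_cons, annotateList_nil,
      h₁, h₂.append (.single (φ := φ) (a := a.take φ.nuCount) (by simp [h₃])),
      h₂.append (.single (φ := ψ) (a := a.drop φ.nuCount) (by simp [h₃]))]
  | or Γ φ ψ =>
    obtain ⟨ℓ₁, a, rfl, h₁, h₂, h₃⟩ := h.exists_concat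
    simp only [Fml.nuCount] at h₃
    simp [annotate, prems, premAssign, annotateList_append h₁, annotateList_cons, annotateList_nil,
      h₁, h₂.append (.cons (φ := φ) (a := a.take φ.nuCount) (by simp [h₃])
        (.single (φ := ψ) (a := a.drop φ.nuCount) (by simp [h₃])))]
  | all Γ φ y | ex Γ φ y =>
    obtain ⟨ℓ₁, a, rfl, h₁, h₂, h₃⟩ := h.exists_concat
    have h₃ : a.length = φ.nuCount := h₃
    simp [annotate, prems, premAssign, annotateList_append h₁, annotateList_cons, annotateList_nil,
      h₁, Fml.annotate_inst, h₂.append (.single (h₃.trans (Fml.nuCount_inst _ _).symm))]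
  | eqSub Γ s t =>
    obtain ⟨ℓ₁, a, rfl, h₁, h₂, h₃⟩ := h.exists_concat
    rw [List.length_map] at h₁
    rw [Matches.map_of_nuCount (Fml.nuCount_inst t), ← Matches.map_of_nuCount (Fml.nuCount_inst s)]
      at h₂
    simp [annotate, prems, premAssign, h₁, annotateList_map (Fml.annotate_inst s), h₂]
  | refl t => exact ⟨rfl, .nil⟩
  | pa i x y => exact ⟨rfl, .nil⟩
  | nat t => exact ⟨rfl, .nil⟩
  | mu Γ t φ =>
    obtain ⟨ℓ₁, a, rfl, h₁, h₂, h₃⟩ := h.exists_concat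
    simp [annotate, prems, premAssign, annotateList_append h₁, annotateList_cons, annotateList_nil,
      h₁, Fml.annotate_plug_mu, h₂.append (.single (Fml.length_muAssign φ t a))]

theorem valid_annotate {b : BaseRule Empty} (h : b.Valid) (ℓ : List OrdAssign) :
    (b.annotate ℓ).Valid := by
  cases b with
  | all Γ φ y =>
    refine ⟨fun ψ hψ => ?_, ?_⟩
    · obtain ⟨χ, hχ, e⟩ := fv_of_mem_annotateList hψ
      exact e ▸ h.1 χ hχ
    · exact (Fml.fv_annotate φ _).symm ▸ h.2
  | _ => trivial

/-- These rules only copy annotations from the conclusion, and cut formulas have none. Hence the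
unchanged constraint still covers every premise. -/
theorem seqOrdVars_prems_annotate (b : BaseRule Empty) (ℓ : List OrdAssign) {Γ : ASequent}
    (hΓ : Γ ∈ (b.annotate ℓ).prems) : seqOrdVars Γ ⊆ seqOrdVars (b.annotate ℓ).concl := by
  cases b with
  | cut Δ φ =>
    simp only [annotate, prems, concl, List.mem_cons, List.not_mem_nil, or_false] at hΓ ⊢
    rcases hΓ with rfl | rfl
    · simp [seqOrdVars_append, seqOrdVars_cons, seqOrdVars_nil, Fml.ordVars_annotate_star]
    · simp [seqOrdVars_append, seqOrdVars_cons, seqOrdVars_nil, ← Fml.annotate_neg_star,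
        Fml.ordVars_annotate_star]
  | id Δ φ | refl t | pa i x y | nat t => simp [annotate, prems] at hΓ
  | sub θ Δ =>
    simp only [annotate, prems, concl, List.mem_cons, List.not_mem_nil, or_false] at hΓ ⊢
    subst hΓ
    rw [seqOrdVars_map (Fml.ordVars_substFree θ)]
    exact le_rfl
  | eqSub Δ s t =>
    simp only [annotate, prems, concl, List.mem_cons, List.not_mem_nil, or_false] at hΓ ⊢
    subst hΓ
    rw [seqOrdVars_append, seqOrdVars_map (Fml.ordVars_inst t), seqOrdVars_map (Fml.ordVars_inst s)]
    exact Set.subset_union_left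
  | mu Δ t φ =>
    simp only [annotate, prems, concl, List.mem_cons, List.not_mem_nil, or_false] at hΓ ⊢
    subst hΓ
    simp only [seqOrdVars_append, seqOrdVars_cons, seqOrdVars_nil, Set.union_empty]
    refine Set.union_subset_union_right _ ((Fml.ordVars_plug_subset _ _ _).trans ?_)
    simp [STm.ordVars, Fml.ordVars]
  | exch Δ φ ψ Λ =>
    simp only [annotate, prems, concl, List.mem_cons, List.not_mem_nil, or_false] at hΓ ⊢
    subst hΓ
    simp only [seqOrdVars_append, seqOrdVars_cons]
    rw [Set.union_left_comm (Fml.ordVars _) (Fml.ordVars _)]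
  | _ =>
    simp only [annotate, prems, concl, List.mem_cons, List.not_mem_nil, or_false] at hΓ ⊢
    rcases hΓ with rfl | rfl <;>
    · intro κ hκ
      simp only [seqOrdVars_append, seqOrdVars_cons, seqOrdVars_nil, Set.union_empty,
        Fml.ordVars_inst, Fml.ordVars, Set.mem_union] at hκ ⊢
      tauto

theorem length_prems_le (b : BaseRule Empty) : b.prems.length ≤ 2 := by
  cases b <;> simp [prems]

end BaseRule

/-! ### Constraints -/

namespace Constraint

theorem isConstraint_empty : empty.IsConstraint where
  mem _ _ h := h.elim
  irrefl _ h := h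
  trans _ _ _ h := h.elim
  linear _ _ _ h := h.elim

theorem fresh_notMem (O : Constraint) : O.fresh ∉ O.V :=
  Nat.sInf_mem (s := {l | l ∉ O.V}) (Infinite.exists_notMem_finset O.V)

/-- Among the first `card + 1` indices at least one is unused. A bound on the size of constraints
thus bounds the indices of all variables. -/
theorem fresh_le_card (O : Constraint) : O.fresh ≤ O.V.card := by
  by_contra! h
  have : Finset.range (O.V.card + 1) ⊆ O.V := by
    intro l hl
    by_contra hl'
    have : O.fresh ≤ l := Nat.sInf_le hl'
    exact h.not_ge (this.trans (Nat.lt_succ_iff.1 (Finset.mem_range.1 hl)))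
  simpa using Finset.card_le_card this

namespace IsConstraint

variable {O : Constraint} (hO : O.IsConstraint)

include hO

theorem remove (L : Finset OrdVar) : (O.remove L).IsConstraint where
  mem _ _ h := h.2
  irrefl a h := hO.irrefl a h.1
  trans a b c h h' := ⟨hO.trans a b c h.1 h'.1, h.2.1, h'.2.2⟩
  linear a b c h h' := by
    rcases hO.linear a b c h.1 h'.1 with h1 | h1 | h1
    · exact .inl ⟨h1, h.2.2, h'.2.2⟩
    · exact .inr (.inl h1)
    · exact .inr (.inr ⟨h1, h'.2.2, h.2.2⟩)

theorem addRoot (l : OrdVar) : (O.addRoot l).IsConstraint where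
  mem a b h := ⟨Finset.mem_insert_of_mem (hO.mem a b h).1, Finset.mem_insert_of_mem (hO.mem a b h).2⟩
  irrefl := hO.irrefl
  trans := hO.trans
  linear := hO.linear

/-- Above the new variable lie `κ` and what is above `κ`, which is a chain. Since `l` is fresh,
nothing was below or above it before. -/
theorem addChild {κ l : OrdVar} (hκ : κ ∈ O.V) (hl : l ∉ O.V) :
    (O.addChild κ l).IsConstraint where
  mem a b h := by
    rcases h with h | ⟨rfl, h | rfl⟩
    · exact ⟨Finset.mem_insert_of_mem (hO.mem a b h).1, Finset.mem_insert_of_mem (hO.mem a b h).2⟩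
    · exact ⟨Finset.mem_insert_self _ _, Finset.mem_insert_of_mem (hO.mem _ b h).2⟩
    · exact ⟨Finset.mem_insert_self _ _, Finset.mem_insert_of_mem hκ⟩
  irrefl a h := by
    rcases h with h | ⟨rfl, h | rfl⟩
    · exact hO.irrefl a h
    · exact hl (hO.mem _ _ h).2
    · exact hl hκ
  trans a b c h h' := by
    rcases h' with h' | ⟨rfl, h'⟩
    · rcases h with h | ⟨rfl, h | rfl⟩
      · exact .inl (hO.trans a b c h h')
      · exact .inr ⟨rfl, .inl (hO.trans _ b c h h')⟩
      · exact .inr ⟨rfl, .inl h'⟩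
    · rcases h with h | ⟨rfl, h | rfl⟩
      · exact absurd (hO.mem _ _ h).2 hl
      · exact absurd (hO.mem _ _ h).2 hl
      · exact absurd hκ hl
  linear a b c h h' := by
    rcases h with h | ⟨rfl, h⟩ <;> rcases h' with h' | ⟨h1, h'⟩
    · exact (hO.linear a b c h h').imp Or.inl (Or.imp_right Or.inl)
    · subst h1
      exact absurd (hO.mem _ _ h).1 hl
    · exact absurd (hO.mem _ _ h').1 hl
    · rcases h with h | rfl <;> rcases h' with h' | rfl
      · exact (hO.linear κ b c h h').imp Or.inl (Or.imp_right Or.inl)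
      · exact .inr (.inr (.inl h))
      · exact .inl (.inl h')
      · exact .inr (.inl rfl)

end IsConstraint

end Constraint

namespace Reduction

theorem removed_subset (O : Constraint) (Γ : ASequent) (ρ : Reduction) : ρ.removed O Γ ⊆ O.V := by
  classical
  cases ρ <;> exact Finset.filter_subset _ _

theorem removed_nonempty {O : Constraint} {Γ : ASequent} {ρ : Reduction}
    (h : ρ.Applicable O Γ) : (ρ.removed O Γ).Nonempty := by
  cases ρ with
  | rs κ => exact h.2.2.1
  | pr => exact h

theorem notMem_seqOrdVars_of_mem_removed {O : Constraint} {Γ : ASequent} {ρ : Reduction}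
    (h : ρ.Applicable O Γ) {κ : OrdVar} (hκ : κ ∈ ρ.removed O Γ) : κ ∉ seqOrdVars Γ := by
  classical
  cases ρ with
  | rs κ' => exact h.2.2.2 κ hκ
  | pr => exact (Finset.mem_filter.1 hκ).2 κ (Finset.mem_filter.1 hκ).1 (.inr rfl)

/-- This is the termination measure for blocks of reductions. -/
theorem card_remove_lt {O : Constraint} {Γ : ASequent} {ρ : Reduction}
    (h : ρ.Applicable O Γ) : (O.remove (ρ.removed O Γ)).V.card < O.V.card := by
  obtain ⟨κ, hκ⟩ := removed_nonempty h
  refine Finset.card_lt_card ⟨Finset.sdiff_subset, fun hs => ?_⟩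
  exact (Finset.mem_sdiff.1 (hs (removed_subset O Γ ρ hκ))).2 hκ

end Reduction

/-! ### The steps of the translation -/

namespace State

variable {D : Coderivation plainSystem} {σ : ReductionStrategy}

/-- The invariant of the calls of the translation: `r` is the rule at the root of the
sub-coderivation, and the extended sequent is well-formed. -/
structure WF (D : Coderivation plainSystem) (s : State) (r : Rule) : Prop where
  label : D.label s.node = some r
  matches_ : Matches r.concl s.ℓ
  ext : IsExtSequent (s.O, annotateList r.concl s.ℓ)
  notPending : s.pending = false → ∃ Γ t φ κ ℓ₀,
    r = .nu Γ t φ ∧ s.ℓ.getD Γ.length [] = some κ :: ℓ₀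

/-- The steps of the translation from a well-formed state at the rule `r`. -/
inductive Trans (D : Coderivation plainSystem) (σ : ReductionStrategy) (s : State) :
    Rule → ARule → List State → Prop
  | red (r : Rule) (ρ : Reduction) (hr : r.prems ≠ []) (hp : s.pending = true)
      (hρ : ρ.Applicable s.O (annotateList r.concl s.ℓ)) :
      Trans D σ s r (.red s.O (annotateList r.concl s.ℓ) ρ)
        [{ s with O := s.O.remove (ρ.removed s.O (annotateList r.concl s.ℓ)) }]
  | base (b : BaseRule Empty) (hp : s.pending = true)
      (hn : b.prems ≠ [] → ∀ ρ : Reduction, ¬ ρ.Applicable s.O (annotateList b.concl s.ℓ)) :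
      Trans D σ s (.base b) (.base s.O (b.annotate s.ℓ))
        ((b.premAssign s.ℓ).mapIdx fun i ℓ' => ⟨s.node ++ [i == 1], s.O, ℓ', true⟩)
  | nu (Γ : Sequent) (t : Term) (φ : Fml Empty 1 1) (ℓ₁ : List OrdAssign) (ℓ₀ : OrdAssign)
      (hℓ : s.ℓ = ℓ₁ ++ [none :: ℓ₀]) (hΓ : Matches Γ ℓ₁) (hp : s.pending = true)
      (hφ : ℓ₀.length = φ.nuCount)
      (hn : ∀ ρ : Reduction, ¬ ρ.Applicable s.O (annotateList (Γ ++ [.nu none t φ]) s.ℓ)) :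
      Trans D σ s (.nu Γ t φ) (.nu s.O (annotateList Γ ℓ₁) t (φ.annotate ℓ₀) s.O.fresh)
        [⟨s.node, s.O.addRoot s.O.fresh, ℓ₁ ++ [some s.O.fresh :: ℓ₀], false⟩]
  | nuK (Γ : Sequent) (t : Term) (φ : Fml Empty 1 1) (κ : OrdVar) (ℓ₁ : List OrdAssign)
      (ℓ₀ : OrdAssign) (hℓ : s.ℓ = ℓ₁ ++ [some κ :: ℓ₀]) (hΓ : Matches Γ ℓ₁)
      (hφ : ℓ₀.length = φ.nuCount) (hn : s.pending = true → ∀ ρ : Reduction,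
        ¬ ρ.Applicable s.O (annotateList (Γ ++ [.nu none t φ]) s.ℓ)) :
      Trans D σ s (.nu Γ t φ) (.nuK s.O (annotateList Γ ℓ₁) κ t (φ.annotate ℓ₀) s.O.fresh)
        [⟨s.node ++ [false], s.O.addChild κ s.O.fresh, ℓ₁ ++ [nuAssign φ t s.O.fresh ℓ₀], true⟩]

/-- A well-formed call never gets stuck. The assignment of a principal `ν`-formula is non-empty
because the `ν` itself counts, and a call that is not pending sits at a `ν`-rule whose principal
formula is already annotated. -/
theorem WF.exists_trans {s : State} {r : Rule} (h : s.WF D r) :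
    ∃ ar ss, s.step D σ = some (ar, ss) ∧ s.Trans D σ r ar ss := by
  have hsel : ∀ o, (if s.pending && !r.prems.isEmpty then
      σ.next s.O (annotateList r.concl s.ℓ) else none) = o →
      ∃ ar ss, s.step D σ = some (ar, ss) ∧ s.Trans D σ r ar ss := by
    rintro (_ | ρ) ho
    · have hn : s.pending = true → r.prems ≠ [] →
          ∀ ρ : Reduction, ¬ ρ.Applicable s.O (annotateList r.concl s.ℓ) := by
        intro hp hr
        rw [if_pos (by simp [hp, hr])] at ho
        exact σ.complete _ _ ho
      cases r with
      | base b =>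
        have hp : s.pending = true := by
          by_contra hp
          obtain ⟨Γ, t, φ, κ, ℓ₀, h, -⟩ := h.notPending (by simpa using hp)
          cases h
        refine ⟨_, _, ?_, .base b hp (hn hp)⟩
        rw [step, h.label]
        simp only [ho]
      | nu Γ t φ =>
        obtain ⟨ℓ₁, a, hℓ, hΓ, hM, ha⟩ := Matches.exists_concat (show Matches (Γ ++ _) _ from h.matches_)
        have hg : s.ℓ.getD Γ.length [] = a := by simp [hℓ, hΓ]
        have ht : s.ℓ.take Γ.length = ℓ₁ := by simp [hℓ, hΓ]
        rcases a with _ | ⟨_ | κ, ℓ₀⟩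
        · simp [Fml.nuCount] at ha
        · have hp : s.pending = true := by
            by_contra hp
            obtain ⟨Γ', t', φ', κ, ℓ', h1, h2⟩ := h.notPending (by simpa using hp)
            cases h1
            rw [hg] at h2
            cases h2
          refine ⟨_, _, ?_, .nu Γ t φ ℓ₁ ℓ₀ hℓ hM hp (by simpa [Fml.nuCount] using ha)
            (hn hp (by simp [Rule.prems]))⟩
          rw [step, h.label]
          simp only [ho, hg, ht]
        · refine ⟨_, _, ?_, .nuK Γ t φ κ ℓ₁ ℓ₀ hℓ hM (by simpa [Fml.nuCount] using ha)
            fun hp => hn hp (by simp [Rule.prems])⟩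
          rw [step, h.label]
          simp only [ho, hg, ht]
    · have hc : (s.pending && !r.prems.isEmpty) = true := by
        by_contra hc
        rw [if_neg hc] at ho
        cases ho
      rw [if_pos hc] at ho
      have hc' : s.pending = true ∧ r.prems ≠ [] := by simpa using hc
      refine ⟨_, _, ?_, .red r ρ hc'.2 hc'.1 (σ.sound _ _ _ ho)⟩
      rw [step, h.label]
      simp only [hc, if_true, ho]
  exact hsel _ rfl

theorem annotate_nu_concl {Γ : Sequent} {ℓ₁ : List OrdAssign} (hΓ : Matches Γ ℓ₁) (t : Term)
    (φ : Fml Empty 1 1) (a : Option OrdVar) (ℓ₀ : OrdAssign) :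
    annotateList (Γ ++ [.nu none t φ]) (ℓ₁ ++ [a :: ℓ₀]) =
      annotateList Γ ℓ₁ ++ [.nu a t (φ.annotate ℓ₀)] := by
  rw [annotateList_append hΓ.length_eq.symm]
  rfl

/-- The conclusion of the rule instance at the root of the translation. -/
theorem Trans.concl_eq (hid : D.HasAtomicIdentities) {s : State} {r : Rule} {ar : ARule}
    {ss : List State} (h : s.WF D r) (ht : s.Trans D σ r ar ss) :
    ar.concl = (s.O, annotateList r.concl s.ℓ) := by
  cases ht with
  | red r ρ => rfl
  | base b =>
    simp only [ARule.concl, Rule.concl]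
    rw [BaseRule.concl_annotate h.matches_ fun Γ φ hb => hid _ _ _ (hb ▸ h.label)]
  | nu Γ t φ ℓ₁ ℓ₀ hℓ hΓ => simp only [ARule.concl, Rule.concl, hℓ, annotate_nu_concl hΓ]
  | nuK Γ t φ κ ℓ₁ ℓ₀ hℓ hΓ => simp only [ARule.concl, Rule.concl, hℓ, annotate_nu_concl hΓ]

/-- Rules are at most binary, so the premise index `i` is coded by the bit `i == 1`. -/
theorem _root_.MuPA.Coderivation.exists_label_of_prems {v : List Bool} {r : Rule}
    (h : D.label v = some r) {i : ℕ} (hi : i < 2) {Γ : Sequent} (hΓ : r.prems[i]? = some Γ) :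
    ∃ r', D.label (v ++ [i == 1]) = some r' ∧ r'.concl = Γ := by
  have h1 := D.isCoderivation.succ v r (i == 1) h
  have h2 : (i == 1).toNat = i := by interval_cases i <;> rfl
  change _ = r.prems[(i == 1).toNat]? at h1
  rw [h2, hΓ, Option.map_eq_some_iff] at h1
  exact h1

/-- The premises of the rule instance at the root of the translation are the conclusions of the
recursive calls. -/
theorem Trans.prems_eq (hid : D.HasAtomicIdentities) {s : State} {r : Rule} {ar : ARule}
    {ss : List State} (h : s.WF D r) (ht : s.Trans D σ r ar ss) :
    (∀ s' ∈ ss, ∃ r', s'.WF D r' ∧ (s'.O, annotateList r'.concl s'.ℓ) ∈ ar.prems) ∧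
    (∀ i : ℕ, (∃ s' r', ss[i]? = some s' ∧ s'.WF D r' ∧
      ar.prems[i]? = some (s'.O, annotateList r'.concl s'.ℓ)) ∨
      (ss[i]? = none ∧ ar.prems[i]? = none)) := by
  suffices H : ∀ i : ℕ, (∃ s' r', ss[i]? = some s' ∧ s'.WF D r' ∧
      ar.prems[i]? = some (s'.O, annotateList r'.concl s'.ℓ)) ∨
      (ss[i]? = none ∧ ar.prems[i]? = none) by
    refine ⟨fun s' hs' => ?_, H⟩
    obtain ⟨i, hi⟩ := List.getElem?_of_mem hs'
    rcases H i with ⟨s'', r', h1, h2, h3⟩ | ⟨h1, -⟩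
    · rw [hi] at h1
      cases h1
      exact ⟨r', h2, List.mem_of_getElem? h3⟩
    · rw [hi] at h1
      cases h1
  intro i
  cases ht with
  | red r ρ hr hp hρ =>
    rcases i with _ | i
    · refine .inl ⟨_, r, rfl, ⟨h.label, h.matches_, ⟨h.ext.1.remove _, fun κ hκ => ?_⟩,
        fun h' => absurd (hp.symm.trans h') (by simp)⟩, rfl⟩
      -- A reduction removes only variables that do not occur in the sequent, so the smaller
      -- constraint still covers it.
      exact Finset.mem_sdiff.2 ⟨h.ext.2 κ hκ,
        fun h' => Reduction.notMem_seqOrdVars_of_mem_removed hρ h' hκ⟩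
    · exact .inr (by simp [ARule.prems])
  | base b hp hn =>
    obtain ⟨hprems, hM⟩ := BaseRule.prems_annotate (b := b) h.matches_
    have hlen := hM.length_eq
    by_cases hi : i < b.prems.length
    · have hi' : i < (b.premAssign s.ℓ).length := hlen ▸ hi
      obtain ⟨r', hr', hc⟩ := D.exists_label_of_prems h.label
        (hi.trans_le b.length_prems_le) (List.getElem?_eq_getElem hi)
      have hseq : annotateList r'.concl (b.premAssign s.ℓ)[i] ∈ (b.annotate s.ℓ).prems := by
        rw [hprems, hc]
        exact List.mem_of_getElem? (i := i) (by simp [hi, hi'])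
      refine .inl ⟨⟨s.node ++ [i == 1], s.O, (b.premAssign s.ℓ)[i], true⟩, r',
        by rw [List.getElem?_mapIdx, List.getElem?_eq_getElem hi']; rfl,
        ⟨hr', ?_, ⟨h.ext.1, fun κ hκ => ?_⟩, fun h' => by simp at h'⟩, ?_⟩
      · exact hc ▸ (List.forall₂_iff_get.1 hM).2 i hi hi'
      · refine h.ext.2 κ ?_
        have := BaseRule.seqOrdVars_prems_annotate b s.ℓ hseq hκ
        rwa [BaseRule.concl_annotate h.matches_ fun Γ φ hb => hid _ _ _ (hb ▸ h.label)] at this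
      · simp [ARule.prems, hprems, hi, hi', hc]
    · right
      have hi' : (b.premAssign s.ℓ).length ≤ i := by omega
      simp only [ARule.prems, hprems, List.getElem?_mapIdx, List.getElem?_map]
      simp [hi']
  | nu Γ t φ ℓ₁ ℓ₀ hℓ hΓ hp hφ hn =>
    rcases i with _ | i
    · have hext := h.ext
      simp only [Rule.concl, hℓ, annotate_nu_concl hΓ] at hext
      refine .inl ⟨_, _, rfl, ⟨h.label, ?_, ⟨hext.1.addRoot _, ?_⟩, fun _ =>
        ⟨Γ, t, φ, s.O.fresh, ℓ₀, rfl, by simp [hΓ.length_eq.symm]⟩⟩, ?_⟩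
      · exact hΓ.append (.single (by simp [Fml.nuCount, hφ]))
      · intro κ hκ
        simp only [Rule.concl, annotate_nu_concl hΓ] at hκ
        have hext := hext.2 κ
        simp only [seqOrdVars_append, seqOrdVars_cons, seqOrdVars_nil, Fml.ordVars, Set.union_empty,
          Set.mem_union] at hκ hext
        rcases hκ with hκ | hκ | hκ
        · exact Finset.mem_insert_of_mem (hext (.inl hκ))
        · cases hκ
          exact Finset.mem_insert_self _ _
        · exact Finset.mem_insert_of_mem (hext (.inr (.inr hκ)))
      · simp [ARule.prems, Rule.concl, annotate_nu_concl hΓ]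
    · exact .inr (by simp [ARule.prems])
  | nuK Γ t φ κ ℓ₁ ℓ₀ hℓ hΓ hφ hn =>
    rcases i with _ | i
    · have hext := h.ext
      simp only [Rule.concl, hℓ, annotate_nu_concl hΓ] at hext
      obtain ⟨r', hr', hc⟩ := D.exists_label_of_prems h.label (i := 0) (by simp) (Γ := _) rfl
      have hseq : annotateList r'.concl (ℓ₁ ++ [nuAssign φ t s.O.fresh ℓ₀]) =
          annotateList Γ ℓ₁ ++
            [(φ.annotate ℓ₀).plug (.nu (some s.O.fresh) (φ.annotate ℓ₀)) t] := by
        rw [hc, annotateList_append hΓ.length_eq.symm, annotateList_cons, Fml.annotate_plug_nu]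
        rfl
      -- The parent of the new variable annotates the principal formula, hence belongs to the
      -- constraint.
      have hκ : κ ∈ s.O.V := by
        refine hext.2 κ ?_
        simp [seqOrdVars_append, seqOrdVars_cons, Fml.ordVars]
      refine .inl ⟨_, r', rfl, ⟨hr', ?_, ⟨hext.1.addChild hκ s.O.fresh_notMem, ?_⟩, fun h' => by
        simp at h'⟩, ?_⟩
      · rw [hc]
        exact hΓ.append (.single (Fml.length_nuAssign _ _ _ _))
      · intro κ' hκ'
        simp only [hseq] at hκ'
        have hext := hext.2 κ'
        simp only [seqOrdVars_append, seqOrdVars_cons, seqOrdVars_nil, Fml.ordVars, Set.union_empty,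
          Set.mem_union] at hκ' hext
        rcases hκ' with hκ' | hκ'
        · exact Finset.mem_insert_of_mem (hext (.inl hκ'))
        · rcases Fml.ordVars_plug_subset _ _ _ hκ' with (hκ' | hκ') | hκ'
          · cases hκ'
            exact Finset.mem_insert_self _ _
          · exact Finset.mem_insert_of_mem (hext (.inr (.inr hκ')))
          · exact Finset.mem_insert_of_mem (hext (.inr (.inr hκ')))
      · simp [ARule.prems, hseq]
    · exact .inr (by simp [ARule.prems])

theorem Trans.side {s : State} {r : Rule} {ar : ARule}
    {ss : List State} (h : s.WF D r) (ht : s.Trans D σ r ar ss) : ar.Side := by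
  cases ht with
  | red r ρ hr hp hρ => exact hρ
  | base b => exact BaseRule.valid_annotate (D.isCoderivation.valid _ _ h.label) _
  | nu | nuK => exact s.O.fresh_notMem

theorem Trans.valid (hid : D.HasAtomicIdentities) {s : State} {r : Rule} {ar : ARule}
    {ss : List State} (h : s.WF D r) (ht : s.Trans D σ r ar ss) : ar.Valid := by
  refine ⟨ht.side h, ht.concl_eq hid h ▸ h.ext, fun p hp => ?_⟩
  obtain ⟨i, hi⟩ := List.getElem?_of_mem hp
  rcases (ht.prems_eq hid h).2 i with ⟨s', r', -, h2, h3⟩ | ⟨-, h2⟩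
  · rw [hi] at h3
    cases h3
    exact h2.ext
  · rw [hi] at h2
    cases h2

theorem at_append (s : State) (v : List Bool) (b : Bool) :
    State.at D σ s (v ++ [b]) =
      (State.at D σ s v).bind fun s' => (s'.step D σ).bind fun x => x.2[b.toNat]? := by
  simp [State.at]

theorem WF.at (hid : D.HasAtomicIdentities) {s₀ : State} {r₀ : Rule} (h₀ : s₀.WF D r₀)
    {v : List Bool} {s : State} (hs : State.at D σ s₀ v = some s) : ∃ r, s.WF D r := by
  induction v using List.reverseRecOn generalizing s with
  | nil =>
    cases hs
    exact ⟨r₀, h₀⟩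
  | append_singleton v b ih =>
    rw [at_append, Option.bind_eq_some_iff] at hs
    obtain ⟨s', hs', hs⟩ := hs
    obtain ⟨r', h'⟩ := ih hs'
    obtain ⟨ar, ss, hstep, ht⟩ := h'.exists_trans (σ := σ)
    rw [hstep] at hs
    obtain ⟨r, hr, -⟩ := (ht.prems_eq hid h').1 s (List.mem_of_getElem? hs)
    exact ⟨r, hr⟩

end State

/-! ### The translation is an annotated coderivation -/

namespace Coderivation

open State

variable {D : Coderivation plainSystem} {σ : ReductionStrategy}

theorem translate_eq_some_iff (hid : D.HasAtomicIdentities) {O : Constraint} {ℓ : List OrdAssign}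
    {r₀ : Rule} (h₀ : (⟨[], O, ℓ, true⟩ : State).WF D r₀) {v : List Bool} {ar : ARule} :
    D.translate σ O ℓ v = some ar ↔ ∃ s r ss, State.at D σ ⟨[], O, ℓ, true⟩ v = some s ∧
      s.WF D r ∧ s.step D σ = some (ar, ss) ∧ s.Trans D σ r ar ss := by
  rw [translate, Option.bind_eq_some_iff]
  constructor
  · rintro ⟨s, hs, har⟩
    obtain ⟨r, hr⟩ := h₀.at hid hs
    obtain ⟨ar', ss, hstep, ht⟩ := hr.exists_trans (σ := σ)
    rw [hstep] at har
    cases har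
    exact ⟨s, r, ss, hs, hr, hstep, ht⟩
  · rintro ⟨s, r, ss, hs, hr, hstep, ht⟩
    exact ⟨s, hs, by rw [hstep]; rfl⟩

/-- The calls at the successors of a node are those listed by `State.step`. `State.Trans.prems_eq`
matches them with the premises index by index, including the indices at which both are absent. -/
theorem isCoderivation_translate (hid : D.HasAtomicIdentities) {O : Constraint}
    {ℓ : List OrdAssign} {r₀ : Rule} (h₀ : (⟨[], O, ℓ, true⟩ : State).WF D r₀) :
    IsCoderivation annotatedSystem (D.translate σ O ℓ) where
  root := by
    obtain ⟨ar, ss, hstep, ht⟩ := h₀.exists_trans (σ := σ)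
    rw [(translate_eq_some_iff hid h₀).2 ⟨_, _, _, rfl, h₀, hstep, ht⟩]
    simp
  prefix_closed v b h := by
    rw [translate, at_append]
    cases hs : State.at D σ ⟨[], O, ℓ, true⟩ v with
    | none => rfl
    | some s =>
      rw [translate, hs] at h
      have : s.step D σ = none := by simpa using h
      simp [this]
  valid v ar h := by
    obtain ⟨s, r, ss, -, hr, -, ht⟩ := (translate_eq_some_iff hid h₀).1 h
    exact ht.valid hid hr
  succ v ar b h := by
    obtain ⟨s, r, ss, hs, hr, hstep, ht⟩ := (translate_eq_some_iff hid h₀).1 h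
    have hat : State.at D σ ⟨[], O, ℓ, true⟩ (v ++ [b]) = ss[b.toNat]? := by
      rw [at_append, hs, Option.bind_some, hstep]
      rfl
    rcases (ht.prems_eq hid hr).2 b.toNat with ⟨s', r', h1, h2, h3⟩ | ⟨h1, h2⟩
    · obtain ⟨ar', ss', hstep', ht'⟩ := h2.exists_trans (σ := σ)
      rw [(translate_eq_some_iff hid h₀).2 ⟨s', r', ss', hat.trans h1, h2, hstep', ht'⟩]
      exact (congrArg some (ht'.concl_eq hid h2)).trans h3.symm
    · have : D.translate σ O ℓ (v ++ [b]) = none := by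
        rw [translate, hat, h1]
        rfl
      rw [this]
      exact h2.symm

/-- The initial call of the translation is well-formed. -/
theorem exists_wf_initial (D : Coderivation plainSystem) :
    ∃ r, (⟨[], .empty, D.conclusion.map Fml.star, true⟩ : State).WF D r := by
  obtain ⟨r, hr⟩ := Option.ne_none_iff_exists'.1 D.isCoderivation.root
  have hc : D.conclusion = r.concl := by simp [conclusion, hr]
  refine ⟨r, hr, hc ▸ .star _, ⟨Constraint.isConstraint_empty, fun κ hκ => ?_⟩, fun h => by
    simp at h⟩
  obtain ⟨a, ha, hκ⟩ := mem_of_mem_seqOrdVars hκ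
  obtain ⟨φ, -, rfl⟩ := List.mem_map.1 ha
  simp [Fml.star] at hκ

end Coderivation

/-! ### Children, counting, and stable reset variables in sequences of constraints -/

namespace Constraint

theorem mem_children {O : Constraint} {κ l : OrdVar} :
    l ∈ O.children κ ↔ l ∈ O.V ∧ O.lt l κ ∧ ∀ ξ, O.lt l ξ → O.lt ξ κ → ξ ∉ O.V := by
  classical
  simp only [children, Finset.mem_filter, not_exists, not_and]
  exact ⟨fun h => ⟨h.1, h.2.1, fun ξ h1 h2 h3 => h.2.2 ξ h3 h1 h2⟩,
    fun h => ⟨h.1, h.2.1, fun ξ h3 h1 h2 => h.2.2 ξ h1 h2 h3⟩⟩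

namespace IsConstraint

variable {O : Constraint} (hO : O.IsConstraint)

include hO

/-- Two parents of `l` both lie above `l`, so they are comparable; were they distinct, the lower one
would lie strictly between `l` and the other. -/
theorem eq_of_mem_children {l κ κ' : OrdVar} (h : l ∈ O.children κ) (h' : l ∈ O.children κ') :
    κ = κ' := by
  rw [mem_children] at h h'
  rcases hO.linear l κ κ' h.2.1 h'.2.1 with h1 | h1 | h1
  · exact absurd (hO.mem _ _ h.2.1).2 (h'.2.2 κ h.2.1 h1)
  · exact h1
  · exact absurd (hO.mem _ _ h'.2.1).2 (h.2.2 κ' h'.2.1 h1)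

/-- A nonempty set of variables has a maximal element. -/
theorem exists_maximal {P : OrdVar → Prop} {a : OrdVar} (ha : a ∈ O.V) (hP : P a) :
    ∃ b ∈ O.V, P b ∧ ∀ c, O.lt b c → ¬ P c := by
  classical
  -- Take an element with `P` that has the fewest variables above it; an element above it with `P`
  -- would have strictly fewer.
  obtain ⟨b, hb, hmin⟩ := Finset.exists_min_image (O.V.filter P)
    (fun b => (O.V.filter (O.lt b)).card) ⟨a, by simp [ha, hP]⟩
  rw [Finset.mem_filter] at hb
  refine ⟨b, hb.1, hb.2, fun c hc hPc => ?_⟩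
  have hcV := (hO.mem _ _ hc).2
  refine (hmin c (by simp [hcV, hPc])).not_gt (Finset.card_lt_card ⟨fun x hx => ?_, fun h => ?_⟩)
  · simp only [Finset.mem_filter] at hx ⊢
    exact ⟨hx.1, hO.trans _ _ _ hc hx.2⟩
  · have := h (show c ∈ _ by simp [hcV, hc])
    exact hO.irrefl c (Finset.mem_filter.1 this).2

/-- Choose a maximal variable with `P` below `κ`. As `P` is upward closed, nothing can lie between
it and `κ`. -/
theorem exists_child {P : OrdVar → Prop} {a κ : OrdVar} (ha : O.lt a κ) (hP : P a)
    (hup : ∀ x y, P x → O.lt x y → P y) : ∃ d ∈ O.children κ, P d := by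
  obtain ⟨d, hd, ⟨hd1, hd2⟩, hmax⟩ :=
    hO.exists_maximal (P := fun d => O.lt d κ ∧ P d) (hO.mem _ _ ha).1 ⟨ha, hP⟩
  exact ⟨d, mem_children.2 ⟨hd, hd1, fun ξ h1 h2 _ => hmax ξ h1 ⟨h2, hup _ _ hd2 h1⟩⟩, hd2⟩

/-- If neither a reset nor pruning is possible, at least half of the variables occur in the
sequent. -/
theorem card_le_of_not_applicable {Γ : ASequent} {S : Finset OrdVar}
    (hS : ∀ κ ∈ seqOrdVars Γ, κ ∈ S) (h : ∀ ρ : Reduction, ¬ ρ.Applicable O Γ) :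
    O.V.card ≤ 2 * S.card := by
  classical
  -- Since `κ` cannot be pruned, some descendant of it occurs; it is a proper one, so `κ` has
  -- children. Since `κ` cannot be reset, one of these children occurs.
  have hchild : ∀ κ ∈ O.V, κ ∉ seqOrdVars Γ → ∃ c ∈ O.children κ, c ∈ seqOrdVars Γ := by
    intro κ hκ hκΓ
    have h1 : κ ∉ prunable O Γ := fun hp => h .pr ⟨κ, hp⟩
    simp only [prunable, Finset.mem_filter, not_and, not_forall, not_not] at h1
    obtain ⟨l, -, hl, hlΓ⟩ := h1 hκ
    rcases hl with hl | rfl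
    · obtain ⟨d, hd, -⟩ := hO.exists_child (P := fun _ => True) hl trivial fun _ _ _ _ => trivial
      by_contra! hc
      exact h (.rs κ) ⟨hκ, hκΓ, ⟨d, hd⟩, hc⟩
    · exact absurd hlΓ hκΓ
  choose! f hf hfΓ using hchild
  have h1 : (O.V.filter (· ∈ seqOrdVars Γ)).card ≤ S.card :=
    Finset.card_le_card fun κ hκ => hS κ (Finset.mem_filter.1 hκ).2
  -- Sending a non-occurring variable to an occurring child is injective, because a child has only
  -- one parent.
  have h2 : (O.V.filter (· ∉ seqOrdVars Γ)).card ≤ S.card := by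
    refine Finset.card_le_card_of_injOn f (fun κ hκ => ?_) fun κ hκ κ' hκ' e => ?_
    · have hκ := Finset.mem_filter.1 hκ
      exact hS _ (hfΓ κ hκ.1 hκ.2)
    · have hκ := Finset.mem_filter.1 hκ
      have hκ' := Finset.mem_filter.1 hκ'
      exact hO.eq_of_mem_children (hf κ hκ.1 hκ.2) (e ▸ hf κ' hκ'.1 hκ'.2)
  rw [← Finset.card_filter_add_card_filter_not (s := O.V) (· ∈ seqOrdVars Γ)]
  omega

end IsConstraint

/-- Along a sequence of constraints, follow a variable `κ j` that is infinitely often replaced by a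
child of it, such that the variables above `κ j` are removed only as children of a reset variable.
If only finitely many variables are used, there is a stable variable that is reset infinitely
often. -/
theorem exists_stable_reset {O : ℕ → Constraint} {κ : ℕ → OrdVar} {reset : ℕ → OrdVar → Prop}
    {M : ℕ} (hO : ∀ j, (O j).IsConstraint)
    (hlt : ∀ j a b, a ∈ (O j).V → b ∈ (O j).V → a ∈ (O (j + 1)).V → b ∈ (O (j + 1)).V →
      ((O (j + 1)).lt a b ↔ (O j).lt a b))
    (hnew : ∀ j a b, a ∈ (O j).V → (O (j + 1)).lt a b → b ∈ (O j).V)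
    (hκ : ∀ j, κ j ∈ (O j).V)
    (hstep : ∀ j, κ (j + 1) = κ j ∨ (O (j + 1)).lt (κ (j + 1)) (κ j))
    (hinf : ∀ N, ∃ j, N ≤ j ∧ (O (j + 1)).lt (κ (j + 1)) (κ j))
    (hrem : ∀ j d, (κ j = d ∨ (O j).lt (κ j) d) → d ∉ (O (j + 1)).V →
      ∃ c, reset j c ∧ d ∈ (O j).children c)
    (hM : ∀ j, (O j).V ⊆ Finset.range M) :
    ∃ c, (∃ J, ∀ j, J ≤ j → c ∈ (O j).V) ∧ ∀ N, ∃ j, N ≤ j ∧ reset j c := by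
  classical
  set Chain : ℕ → OrdVar → Prop := fun j d => κ j = d ∨ (O j).lt (κ j) d with hChain
  have hmem : ∀ {j d}, Chain j d → d ∈ (O j).V := by
    rintro j d (rfl | h)
    · exact hκ j
    · exact ((hO j).mem _ _ h).2
  have hup : ∀ {j x y}, Chain j x → (O j).lt x y → Chain j y := by
    rintro j x y (rfl | h) h'
    · exact .inr h'
    · exact .inr ((hO j).trans _ _ _ h h')
  have hκ' : ∀ j, κ j ∈ (O (j + 1)).V := fun j => by
    rcases hstep j with h | h
    · exact h ▸ hκ (j + 1)
    · exact ((hO _).mem _ _ h).2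
  have hpers : ∀ {j d}, Chain j d → d ∈ (O (j + 1)).V → Chain (j + 1) d := by
    intro j d h hd
    have h1 : κ j = d ∨ (O (j + 1)).lt (κ j) d :=
      h.imp_right fun h' => (hlt j _ _ (hκ j) (hmem h) (hκ' j) hd).2 h'
    rcases hstep j with h2 | h2
    · exact h1.imp h2.trans fun h => by rwa [h2]
    · rcases h1 with rfl | h1
      · exact .inr h2
      · exact .inr ((hO _).trans _ _ _ h2 h1)
  obtain ⟨root, -, hroot, hrmax⟩ :=
    (hO 0).exists_maximal (P := Chain 0) (hκ 0) (.inl rfl)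
  -- The top of the initial chain has no parent, so it is never removed as a child; and no variable
  -- is ever inserted above an existing one.
  have hroot' : ∀ j, Chain j root ∧ ∀ x, ¬ (O j).lt root x := by
    intro j
    induction j with
    | zero => exact ⟨hroot, fun x hx => hrmax x hx (hup hroot hx)⟩
    | succ j ih =>
      have hV : root ∈ (O (j + 1)).V := by
        by_contra hV
        obtain ⟨c, -, hc⟩ := hrem j root ih.1 hV
        exact ih.2 c (mem_children.1 hc).2.1
      refine ⟨hpers ih.1 hV, fun x hx => ih.2 x ?_⟩
      exact (hlt j _ _ (hmem ih.1) (hnew j _ _ (hmem ih.1) hx) hV ((hO _).mem _ _ hx).2).1 hx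
  -- `T` collects the variables that eventually stay in the chain. It is finite because all indices
  -- are below `M`, and it contains the root.
  set T : Finset OrdVar := (Finset.range M).filter fun c => ∃ J, ∀ j, J ≤ j → Chain j c with hT
  have hTmem : ∀ c, c ∈ T ↔ ∃ J, ∀ j, J ≤ j → Chain j c := fun c => by
    rw [hT, Finset.mem_filter, and_iff_right_iff_imp]
    rintro ⟨J, hJ⟩
    exact hM J (hmem (hJ J le_rfl))
  obtain ⟨J, hJ⟩ : ∃ J, ∀ c ∈ T, ∀ j, J ≤ j → Chain j c := by
    have : ∀ c, ∃ J, c ∈ T → ∀ j, J ≤ j → Chain j c := fun c => by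
      by_cases hc : c ∈ T
      · exact ((hTmem c).1 hc).imp fun J hJ _ => hJ
      · exact ⟨0, fun h => absurd h hc⟩
    choose f hf using this
    exact ⟨T.sup f, fun c hc j hj => hf c hc j ((Finset.le_sup hc).trans hj)⟩
  -- From `J` on all of `T` is in the chain. The candidate `c` has the fewest members of `T` below
  -- it, which turns out to mean none.
  obtain ⟨c, hc, hmin⟩ := Finset.exists_min_image T
    (fun c => (T.filter fun x => (O J).lt x c).card)
    ⟨root, (hTmem root).2 ⟨0, fun j _ => (hroot' j).1⟩⟩
  -- The order between surviving variables does not change, so `c` remains minimal in `T` at all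
  -- times from `J` on.
  have hleast : ∀ j, J ≤ j → ∀ x ∈ T, ¬ (O j).lt x c := by
    intro j hj
    induction j, hj using Nat.le_induction with
    | base =>
      intro x hx hxc
      refine (hmin x hx).not_gt (Finset.card_lt_card ⟨fun y hy => ?_, fun h => ?_⟩)
      · simp only [Finset.mem_filter] at hy ⊢
        exact ⟨hy.1, (hO J).trans _ _ _ hy.2 hxc⟩
      · exact (hO J).irrefl x (Finset.mem_filter.1 (h (Finset.mem_filter.2 ⟨hx, hxc⟩))).2
    | succ j hj ih =>
      intro x hx hxc
      exact ih x hx ((hlt j _ _ (hmem (hJ x hx j hj)) (hmem (hJ c hc j hj))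
        (hmem (hJ x hx _ (by omega))) (hmem (hJ c hc _ (by omega)))).1 hxc)
  refine ⟨c, ⟨J, fun j hj => hmem (hJ c hc j hj)⟩, fun N => ?_⟩
  by_contra! hN
  -- Assuming no reset of `c` from `N` on, a later descent puts the followed variable strictly below
  -- `c`. Hence `c` has a child `d` in the chain.
  obtain ⟨j, hj, hjlt⟩ := hinf (max N J)
  have hcj := hJ c hc j (by omega)
  have hcj' := hJ c hc (j + 1) (by omega)
  have hlow : (O (j + 1)).lt (κ (j + 1)) c := by
    rcases hcj with h | h
    · exact h ▸ hjlt
    · exact (hO _).trans _ _ _ hjlt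
        ((hlt j _ _ (hκ j) (hmem (.inr h)) (hκ' j) (hmem hcj')).2 h)
  obtain ⟨d, hd, hdC⟩ := (hO (j + 1)).exists_child (P := Chain (j + 1)) hlow (.inl rfl)
    fun _ _ => hup
  -- Removing `d` would be a reset of its unique parent `c`. No variable is inserted between `d` and
  -- `c`, so `d` stays a child of `c` in the chain and belongs to `T` below `c`.
  have hd' : ∀ i, j + 1 ≤ i → Chain i d ∧ d ∈ (O i).children c := by
    intro i hi
    induction i, hi using Nat.le_induction with
    | base => exact ⟨hdC, hd⟩
    | succ i hi ih =>
      have hV : d ∈ (O (i + 1)).V := by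
        by_contra hV
        obtain ⟨c', hc', hdc'⟩ := hrem i d ih.1 hV
        obtain rfl := (hO i).eq_of_mem_children hdc' ih.2
        exact hN i (by omega) hc'
      have hci := hmem (hJ c hc i (by omega))
      have hci' := hmem (hJ c hc (i + 1) (by omega))
      have hdi := hmem ih.1
      have hch := mem_children.1 ih.2
      refine ⟨hpers ih.1 hV, mem_children.2 ⟨hV, (hlt i _ _ hdi hci hV hci').2 hch.2.1,
        fun ξ h1 h2 h3 => ?_⟩⟩
      have hξ := hnew i _ _ hdi h1
      exact hch.2.2 ξ ((hlt i _ _ hdi hξ hV h3).1 h1) ((hlt i _ _ hξ hci h3 hci').1 h2) hξ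
  exact hleast (j + 1) (by omega) d ((hTmem d).2 ⟨j + 1, fun i hi => (hd' i hi).1⟩)
    (mem_children.1 hd).2.1

end Constraint

/-! ### Size and evolution of the constraints in the translation -/

namespace State

variable {D : Coderivation plainSystem} {σ : ReductionStrategy}

/-- The number of variables in the constraint is bounded. -/
def Bounded (N : ℕ) (s : State) : Prop :=
  s.O.V.card ≤ 2 * N + (if s.pending then 2 else 1) ∧ s.O.V ⊆ Finset.range (2 * N + 2)

/-- Occurring variables are entries of the assignments, whose total length is the number of
occurrences of `ν` in the sequent, at most `N`. -/
theorem WF.card_le_of_not_applicable {s : State} {r : Rule} (h : s.WF D r) {N : ℕ}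
    (hN : ∀ Γ ∈ D.sequents, (Γ.map Fml.nuCount).sum ≤ N)
    (hn : ∀ ρ : Reduction, ¬ ρ.Applicable s.O (annotateList r.concl s.ℓ)) :
    s.O.V.card ≤ 2 * N := by
  refine (h.ext.1.card_le_of_not_applicable (S := (s.ℓ.flatten.filterMap id).toFinset)
    (fun κ hκ => ?_) hn).trans ?_
  · obtain ⟨a, ha, hκ⟩ := mem_of_mem_seqOrdVars hκ
    simp only [List.mem_toFinset, List.mem_filterMap, List.mem_flatten]
    exact ⟨_, ⟨a, ha, hκ⟩, rfl⟩
  · refine Nat.mul_le_mul_left 2 (((List.toFinset_card_le _).trans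
      (List.length_filterMap_le _ _)).trans ?_)
    rw [List.length_flatten, h.matches_]
    exact hN _ ⟨_, _, h.label, rfl⟩

/-- When no reduction applies there are at most `2 * N` variables. The `ν` step and the following
`ν^κ` step add one each, which explains the summands `1` and `2` in `Bounded`; the new index is at
most `2 * N + 1`. -/
theorem Trans.bounded {s s' : State} {r : Rule} {ar : ARule} {ss : List State} (h : s.WF D r)
    (ht : s.Trans D σ r ar ss) (hs' : s' ∈ ss) {N : ℕ}
    (hN : ∀ Γ ∈ D.sequents, (Γ.map Fml.nuCount).sum ≤ N) (hb : s.Bounded N) :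
    s'.Bounded N := by
  have hins : ∀ {V : Finset OrdVar} {k : ℕ}, V = insert s.O.fresh s.O.V → s.O.V.card ≤ k →
      k ≤ 2 * N + 1 → V.card ≤ k + 1 ∧ V ⊆ Finset.range (2 * N + 2) := by
    rintro V k rfl h1 h2
    refine ⟨(Finset.card_insert_le _ _).trans (by omega), Finset.insert_subset ?_ hb.2⟩
    exact Finset.mem_range.2 (lt_of_le_of_lt (s.O.fresh_le_card.trans (h1.trans h2)) (by omega))
  cases ht with
  | red r ρ hr hp hρ =>
    obtain rfl := List.mem_singleton.1 hs'
    exact ⟨(Finset.card_le_card Finset.sdiff_subset).trans hb.1,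
      Finset.sdiff_subset.trans hb.2⟩
  | base b hp hn =>
    obtain ⟨i, hi, rfl⟩ := List.mem_mapIdx.1 hs'
    have h1 := hb.1
    rw [hp] at h1
    exact ⟨h1, hb.2⟩
  | nu Γ t φ ℓ₁ ℓ₀ hℓ hΓ hp hφ hn =>
    obtain rfl := List.mem_singleton.1 hs'
    exact hins rfl (h.card_le_of_not_applicable hN hn) (by omega)
  | nuK Γ t φ κ ℓ₁ ℓ₀ hℓ hΓ hφ hn =>
    obtain rfl := List.mem_singleton.1 hs'
    refine hins rfl ?_ le_rfl
    by_cases hp : s.pending = true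
    · exact (h.card_le_of_not_applicable hN (hn hp)).trans (by omega)
    · have h1 := hb.1
      rwa [if_neg hp] at h1

/-- How a step of the translation changes the constraint. -/
theorem Trans.constraint {s s' : State} {r : Rule} {ar : ARule} {ss : List State} (h : s.WF D r)
    (ht : s.Trans D σ r ar ss) (hs' : s' ∈ ss) :
    (∀ a b, a ∈ s.O.V → b ∈ s.O.V → a ∈ s'.O.V → b ∈ s'.O.V → (s'.O.lt a b ↔ s.O.lt a b)) ∧
    (∀ a b, a ∈ s.O.V → s'.O.lt a b → b ∈ s.O.V) ∧
    (∀ d ∈ s.O.V, d ∉ s'.O.V → ∃ ρ, ar = .red s.O (annotateList r.concl s.ℓ) ρ ∧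
      d ∈ ρ.removed s.O (annotateList r.concl s.ℓ)) := by
  have hO := h.ext.1
  cases ht with
  | red r ρ hr hp hρ =>
    obtain rfl := List.mem_singleton.1 hs'
    refine ⟨fun a b _ _ ha hb => ⟨fun h => h.1, fun h => ⟨h, ha, hb⟩⟩,
      fun a b _ h => (hO.mem _ _ h.1).2, fun d hd hd' => ⟨ρ, rfl, ?_⟩⟩
    by_contra hd''
    exact hd' (Finset.mem_sdiff.2 ⟨hd, hd''⟩)
  | base b hp hn =>
    obtain ⟨i, hi, rfl⟩ := List.mem_mapIdx.1 hs'
    exact ⟨fun a b _ _ _ _ => Iff.rfl, fun a b _ h => (hO.mem _ _ h).2,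
      fun d hd hd' => absurd hd hd'⟩
  | nu Γ t φ ℓ₁ ℓ₀ hℓ hΓ hp hφ hn =>
    obtain rfl := List.mem_singleton.1 hs'
    exact ⟨fun a b _ _ _ _ => Iff.rfl, fun a b _ h => (hO.mem _ _ h).2,
      fun d hd hd' => absurd (Finset.mem_insert_of_mem hd) hd'⟩
  | nuK Γ t φ κ ℓ₁ ℓ₀ hℓ hΓ hφ hn =>
    obtain rfl := List.mem_singleton.1 hs'
    have hne : ∀ a b, a ∈ s.O.V → (s.O.addChild κ s.O.fresh).lt a b → s.O.lt a b := by
      rintro a b ha (h | ⟨rfl, -⟩)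
      · exact h
      · exact absurd ha s.O.fresh_notMem
    exact ⟨fun a b ha _ _ _ => ⟨hne a b ha, Or.inl⟩, fun a b ha h => (hO.mem _ _ (hne a b ha h)).2,
      fun d hd hd' => absurd (Finset.mem_insert_of_mem hd) hd'⟩

end State

/-! ### Traces through annotated formulas -/

/-- In passing from `A` to `A'` no annotation is introduced and marked formulas remain marked. -/
def Tame (A A' : AFormula) : Prop :=
  A'.ordVars ⊆ A.ordVars ∧ ∀ κ n, A.Marked κ n → A'.Marked κ n

namespace Tame

theorem refl (A : AFormula) : Tame A A := ⟨le_rfl, fun _ _ => id⟩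

theorem subst {n : ℕ} (σ σ' : Fin n → Term) (θ θ' : ℕ → Term) (φ : Fml OrdVar n 0) :
    Tame (φ.subst σ θ) (φ.subst σ' θ') :=
  ⟨by rw [Fml.ordVars_subst, Fml.ordVars_subst], fun κ n h => by
    rwa [Fml.marked_subst] at h ⊢⟩

theorem substFree (θ : ℕ → Term) (φ : AFormula) : Tame (φ.substFree θ) φ :=
  ⟨by rw [Fml.ordVars_substFree], fun κ n h => by rwa [Fml.substFree, Fml.marked_subst] at h⟩

theorem inst {A : AFormula} {φ : Fml OrdVar 1 0} (t : Term) (h : A = .all φ ∨ A = .ex φ) :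
    Tame A (φ.inst t) := by
  refine ⟨?_, fun κ n hA => ?_⟩
  · rw [Fml.ordVars_inst]
    rcases h with rfl | rfl <;> exact le_rfl
  · rw [Fml.inst, Fml.marked_subst]
    rcases h with rfl | rfl <;> exact hA

theorem left {A φ ψ : AFormula} (h : A = .and φ ψ ∨ A = .or φ ψ) : Tame A φ := by
  rcases h with rfl | rfl <;> exact ⟨Set.subset_union_left, fun κ n h => h.1⟩

theorem right {A φ ψ : AFormula} (h : A = .and φ ψ ∨ A = .or φ ψ) : Tame A ψ := by
  rcases h with rfl | rfl <;> exact ⟨Set.subset_union_right, fun κ n h => h.2⟩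

end Tame

namespace Rule

theorem Anc.lt_length {r : Rule} {p q : ℕ} (h : r.Anc p q) : p < r.concl.length := by
  rcases r with b | ⟨Γ, t, φ⟩
  · cases b <;> simp [Anc, concl, BaseRule.concl] at h ⊢ <;> omega
  · simp [Anc, concl] at h ⊢
    omega

theorem Unfolds.unique {r : Rule} {p : ℕ} {S S' : STm Empty 0 0} (h : r.Unfolds p S)
    (h' : r.Unfolds p S') : S = S' := by
  rcases r with b | ⟨Γ, t, φ⟩
  · cases b with
    | mu Γ t φ => exact h.2.trans h'.2.symm
    | _ => exact h.elim
  · exact h.2.trans h'.2.symm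

theorem Unfolds.exists_mem {r : Rule} {p : ℕ} {S : STm Empty 0 0} (h : r.Unfolds p S) :
    ∃ t, S.toFml t ∈ r.concl := by
  rcases r with b | ⟨Γ, t, φ⟩
  · cases b with
    | mu Γ t φ =>
      obtain ⟨-, rfl⟩ := h
      exact ⟨t, by simp [concl, BaseRule.concl, STm.toFml]⟩
    | _ => exact h.elim
  · obtain ⟨-, rfl⟩ := h
    exact ⟨t, by simp [concl, STm.toFml]⟩

end Rule

/-- A step of a trace in a common rule, seen in the annotated instance of the rule. -/
theorem BaseRule.exists_traceStep {b : BaseRule Empty} {ℓ : List OrdAssign}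
    (h : Matches b.concl ℓ) {p q : ℕ} (hanc : (Rule.base b).Anc p q) {Δ : ASequent}
    (hΔ : Δ ∈ (b.annotate ℓ).prems) :
    ∃ A A', (b.annotate ℓ).concl[p]? = some A ∧ Δ[q]? = some A' ∧
      ((Tame A A' ∧ ∀ S, ¬ (Rule.base b).Unfolds p S) ∨
        ∃ t φ ψ, (Rule.base b).Unfolds p (.mu none ψ) ∧ φ.size = ψ.size ∧
          A = .mu none t φ ∧ A' = φ.plug (.mu none φ) t) := by
  have side : ∀ {G : ASequent} {L L' : ASequent} {p : ℕ}, p < G.length →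
      ∃ A A', (G ++ L)[p]? = some A ∧ (G ++ L')[p]? = some A' ∧ Tame A A' := by
    intro G L L' p hp
    have e : ∀ L : ASequent, (G ++ L)[p]? = some G[p] := fun L =>
      (List.getElem?_append_left hp).trans (List.getElem?_eq_getElem hp)
    exact ⟨G[p], G[p], e L, e L', .refl _⟩
  -- The same for positions up to and including the principal formula, which sits directly after the
  -- context.
  have main : ∀ {G : ASequent} {A A' : AFormula} {L : ASequent} {p : ℕ}, p ≤ G.length →
      Tame A A' → ∃ B B', (G ++ [A])[p]? = some B ∧ (G ++ A' :: L)[p]? = some B' ∧ Tame B B' := by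
    intro G A A' L p hp hA
    rcases hp.lt_or_eq with hp | rfl
    · exact side hp
    · exact ⟨A, A', by simp, by simp, hA⟩
  cases b with
  | id Γ φ | refl t | pa i x y | nat t => exact hanc.elim
  | wk Γ Λ =>
    obtain ⟨ℓ₁, ℓ₂, rfl, h₁, -, -⟩ := h.exists_append
    obtain ⟨rfl, hp⟩ := hanc
    obtain rfl := List.mem_singleton.1 hΔ
    obtain ⟨A, A', h2, h3, h4⟩ := side (G := annotateList Γ ℓ₁) (L := annotateList Λ ℓ₂) (L' := [])
      (by rwa [length_annotateList h₁, ← h₁])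
    exact ⟨A, A', by simpa [annotate, concl, h₁] using h2, by simpa [h₁] using h3,
      .inl ⟨h4, fun S hS => hS⟩⟩
  | exch Γ φ ψ Λ =>
    obtain ⟨ℓ₁, ℓ₂, rfl, h₁, -, h₂⟩ := h.exists_append
    obtain ⟨a, ℓ₂, rfl, ha, h₂⟩ := h₂.exists_cons
    obtain ⟨c, ℓ₂, rfl, hc, h₂⟩ := h₂.exists_cons
    have hG := (length_annotateList (Γ := Γ) h₁).trans h₁.symm
    have hL := length_annotateList h₂.length_eq.symm
    simp only [annotate, prems, concl, List.mem_singleton] at hΔ ⊢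
    have e1 : (ℓ₁ ++ a :: c :: ℓ₂).take Γ.length = ℓ₁ := by simp [h₁]
    have e2 : (ℓ₁ ++ a :: c :: ℓ₂).getD Γ.length [] = a := by simp [h₁]
    have e3 : (ℓ₁ ++ a :: c :: ℓ₂).getD (Γ.length + 1) [] = c := by simp [h₁]
    have e4 : (ℓ₁ ++ a :: c :: ℓ₂).drop (Γ.length + 2) = ℓ₂ := by simp [h₁]
    rw [e1, e2, e3, e4] at hΔ ⊢
    subst hΔ
    rcases hanc with ⟨rfl, rfl⟩ | ⟨rfl, rfl⟩ | ⟨rfl, hp | ⟨hp, hp'⟩⟩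
    · exact ⟨φ.annotate a, φ.annotate a, by simp [← hG], by simp [← hG],
        .inl ⟨.refl _, fun S hS => hS⟩⟩
    · exact ⟨ψ.annotate c, ψ.annotate c, by simp [← hG], by simp [← hG],
        .inl ⟨.refl _, fun S hS => hS⟩⟩
    · obtain ⟨A, A', h2, h3, h4⟩ := side (G := annotateList Γ ℓ₁)
        (L := φ.annotate a :: ψ.annotate c :: annotateList Λ ℓ₂)
        (L' := ψ.annotate c :: φ.annotate a :: annotateList Λ ℓ₂) (hG ▸ hp)
      exact ⟨A, A', h2, h3, .inl ⟨h4, fun S hS => hS⟩⟩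
    · obtain ⟨k, rfl⟩ := Nat.exists_eq_add_of_le hp
      have hk : k < (annotateList Λ ℓ₂).length := by rw [hL, h₂.length_eq]; omega
      have e5 : ∀ x y : AFormula, (annotateList Γ ℓ₁ ++ x :: y :: annotateList Λ ℓ₂)[
          Γ.length + 2 + k]? = some (annotateList Λ ℓ₂)[k] := by
        intro x y
        rw [List.getElem?_append_right (by omega), hG,
          show Γ.length + 2 + k - Γ.length = k + 2 by omega]
        simp [hk]
      exact ⟨_, _, e5 _ _, e5 _ _, .inl ⟨.refl _, fun S hS => hS⟩⟩
  | sub θ Γ =>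
    obtain ⟨rfl, hp⟩ := hanc
    obtain rfl := List.mem_singleton.1 hΔ
    have hM := (Matches.map_of_nuCount (Fml.nuCount_substFree θ)).1 h
    have hG : (annotateList Γ ℓ).length = ℓ.length :=
      length_annotateList (by simpa using (congrArg List.length hM).symm)
    have hp' : p < (annotateList Γ ℓ).length := by
      rw [hG, show ℓ.length = Γ.length by simpa using congrArg List.length hM]
      exact hp
    exact ⟨_, _, by simp [annotate, concl, hp'], by simp [hp'],
      .inl ⟨.substFree θ (annotateList Γ ℓ)[p], fun S hS => hS⟩⟩
  | cut Γ φ =>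
    obtain ⟨rfl, hp⟩ := hanc
    have hp' : p < (annotateList Γ ℓ).length := by
      rw [length_annotateList (Γ := Γ) h.length_eq.symm]
      exact hp.trans_eq h.length_eq.symm
    -- Which premise of the cut is taken does not matter: traces never enter the cut formula.
    have : ∃ x, Δ = annotateList Γ ℓ ++ [x] := by
      rcases List.mem_pair.1 hΔ with rfl | rfl <;> exact ⟨_, rfl⟩
    obtain ⟨x, rfl⟩ := this
    obtain ⟨A, A', h2, h3, h4⟩ := side (L := []) (L' := [x]) hp'
    exact ⟨A, A', by simpa [annotate, concl] using h2, h3, .inl ⟨h4, fun S hS => hS⟩⟩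
  | and Γ φ ψ =>
    obtain ⟨ℓ₁, a, rfl, h₁, -, -⟩ := h.exists_concat
    have hG := (length_annotateList (Γ := Γ) h₁).trans h₁.symm
    obtain ⟨rfl, hp⟩ := hanc
    have e1 : (ℓ₁ ++ [a]).take Γ.length = ℓ₁ := by simp [h₁]
    simp only [annotate, prems, concl, e1, List.mem_pair] at hΔ ⊢
    rcases hΔ with rfl | rfl
    · obtain ⟨A, A', h2, h3, h4⟩ := main (L := []) (hG.symm ▸ hp) (.left (.inl rfl))
      exact ⟨A, A', h2, h3, .inl ⟨h4, fun S hS => hS⟩⟩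
    · obtain ⟨A, A', h2, h3, h4⟩ := main (L := []) (hG.symm ▸ hp) (.right (.inl rfl))
      exact ⟨A, A', h2, h3, .inl ⟨h4, fun S hS => hS⟩⟩
  | or Γ φ ψ =>
    obtain ⟨ℓ₁, a, rfl, h₁, -, -⟩ := h.exists_concat
    have hG := (length_annotateList (Γ := Γ) h₁).trans h₁.symm
    have e1 : (ℓ₁ ++ [a]).take Γ.length = ℓ₁ := by simp [h₁]
    simp only [annotate, prems, concl, e1, List.mem_singleton] at hΔ ⊢
    subst hΔ
    rcases hanc with ⟨rfl, hp⟩ | ⟨rfl, rfl⟩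
    · obtain ⟨A, A', h2, h3, h4⟩ := main (hG.symm ▸ hp) (.left (.inr rfl))
      exact ⟨A, A', h2, h3, .inl ⟨h4, fun S hS => hS⟩⟩
    · exact ⟨_, _, by rw [← hG, List.getElem?_concat_length],
        by rw [← hG, List.getElem?_append_right (by omega), Nat.add_sub_cancel_left]; rfl,
        .inl ⟨.right (.inr rfl), fun S hS => hS⟩⟩
  | all Γ φ y =>
    obtain ⟨ℓ₁, a, rfl, h₁, -, -⟩ := h.exists_concat
    have hG := (length_annotateList (Γ := Γ) h₁).trans h₁.symm
    obtain ⟨rfl, hp⟩ := hanc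
    have e1 : (ℓ₁ ++ [a]).take Γ.length = ℓ₁ := by simp [h₁]
    simp only [annotate, prems, concl, e1, List.mem_singleton] at hΔ ⊢
    subst hΔ
    obtain ⟨A, A', h2, h3, h4⟩ := main (L := []) (hG.symm ▸ hp) (.inst _ (.inl rfl))
    exact ⟨A, A', h2, h3, .inl ⟨h4, fun S hS => hS⟩⟩
  | ex Γ φ y =>
    obtain ⟨ℓ₁, a, rfl, h₁, -, -⟩ := h.exists_concat
    have hG := (length_annotateList (Γ := Γ) h₁).trans h₁.symm
    obtain ⟨rfl, hp⟩ := hanc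
    have e1 : (ℓ₁ ++ [a]).take Γ.length = ℓ₁ := by simp [h₁]
    simp only [annotate, prems, concl, e1, List.mem_singleton] at hΔ ⊢
    subst hΔ
    obtain ⟨A, A', h2, h3, h4⟩ := main (L := []) (hG.symm ▸ hp) (.inst _ (.inr rfl))
    exact ⟨A, A', h2, h3, .inl ⟨h4, fun S hS => hS⟩⟩
  | eqSub Γ s t =>
    obtain ⟨ℓ₁, a, rfl, h₁, -, -⟩ := h.exists_concat
    rw [List.length_map] at h₁
    have hG := (length_annotateList (Γ := Γ) h₁).trans h₁.symm
    obtain ⟨rfl, hp⟩ := hanc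
    have e1 : (ℓ₁ ++ [a]).take Γ.length = ℓ₁ := by simp [h₁]
    simp only [annotate, prems, concl, e1, List.mem_singleton] at hΔ ⊢
    subst hΔ
    have hp' : p < (annotateList Γ ℓ₁).length := hG.symm ▸ hp
    have e : ∀ u, ((annotateList Γ ℓ₁).map (Fml.inst u))[p]? =
        some ((annotateList Γ ℓ₁)[p].inst u) := fun u => by
      rw [List.getElem?_map, List.getElem?_eq_getElem hp', Option.map_some]
    exact ⟨(annotateList Γ ℓ₁)[p].inst t, (annotateList Γ ℓ₁)[p].inst s,
      by rw [List.getElem?_append_left (by rwa [List.length_map]), e], e s, .inl ⟨.subst _ _ _ _ _, fun S hS => hS⟩⟩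
  | mu Γ t φ =>
    obtain ⟨ℓ₁, a, rfl, h₁, -, -⟩ := h.exists_concat
    have hG := (length_annotateList (Γ := Γ) h₁).trans h₁.symm
    obtain ⟨rfl, hp⟩ := hanc
    have e1 : (ℓ₁ ++ [a]).take Γ.length = ℓ₁ := by simp [h₁]
    simp only [annotate, prems, concl, e1, List.mem_singleton] at hΔ ⊢
    subst hΔ
    rcases hp.lt_or_eq with hp | rfl
    · obtain ⟨A, A', h2, h3, h4⟩ := side (hG.symm ▸ hp)
      exact ⟨A, A', h2, h3, .inl ⟨h4, fun S hS => hp.ne hS.1⟩⟩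
    · exact ⟨_, _, by rw [← hG, List.getElem?_concat_length],
        by rw [← hG, List.getElem?_concat_length],
        .inr ⟨t, _, φ, ⟨rfl, rfl⟩, Fml.size_annotate _ _, rfl, rfl⟩⟩

namespace State

variable {D : Coderivation plainSystem} {σ : ReductionStrategy}

/-- The ways in which the traced formula `A` at position `p` of the rule `r` changes in a step of the
translation from `s` to `s'`. -/
inductive TraceStep (s s' : State) (r : Rule) (p : ℕ) (A A' : AFormula) : Prop
  | tame (h : Tame A A') (hu : s'.node ≠ s.node → ∀ S, ¬ r.Unfolds p S)
  | mu (t : Term) (φ : Fml OrdVar 1 1) (ψ : Fml Empty 1 1) (hu : r.Unfolds p (.mu none ψ))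
      (hs : φ.size = ψ.size) (hA : A = .mu none t φ) (hA' : A' = φ.plug (.mu none φ) t)
  | nu (t : Term) (φ : Fml OrdVar 1 1) (ψ : Fml Empty 1 1) (hu : r.Unfolds p (.nu none ψ))
      (hs : φ.size = ψ.size) (hA : A = .nu none t φ) (hA' : A' = .nu (some s.O.fresh) t φ)
      (hnode : s'.node = s.node)
  | nuK (κ : OrdVar) (t : Term) (φ : Fml OrdVar 1 1) (ψ : Fml Empty 1 1)
      (hu : r.Unfolds p (.nu none ψ)) (hs : φ.size = ψ.size) (hA : A = .nu (some κ) t φ)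
      (hA' : A' = φ.plug (.nu (some s.O.fresh) φ) t) (hO : s'.O = s.O.addChild κ s.O.fresh)

/-- One rule of the proof may become several steps of the translation. Reductions and the `ν` step
stay at the node and leave the traced position alone; ancestry is used only when the node changes.
-/
theorem Trans.exists_traceStep (hid : D.HasAtomicIdentities) {s s' : State} {r r' : Rule}
    {ar : ARule} {ss : List State} (h : s.WF D r) (ht : s.Trans D σ r ar ss) (hs' : s' ∈ ss)
    (h' : s'.WF D r') {p q₀ q : ℕ} (hanc : r.Anc p q₀) (hq : s'.node = s.node → q = p)
    (hq' : s'.node ≠ s.node → q = q₀) :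
    ∃ A A', (annotateList r.concl s.ℓ)[p]? = some A ∧
      (annotateList r'.concl s'.ℓ)[q]? = some A' ∧ TraceStep s s' r p A A' := by
  obtain ⟨r'', h'', hmem⟩ := (ht.prems_eq hid h).1 s' hs'
  obtain rfl : r'' = r' := Option.some_injective _ (h''.label.symm.trans h'.label)
  have hc := ht.concl_eq hid h
  cases ht with
  | red r ρ hr hp hρ =>
    obtain rfl := List.mem_singleton.1 hs'
    obtain rfl := hq rfl
    obtain rfl : r'' = r := Option.some_injective _ (h''.label.symm.trans h.label)
    have hlen : q < (annotateList r''.concl s.ℓ).length := by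
      rw [length_annotateList h.matches_.length_eq.symm, h.matches_.length_eq]
      exact hanc.lt_length
    exact ⟨_, _, List.getElem?_eq_getElem hlen, List.getElem?_eq_getElem hlen,
      .tame (.refl _) fun hne => absurd rfl hne⟩
  | base b hp hn =>
    have hne : s'.node ≠ s.node := by
      obtain ⟨i, hi, rfl⟩ := List.mem_mapIdx.1 hs'
      simp
    obtain rfl := hq' hne
    simp only [ARule.prems, List.mem_map, Prod.mk.injEq] at hmem
    obtain ⟨Δ, hΔ, -, e⟩ := hmem
    obtain ⟨A, A', h1, h2, h3⟩ := BaseRule.exists_traceStep h.matches_ hanc hΔ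
    refine ⟨A, A', by rwa [← show (b.annotate s.ℓ).concl = annotateList (Rule.base b).concl s.ℓ from
      (Prod.ext_iff.1 hc).2], e ▸ h2, ?_⟩
    rcases h3 with ⟨h3, h4⟩ | ⟨t, φ, ψ, h3, h4, h5, h6⟩
    · exact .tame h3 fun _ => h4
    · exact .mu t φ ψ h3 h4 h5 h6
  | nu Γ t φ ℓ₁ ℓ₀ hℓ hΓ hp hφ hn =>
    obtain rfl := List.mem_singleton.1 hs'
    obtain rfl := hq rfl
    have hG := (length_annotateList hΓ.length_eq.symm).trans hΓ.length_eq
    simp only [ARule.prems, List.mem_singleton, Prod.mk.injEq, true_and] at hmem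
    have hc : annotateList Γ ℓ₁ ++ _ = annotateList (Rule.nu Γ t φ).concl s.ℓ :=
      (Prod.ext_iff.1 hc).2
    rw [← hc, hmem]
    rcases hanc.2.lt_or_eq with hlt | rfl
    · have hlt' : q < (annotateList Γ ℓ₁).length := hG.symm ▸ hlt
      exact ⟨_, _, by rw [List.getElem?_append_left hlt', List.getElem?_eq_getElem hlt'],
        by rw [List.getElem?_append_left hlt', List.getElem?_eq_getElem hlt'],
        .tame (.refl _) fun hne => absurd rfl hne⟩
    · exact ⟨_, _, by rw [← hG, List.getElem?_concat_length],
        by rw [← hG, List.getElem?_concat_length],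
        .nu t _ φ ⟨rfl, rfl⟩ (Fml.size_annotate _ _) rfl rfl rfl⟩
  | nuK Γ t φ κ ℓ₁ ℓ₀ hℓ hΓ hφ hn =>
    obtain rfl := List.mem_singleton.1 hs'
    obtain rfl := hq' (by simp)
    obtain rfl := hanc.1
    have hG := (length_annotateList hΓ.length_eq.symm).trans hΓ.length_eq
    simp only [ARule.prems, List.mem_singleton, Prod.mk.injEq, true_and] at hmem
    have hc : annotateList Γ ℓ₁ ++ _ = annotateList (Rule.nu Γ t φ).concl s.ℓ :=
      (Prod.ext_iff.1 hc).2
    rw [← hc, hmem]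
    rcases hanc.2.lt_or_eq with hlt | rfl
    · have hlt' : p < (annotateList Γ ℓ₁).length := hG.symm ▸ hlt
      exact ⟨_, _, by rw [List.getElem?_append_left hlt', List.getElem?_eq_getElem hlt'],
        by rw [List.getElem?_append_left hlt', List.getElem?_eq_getElem hlt'],
        .tame (.refl _) fun _ S hS => hlt.ne hS.1⟩
    · exact ⟨_, _, by rw [← hG, List.getElem?_concat_length],
        by rw [← hG, List.getElem?_concat_length],
        .nuK κ t _ φ ⟨rfl, rfl⟩ (Fml.size_annotate _ _) rfl rfl rfl⟩

/-- A marked formula in which the mark does not occur cannot be one of the fixed points of size at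
least `n`. So the traced formula is not unfolded, and a tame step cannot bring the mark back. -/
theorem TraceStep.of_notMem_ordVars {s s' : State} {r : Rule} {p n : ℕ} {A A' : AFormula}
    (h : TraceStep s s' r p A A') (hn : ∀ S, r.Unfolds p S → n ≤ S.size) {κ : OrdVar}
    (hA : A.Marked κ n) (hκ : κ ∉ A.ordVars) :
    (A'.Marked κ n ∧ κ ∉ A'.ordVars) ∧ (s'.node ≠ s.node → ∀ S, ¬ r.Unfolds p S) := by
  cases h with
  | tame h hu => exact ⟨⟨h.2 _ _ hA, fun h' => hκ (h.1 h')⟩, hu⟩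
  | mu t φ ψ hu hs e e' =>
    subst e
    have h1 := hn _ hu
    simp only [Fml.ordVars, Set.mem_union, not_or] at hκ
    have h2 := hA.2.1.resolve_left hκ.2
    simp only [STm.size] at h1
    omega
  | nu t φ ψ hu hs e e' _ | nuK _ t φ ψ hu hs e e' _ =>
    subst e
    have h1 := hn _ hu
    simp only [Fml.ordVars, Set.mem_union, not_or] at hκ
    simp only [Fml.Marked] at hA
    rw [if_neg (show ¬ _ = some κ from hκ.1)] at hA
    have h2 := hA.1.resolve_left hκ.2
    simp only [STm.size] at h1
    omega

/-- Unfolding `ν^κ` hands the mark to the fresh child of `κ`; any other unfolded term has `κ` in its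
body, and the mark survives. The last clause demands a change of node because the preliminary `ν`
step only annotates. -/
theorem TraceStep.marked {s s' : State} {r : Rule} {p n : ℕ} {A A' : AFormula}
    (h : TraceStep s s' r p A A') (hO : ∀ κ ∈ A.ordVars, κ ∈ s.O.V) {κ : OrdVar}
    (hA : A.Marked κ n) (hκ : κ ∈ A.ordVars) :
    ∃ κ', A'.Marked κ' n ∧
      (κ' = κ ∨ (s'.O = s.O.addChild κ s.O.fresh ∧ κ' = s.O.fresh)) ∧
      ((s'.node ≠ s.node ∧ ∃ φ, r.Unfolds p (.nu none φ) ∧ φ.size + 3 = n) →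
        s'.O = s.O.addChild κ s.O.fresh ∧ κ' = s.O.fresh) := by
  have hfresh : s.O.fresh ≠ κ := fun e => s.O.fresh_notMem (e ▸ hO κ hκ)
  cases h with
  | tame h hu => exact ⟨κ, h.2 _ _ hA, .inl rfl, fun ⟨h1, φ, h2, _⟩ => (hu h1 _ h2).elim⟩
  | mu t φ ψ hu hs e e' =>
    subst e e'
    refine ⟨κ, ?_, .inl rfl, fun ⟨_, φ', h2, _⟩ => by cases hu.unique h2⟩
    have h1 := hκ.resolve_left hA.1
    exact Fml.marked_plug t hA.2.2 (.inr h1) fun _ => ⟨by simp, .inl h1, hA.2.2⟩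
  | nu t φ ψ hu hs e e' hnode =>
    subst e e'
    simp only [Fml.Marked, reduceCtorEq, if_false] at hA
    refine ⟨κ, ?_, .inl rfl, fun ⟨h1, _⟩ => absurd hnode h1⟩
    have h1 : ¬ some s.O.fresh = some κ := by simpa using hfresh
    simp only [Fml.Marked, if_neg h1]
    exact hA
  | nuK κ₀ t φ ψ hu hs e e' h0 =>
    subst e e'
    by_cases hκ₀ : κ₀ = κ
    · subst hκ₀
      simp only [Fml.Marked, if_true] at hA
      refine ⟨s.O.fresh, ?_, .inr ⟨h0, rfl⟩, fun _ => ⟨h0, rfl⟩⟩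
      rw [← hA.1]
      exact Fml.marked_plug_of_fresh t fun h => s.O.fresh_notMem (hO _ (.inr h))
    · have h1 : ¬ some κ₀ = some κ := by simpa using hκ₀
      have h2 : ¬ some s.O.fresh = some κ := by simpa using hfresh
      have h3 : κ ∈ φ.ordVars := hκ.resolve_left h1
      simp only [Fml.Marked, if_neg h1] at hA
      refine ⟨κ, ?_, .inl rfl, ?_⟩
      · refine Fml.marked_plug t hA.2 (.inr h3) fun _ => ?_
        simp only [STm.toFml, Fml.Marked, if_neg h2]
        exact ⟨.inl h3, hA.2⟩
      -- The unfolded term has `κ` in its body, so it is larger than `n` and cannot be the minimal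
      -- one.
      · rintro ⟨-, φ', hu', hφ'⟩
        have e := hu.unique hu'
        simp only [STm.nu.injEq, true_and] at e
        have := hA.2.le_size h3
        rw [← e] at hφ'
        omega

end State

/-! ### Infinite branches of the translation -/

/-- The calls along an infinite branch of the translation, with the rules of the coderivation, the
rules of the translation and the lists of recursive calls. -/
structure Run (D : Coderivation plainSystem) (σ : ReductionStrategy) where
  s : ℕ → State
  r : ℕ → Rule
  ar : ℕ → ARule
  ss : ℕ → List State
  wf : ∀ j, (s j).WF D (r j)
  trans : ∀ j, (s j).Trans D σ (r j) (ar j) (ss j)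
  mem : ∀ j, s (j + 1) ∈ ss j
  node_zero : (s 0).node = []
  O_zero : (s 0).O = .empty

/-- Every infinite branch of the translation gives a run. -/
theorem IsInfiniteBranch.exists_run {D : Coderivation plainSystem} {σ : ReductionStrategy}
    (hid : D.HasAtomicIdentities) {ℓ : List OrdAssign} {r₀ : Rule}
    (h₀ : (⟨[], .empty, ℓ, true⟩ : State).WF D r₀) {β : ℕ → List Bool}
    (hβ : IsInfiniteBranch (D.translate σ .empty ℓ) β) :
    ∃ R : Run D σ, ∀ j, D.translate σ .empty ℓ (β j) = some (R.ar j) := by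
  choose ar har using fun j => Option.ne_none_iff_exists'.1 (hβ.mem j)
  choose s r ss hs hr hstep ht using fun j =>
    (Coderivation.translate_eq_some_iff hid h₀).1 (har j)
  have h0 := hs 0
  rw [hβ.zero] at h0
  obtain h0 : _ = s 0 := Option.some_injective _ h0
  refine ⟨⟨s, r, ar, ss, hr, ht, fun j => ?_, by rw [← h0], by rw [← h0]⟩, har⟩
  obtain ⟨b, hb⟩ := hβ.succ j
  have h1 := hs (j + 1)
  rw [hb, State.at_append, hs j, Option.bind_some, hstep j] at h1
  exact List.mem_of_getElem? h1

/-- The steps that stay at a node are reductions, which shrink the constraint, and the `ν` step,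
which clears `pending`. This is the measure behind `Run.exists_advance`. -/
theorem State.Trans.node {D : Coderivation plainSystem} {σ : ReductionStrategy} {s s' : State}
    {r : Rule} {ar : ARule} {ss : List State} (ht : s.Trans D σ r ar ss) (hs' : s' ∈ ss) :
    (∃ b, s'.node = s.node ++ [b]) ∨ (s'.node = s.node ∧ s.pending = true ∧
      (s'.pending = true → s'.O.V.card < s.O.V.card)) := by
  cases ht with
  | red r ρ hr hp hρ =>
    obtain rfl := List.mem_singleton.1 hs'
    exact .inr ⟨rfl, hp, fun _ => Reduction.card_remove_lt hρ⟩
  | base b hp hn =>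
    obtain ⟨i, hi, rfl⟩ := List.mem_mapIdx.1 hs'
    exact .inl ⟨_, rfl⟩
  | nu Γ t φ ℓ₁ ℓ₀ hℓ hΓ hp hφ hn =>
    obtain rfl := List.mem_singleton.1 hs'
    exact .inr ⟨rfl, hp, fun h => by simp at h⟩
  | nuK Γ t φ κ ℓ₁ ℓ₀ hℓ hΓ hφ hn =>
    obtain rfl := List.mem_singleton.1 hs'
    exact .inl ⟨_, rfl⟩

namespace Run

variable {D : Coderivation plainSystem} {σ : ReductionStrategy} (R : Run D σ)

theorem node_step (j : ℕ) : (∃ b, (R.s (j + 1)).node = (R.s j).node ++ [b]) ∨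
    (R.s (j + 1)).node = (R.s j).node :=
  ((R.trans j).node (R.mem j)).imp_right And.left

/-- Induction on the size of the constraint handles reductions; after a `ν` step the call is not
pending, so the next step must leave the node. -/
theorem exists_advance (j : ℕ) : ∃ i, j ≤ i ∧ ∃ b, (R.s (i + 1)).node = (R.s i).node ++ [b] := by
  induction h : (R.s j).O.V.card using Nat.strong_induction_on generalizing j with
  | _ k ih =>
    rcases (R.trans j).node (R.mem j) with h1 | ⟨-, -, h2⟩
    · exact ⟨j, le_rfl, h1⟩
    · by_cases hp : (R.s (j + 1)).pending = true
      · obtain ⟨i, hi, hb⟩ := ih _ (h ▸ h2 hp) (j + 1) rfl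
        exact ⟨i, by omega, hb⟩
      · rcases (R.trans (j + 1)).node (R.mem (j + 1)) with h1 | ⟨-, h1, -⟩
        · exact ⟨j + 1, by omega, h1⟩
        · exact absurd h1 hp

/-- The depth of the current node of the coderivation. -/
def depth (j : ℕ) : ℕ := (R.s j).node.length

theorem node_prefix {i j : ℕ} (h : i ≤ j) : (R.s i).node <+: (R.s j).node := by
  induction j, h using Nat.le_induction with
  | base => exact List.prefix_rfl
  | succ j _ ih =>
    rcases R.node_step j with ⟨b, hb⟩ | hb
    · exact ih.trans (hb ▸ List.prefix_append _ _)
    · exact hb ▸ ih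

theorem depth_mono {i j : ℕ} (h : i ≤ j) : R.depth i ≤ R.depth j := (R.node_prefix h).length_le

theorem node_eq_of_depth_eq {i j : ℕ} (h : R.depth i = R.depth j) :
    (R.s i).node = (R.s j).node := by
  rcases le_total i j with hij | hij
  · exact (R.node_prefix hij).eq_of_length h
  · exact ((R.node_prefix hij).eq_of_length h.symm).symm

/-- The depth starts at `0`, grows by at most one per step and keeps growing, so every value is
attained and eventually left. The first advance after reaching a depth is the last call at that
depth. -/
theorem exists_depth_eq (i : ℕ) :
    ∃ j, R.depth j = i ∧ ∃ b, (R.s (j + 1)).node = (R.s j).node ++ [b] := by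
  induction i with
  | zero =>
    obtain ⟨j, -, b, hb⟩ := R.exists_advance 0
    classical
    have hex : ∃ j, ∃ b, (R.s (j + 1)).node = (R.s j).node ++ [b] := ⟨j, b, hb⟩
    refine ⟨Nat.find hex, ?_, Nat.find_spec hex⟩
    have : ∀ k ≤ Nat.find hex, R.depth k = 0 := by
      intro k
      induction k with
      | zero => exact fun _ => by rw [depth, R.node_zero]; rfl
      | succ k ih =>
        intro hk
        have h1 := (R.node_step k).resolve_left (Nat.find_min hex (by omega))
        rw [depth, h1]
        exact ih (by omega)
    exact this _ le_rfl
  | succ i ih =>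
    obtain ⟨j, hj, b, hb⟩ := ih
    obtain ⟨j', hj', b', hb'⟩ := R.exists_advance (j + 1)
    classical
    have hex : ∃ k, ∃ b, (R.s (j + 1 + k + 1)).node = (R.s (j + 1 + k)).node ++ [b] :=
      ⟨j' - (j + 1), b', by rwa [show j + 1 + (j' - (j + 1)) = j' by omega]⟩
    refine ⟨j + 1 + Nat.find hex, ?_, Nat.find_spec hex⟩
    have : ∀ k ≤ Nat.find hex, R.depth (j + 1 + k) = i + 1 := by
      intro k
      induction k with
      | zero =>
        intro _
        rw [Nat.add_zero, depth, hb, List.length_append, ← hj]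
        rfl
      | succ k ih =>
        intro hk
        have h1 := (R.node_step (j + 1 + k)).resolve_left (Nat.find_min hex (by omega))
        rw [← add_assoc, depth, h1]
        exact ih (by omega)
    exact this _ le_rfl

/-- The last call of the run at depth `i`. -/
noncomputable def last (i : ℕ) : ℕ := (R.exists_depth_eq i).choose

theorem depth_last (i : ℕ) : R.depth (R.last i) = i := (R.exists_depth_eq i).choose_spec.1

theorem node_last (i : ℕ) :
    ∃ b, (R.s (R.last i + 1)).node = (R.s (R.last i)).node ++ [b] :=
  (R.exists_depth_eq i).choose_spec.2

theorem le_last {i j : ℕ} (hij : R.depth j ≤ i) : j ≤ R.last i := by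
  by_contra! h
  have h1 := R.depth_mono (show R.last i + 1 ≤ j from h)
  obtain ⟨b, hb⟩ := R.node_last i
  have h2 := R.depth_last i
  rw [depth] at h2
  rw [depth, hb, List.length_append, h2] at h1
  simp at h1
  omega

theorem node_last_ne (i : ℕ) : (R.s (R.last i + 1)).node ≠ (R.s (R.last i)).node := by
  obtain ⟨b, hb⟩ := R.node_last i
  simp [hb]

/-- The branch of the coderivation that is followed by the run. -/
noncomputable def branch (i : ℕ) : List Bool := (R.s (R.last i)).node

theorem branch_depth (j : ℕ) : R.branch (R.depth j) = (R.s j).node :=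
  R.node_eq_of_depth_eq (R.depth_last _)

theorem label_branch (j : ℕ) : D.label (R.branch (R.depth j)) = some (R.r j) := by
  rw [R.branch_depth, (R.wf j).label]

theorem isInfiniteBranch_branch : IsInfiniteBranch D.label R.branch where
  zero := List.eq_nil_of_length_eq_zero (R.depth_last 0)
  succ i := by
    obtain ⟨b, hb⟩ := R.node_last i
    refine ⟨b, ?_⟩
    have : R.depth (R.last i + 1) = i + 1 := by
      have h := R.depth_last i
      rw [depth] at h
      rw [depth, hb, List.length_append, h]
      rfl
    rw [← this, R.branch_depth, hb]
    rfl
  mem i := by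
    rw [branch, (R.wf _).label]
    simp

theorem depth_succ (j : ℕ) :
    ((R.s (j + 1)).node = (R.s j).node ∧ R.depth (j + 1) = R.depth j) ∨
      ((R.s (j + 1)).node ≠ (R.s j).node ∧ R.depth (j + 1) = R.depth j + 1) := by
  rcases R.node_step j with ⟨b, hb⟩ | hb
  · exact .inr ⟨by simp [hb], by simp [depth, hb]⟩
  · exact .inl ⟨hb, by simp [depth, hb]⟩

/-- The annotated sequent of a call. -/
def seq (j : ℕ) : ASequent := annotateList (R.r j).concl (R.s j).ℓ

theorem bounded {N : ℕ} (hN : ∀ Γ ∈ D.sequents, (Γ.map Fml.nuCount).sum ≤ N) (j : ℕ) :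
    (R.s j).Bounded N := by
  induction j with
  | zero =>
    rw [State.Bounded, R.O_zero]
    simp [Constraint.empty]
  | succ j ih => exact (R.trans j).bounded (R.wf j) (R.mem j) hN ih

/-- A trace of the coderivation is followed by the annotated formulas of the run. -/
theorem exists_traceStep (hid : D.HasAtomicIdentities) {k : ℕ} {p : ℕ → ℕ}
    (hp : IsTrace D.label R.branch k p) {j : ℕ} (hj : k ≤ R.depth j) :
    ∃ A A', (R.seq j)[p (R.depth j)]? = some A ∧
      (R.seq (j + 1))[p (R.depth (j + 1))]? = some A' ∧
      State.TraceStep (R.s j) (R.s (j + 1)) (R.r j) (p (R.depth j)) A A' := by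
  obtain ⟨r, hr, hanc⟩ := hp _ hj
  rw [R.label_branch] at hr
  cases hr
  refine (R.trans j).exists_traceStep hid (R.wf j) (R.mem j) (R.wf (j + 1)) hanc
    (fun h => ?_) (fun h => ?_)
  · rcases R.depth_succ j with ⟨-, h1⟩ | ⟨h1, -⟩
    · rw [h1]
    · exact absurd h h1
  · rcases R.depth_succ j with ⟨h1, -⟩ | ⟨-, h1⟩
    · exact absurd h1 h
    · rw [h1]

theorem mem_of_getElem? {j q : ℕ} {A : AFormula} (h : (R.seq j)[q]? = some A) {κ : OrdVar}
    (hκ : κ ∈ A.ordVars) : κ ∈ seqOrdVars (R.seq j) ∧ κ ∈ (R.s j).O.V :=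
  have h1 : κ ∈ seqOrdVars (R.seq j) := ⟨A, List.mem_of_getElem? h, hκ⟩
  ⟨h1, (R.wf j).ext.2 κ h1⟩

/-- If from depth `k` on all unfolded terms have size at least `n` and there are infinitely many
unfoldings, then the mark occurs in the marked formulas of the trace. -/
theorem mem_ordVars_of_marked (hid : D.HasAtomicIdentities) {k n : ℕ} {p : ℕ → ℕ}
    (hp : IsTrace D.label R.branch k p)
    (hmin : ∀ j S, k ≤ R.depth j → (R.r j).Unfolds (p (R.depth j)) S → n ≤ S.size)
    (hinf : ∀ N, ∃ i, N ≤ i ∧ ∃ S, (R.r (R.last i)).Unfolds (p i) S)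
    {j : ℕ} (hj : k ≤ R.depth j) {A : AFormula}
    (hA : (R.seq j)[p (R.depth j)]? = some A) {κ : OrdVar} (hm : A.Marked κ n) :
    κ ∈ A.ordVars := by
  by_contra hκ
  -- Once absent, the mark never returns, so the next unfolding on the trace would be of a term
  -- smaller than `n`.
  have key : ∀ j', j ≤ j' → ∃ A', (R.seq j')[p (R.depth j')]? = some A' ∧ A'.Marked κ n ∧
      κ ∉ A'.ordVars := by
    intro j' hj'
    induction j', hj' using Nat.le_induction with
    | base => exact ⟨A, hA, hm, hκ⟩
    | succ j' hj' ih =>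
      obtain ⟨B, hB, hBm, hBκ⟩ := ih
      have hk := hj.trans (R.depth_mono hj')
      obtain ⟨B', A', h1, h2, h3⟩ := R.exists_traceStep hid hp hk
      cases hB.symm.trans h1
      exact ⟨A', h2, (h3.of_notMem_ordVars (fun S => hmin j' S hk) hBm hBκ).1⟩
  obtain ⟨i, hi, S, hS⟩ := hinf (R.depth j)
  have hle := R.le_last hi
  obtain ⟨B, hB, hBm, hBκ⟩ := key _ hle
  have hk := hj.trans (R.depth_mono hle)
  obtain ⟨B', A', h1, h2, h3⟩ := R.exists_traceStep hid hp hk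
  cases hB.symm.trans h1
  refine (h3.of_notMem_ordVars (fun S => hmin _ S hk) hBm hBκ).2 (R.node_last_ne i) S ?_
  rwa [R.depth_last]

end Run

/-- From some point on, only set terms that progress infinitely often are unfolded on a trace of a
coderivation with finitely many sequents. -/
theorem exists_forall_unfolds_le {D : Coderivation plainSystem} (hfin : D.sequents.Finite)
    {β : ℕ → List Bool} {k n : ℕ} {p : ℕ → ℕ}
    (hn : ∀ S, ProgressesInfinitelyOften D.label β k p S → n ≤ S.size) :
    ∃ K, k ≤ K ∧ ∀ i, K ≤ i → ∀ r S, D.label (β i) = some r → r.Unfolds (p i) S → n ≤ S.size := by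
  -- Every unfolded term occurs in one of the finitely many sequents, so only finitely many terms
  -- are concerned.
  have hfinS : {S : STm Empty 0 0 | ∃ Γ ∈ D.sequents, ∃ t, S.toFml t ∈ Γ}.Finite := by
    let f : Formula → STm Empty 0 0 := fun φ => match φ with
      | .mu a _ ψ => .mu a ψ
      | .nu a _ ψ => .nu a ψ
      -- An arbitrary value: only formulas of the form `t ∈ S` are used.
      | _ => .mu none (.eq .zero .zero)
    refine (hfin.biUnion fun Γ _ => (List.finite_toSet Γ).image f).subset ?_
    rintro S ⟨Γ, hΓ, t, ht⟩
    refine Set.mem_biUnion hΓ ⟨S.toFml t, ht, ?_⟩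
    cases S with
    | var X => exact X.elim0
    | mu a ψ => rfl
    | nu a ψ => rfl
  have hK : ∀ S : STm Empty 0 0, ∃ K, S.size < n → ∀ i, K ≤ i → ∀ r, D.label (β i) = some r →
      ¬ r.Unfolds (p i) S := by
    intro S
    by_cases hS : ProgressesInfinitelyOften D.label β k p S
    · exact ⟨0, fun h => absurd (hn S hS) h.not_ge⟩
    · simp only [ProgressesInfinitelyOften, not_forall, not_exists, not_and] at hS
      obtain ⟨N, hN⟩ := hS
      exact ⟨max N k, fun _ i hi r hr => hN i (by omega) (by omega) r hr⟩
  choose K hK using hK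
  obtain ⟨M, hM⟩ := (hfinS.image K).bddAbove
  refine ⟨max M k, by omega, fun i hi r S hr hS => ?_⟩
  by_contra! h
  obtain ⟨t, ht⟩ := hS.exists_mem
  have : K S ≤ M := hM ⟨S, ⟨_, ⟨_, _, hr, rfl⟩, t, ht⟩, rfl⟩
  exact hK S h i (by omega) r hr hS

/-! ### Following the mark along a run -/

namespace Run

variable {D : Coderivation plainSystem} {σ : ReductionStrategy} (R : Run D σ)

/-- A mark that is followed along the run, where `n` is the minimal size of the terms unfolded. -/
theorem exists_marks (hid : D.HasAtomicIdentities) {k n : ℕ} {p : ℕ → ℕ}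
    (hp : IsTrace D.label R.branch k p)
    (hmin : ∀ j S, k ≤ R.depth j → (R.r j).Unfolds (p (R.depth j)) S → n ≤ S.size)
    (hinf : ∀ N, ∃ i, N ≤ i ∧ ∃ φ, (R.r (R.last i)).Unfolds (p i) (.nu none φ) ∧
      φ.size + 3 = n) :
    ∃ (a : ℕ) (κ : ℕ → OrdVar),
      (∀ j, κ j ∈ seqOrdVars (R.seq (a + j)) ∧ κ j ∈ (R.s (a + j)).O.V) ∧
      (∀ j, κ (j + 1) = κ j ∨ (R.s (a + j + 1)).O.lt (κ (j + 1)) (κ j)) ∧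
      ∀ N, ∃ j, N ≤ j ∧ (R.s (a + j + 1)).O.lt (κ (j + 1)) (κ j) := by
  have hocc := fun {j A κ} => R.mem_ordVars_of_marked hid hp hmin
    (fun N => (hinf N).imp fun i h => ⟨h.1, h.2.imp' _ fun φ h => h.1⟩) (j := j) (A := A) (κ := κ)
  -- The first mark is the fresh annotation introduced at this unfolding of a `ν`-term of size `n`;
  -- the marks therefore start at `R.last i₀ + 1`.
  obtain ⟨i₀, hi₀, φ₀, hu₀, hφ₀⟩ := hinf k
  have hk₀ : k ≤ R.depth (R.last i₀) := by rwa [R.depth_last]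
  have hdep : ∀ j, k ≤ R.depth (R.last i₀ + 1 + j) := fun j =>
    hk₀.trans (R.depth_mono (by omega))
  let Inv : ℕ → OrdVar → Prop := fun j κ => ∃ A,
    (R.seq (R.last i₀ + 1 + j))[p (R.depth (R.last i₀ + 1 + j))]? = some A ∧ A.Marked κ n
  have hinv : ∀ {j κ}, Inv j κ → κ ∈ seqOrdVars (R.seq (R.last i₀ + 1 + j)) ∧
      κ ∈ (R.s (R.last i₀ + 1 + j)).O.V := by
    rintro j κ ⟨A, hA, hm⟩
    exact R.mem_of_getElem? hA (hocc (hdep j) hA hm)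
  have hstart : ∃ κ, Inv 0 κ := by
    obtain ⟨A, A', h1, h2, h3⟩ := R.exists_traceStep hid hp hk₀
    have hu : (R.r (R.last i₀)).Unfolds (p (R.depth (R.last i₀))) (.nu none φ₀) := by
      rwa [R.depth_last]
    cases h3 with
    | tame h h' => exact (h' (R.node_last_ne i₀) _ hu).elim
    | mu t φ ψ hu' => cases hu.unique hu'
    | nu t φ ψ hu' hs e e' hnode => exact absurd hnode (R.node_last_ne i₀)
    | nuK κ t φ ψ hu' hs e e' hO =>
      cases hu.unique hu'
      refine ⟨(R.s (R.last i₀)).O.fresh, A', h2, ?_⟩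
      rw [e', ← hφ₀, ← hs]
      refine Fml.marked_plug_of_fresh t fun h => (R.s (R.last i₀)).O.fresh_notMem ?_
      exact (R.mem_of_getElem? h1 (by rw [e]; exact .inr h)).2
  -- The last clause records that leaving a node at which a `ν`-term of size `n` is unfolded forces
  -- a strict descent.
  have hnext : ∀ j κ, Inv j κ → ∃ κ', Inv (j + 1) κ' ∧
      (κ' = κ ∨ (R.s (R.last i₀ + 1 + j + 1)).O.lt κ' κ) ∧
      (((R.s (R.last i₀ + 1 + j + 1)).node ≠ (R.s (R.last i₀ + 1 + j)).node ∧
        ∃ φ, (R.r (R.last i₀ + 1 + j)).Unfolds (p (R.depth (R.last i₀ + 1 + j))) (.nu none φ) ∧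
          φ.size + 3 = n) → (R.s (R.last i₀ + 1 + j + 1)).O.lt κ' κ) := by
    rintro j κ ⟨A, hA, hm⟩
    obtain ⟨B, A', h1, h2, h3⟩ := R.exists_traceStep hid hp (hdep j)
    cases hA.symm.trans h1
    obtain ⟨κ', h4, h5, h6⟩ := h3.marked (fun κ hκ => (R.mem_of_getElem? hA hκ).2) hm
      (hocc (hdep j) hA hm)
    have hlt : (R.s (R.last i₀ + 1 + j + 1)).O = (R.s (R.last i₀ + 1 + j)).O.addChild κ
        (R.s (R.last i₀ + 1 + j)).O.fresh ∧ κ' = (R.s (R.last i₀ + 1 + j)).O.fresh →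
        (R.s (R.last i₀ + 1 + j + 1)).O.lt κ' κ := by
      rintro ⟨hO, rfl⟩
      rw [hO]
      exact .inr ⟨rfl, .inr rfl⟩
    exact ⟨κ', ⟨A', h2, h4⟩, h5.imp_right hlt, fun h => hlt (h6 h)⟩
  obtain ⟨κ₀, hκ₀⟩ := hstart
  choose! f hf₁ hf₂ hf₃ using hnext
  let κ : ℕ → OrdVar := fun j => Nat.rec κ₀ (fun j x => f j x) j
  have hκ : ∀ j, Inv j (κ j) := by
    intro j
    induction j with
    | zero => exact hκ₀
    | succ j ih => exact hf₁ j _ ih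
  refine ⟨R.last i₀ + 1, κ, fun j => hinv (hκ j), fun j => hf₂ j _ (hκ j), fun N => ?_⟩
  -- An unfolding at depth `i`, not smaller than the current depth, takes place at `R.last i`, hence
  -- at or after the given time.
  obtain ⟨i, hi, φ, hu, hφ⟩ := hinf (R.depth (R.last i₀ + 1 + N))
  obtain ⟨m, hm⟩ := Nat.exists_eq_add_of_le (R.le_last hi)
  have hm' : R.last i₀ + 1 + (N + m) = R.last i := by omega
  refine ⟨N + m, by omega, hf₃ (N + m) _ (hκ _) ?_⟩
  rw [hm', R.depth_last]
  exact ⟨R.node_last_ne i, φ, hu, hφ⟩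

/-- Every run through a progressing proof with finitely many sequents has a stable reset variable. -/
theorem exists_stable_reset (hid : D.HasAtomicIdentities) (hfin : D.sequents.Finite)
    (hprog : D.IsProgressing) :
    ∃ c, (∃ J, ∀ j, J ≤ j → c ∈ (R.s j).O.V) ∧
      ∀ N, ∃ j, N ≤ j ∧ ∃ O Γ, R.ar j = .red O Γ (.rs c) := by
  obtain ⟨k, p, hp, φ, hφ, hmin⟩ := hprog _ R.isInfiniteBranch_branch
  obtain ⟨K, hkK, hK⟩ := exists_forall_unfolds_le hfin hmin
  obtain ⟨N, hN⟩ := (hfin.image fun Γ => (Γ.map Fml.nuCount).sum).bddAbove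
  obtain ⟨a, κ, hκ, hstep, hinf⟩ := R.exists_marks (k := K) hid (fun i hi => hp i (hkK.trans hi))
    (fun j S hj hS => hK _ hj _ S (R.label_branch j) hS) (fun N => by
      obtain ⟨i, hi, -, r, hr, hu⟩ := hφ N
      rw [branch, (R.wf _).label] at hr
      cases hr
      exact ⟨i, hi, φ, hu, rfl⟩)
  have hc := fun j => (R.trans j).constraint (R.wf j) (R.mem j)
  have hrem : ∀ j d, (κ j = d ∨ (R.s (a + j)).O.lt (κ j) d) → d ∉ (R.s (a + j + 1)).O.V →
      ∃ c, (∃ O Γ, R.ar (a + j) = .red O Γ (.rs c)) ∧ d ∈ (R.s (a + j)).O.children c := by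
    intro j d hd hd'
    have hdV : d ∈ (R.s (a + j)).O.V := by
      rcases hd with rfl | hd
      · exact (hκ j).2
      · exact ((R.wf _).ext.1.mem _ _ hd).2
    obtain ⟨ρ, hρ, hdρ⟩ := (hc (a + j)).2.2 d hdV hd'
    cases ρ with
    | rs c => exact ⟨c, ⟨_, _, hρ⟩, hdρ⟩
    -- A pruned variable has no occurring descendant, but the followed variable occurs and lies at
    -- or below `d`. So only resets remove members of the chain.
    | pr =>
      classical
      exact absurd (hκ j).1 ((Finset.mem_filter.1 hdρ).2 _ (hκ j).2 (hd.symm.imp_right id))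
  obtain ⟨c, ⟨J, hJ⟩, hreset⟩ := Constraint.exists_stable_reset
    (O := fun j => (R.s (a + j)).O) (κ := κ)
    (reset := fun j c => ∃ O Γ, R.ar (a + j) = .red O Γ (.rs c)) (M := 2 * N + 2)
    (fun j => (R.wf _).ext.1) (fun j => (hc (a + j)).1) (fun j => (hc (a + j)).2.1)
    (fun j => (hκ j).2) hstep hinf hrem
    fun j => (R.bounded (fun Γ hΓ => hN ⟨Γ, hΓ, rfl⟩) _).2
  refine ⟨c, ⟨a + J, fun j hj => ?_⟩, fun N => ?_⟩
  · obtain ⟨m, rfl⟩ := Nat.exists_eq_add_of_le hj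
    exact add_assoc a J m ▸ hJ (J + m) (by omega)
  · obtain ⟨j, hj, h⟩ := hreset N
    exact ⟨a + j, by omega, h⟩

end Run

end MuPA

theorem mainTheorem8 (D : MuPA.Coderivation MuPA.plainSystem)
    (hprog : D.IsProgressing) (hfin : D.sequents.Finite) (hid : D.HasAtomicIdentities)
    (σ : MuPA.ReductionStrategy) :
    MuPA.IsResetProof (D.translate σ MuPA.Constraint.empty (D.conclusion.map MuPA.Fml.star)) := by
  obtain ⟨r₀, h₀⟩ := MuPA.Coderivation.exists_wf_initial D
  refine ⟨MuPA.Coderivation.isCoderivation_translate hid h₀, fun β hβ => ?_⟩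
  obtain ⟨R, hR⟩ := hβ.exists_run hid h₀
  obtain ⟨c, ⟨J, hJ⟩, hreset⟩ := R.exists_stable_reset hid hfin hprog
  refine ⟨c, ⟨J, fun j hj => ⟨_, hR j, ?_⟩⟩, fun N => ?_⟩
  · rw [(R.trans j).concl_eq hid (R.wf j)]
    exact hJ j hj
  · obtain ⟨j, hj, O, Γ, h⟩ := hreset N
    exact ⟨j, hj, O, Γ, by rw [hR j, h]⟩
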